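/- Let $m-1\ge p\ge 2$, let $\Psi:\mathbb R^m\to\mathbb R^p$ be a polynomial map, $V=\Psi^{-1}(0)$, and for $R>0$ let $B_R$ and $S_R^{m-1}$ be the open ball and the sphere of radius $R$ centred at the origin of $\mathbb R^m$, and $K_R=V\cap S_R^{m-1}$. Definitions. - The dimension of a (semi-)analytic set is the largest dimension of a smooth submanifold contained in it. $V$ has codimension $p$ at infinity if, for all sufficiently large $R$, $V\setminus B_R$ has dimension $m-p$, and, for every irreducible component $W$ of the real algebraic set $V$, $W\setminus B_R$ has dimension $m-p$ for all sufficiently large $R$. - Let $\rho(x)=\|x\|$. The Milnor set $M(\Psi)$ is the set of $x\in\mathbb R^m$ at which the differential of $(\rho,\Psi)$ has rank less than $p+1$. The Milnor set $M(\Psi/\|\Psi\|)$ is the set of $x\in\mathbb R^m\setminus V$ at which the differential of $(\rho,\Psi/\|\Psi\|):\mathbb R^m\setminus V\to\mathbb R\times S_1^{p-1}$ has rank less than $p$. (At $x=0$ the differential of $\rho$ is read as that of $\rho^2/2$.) - A pair $(K,\theta)$ is an open book with singular binding on an analytic manifold $M$ of dimension $m-1$ if $K\subset M$ is a real analytic subvariety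 of codimension $p$ in $M$, $\theta:M\setminus K\to S_1^{p-1}$ is a (surjective) locally trivial $C^\infty$ fibration, and $K$ has an open neighbourhood $N$ in $M$ with a (surjective) locally trivial $C^\infty$ fibration $h:N\setminus K\to B^p\setminus\{0\}$ onto a punctured open ball centred at the origin of $\mathbb R^p$ such that $\theta=h/\|h\|$ on $N\setminus K$. - The open books $(K_s,\Psi/\|\Psi\|)$ on $S_s^{m-1}$ are $C^\infty$ isotopic for $s\in[R,R']$ if there are diffeomorphisms $\Phi_s:S_R^{m-1}\setminus K_R\to S_s^{m-1}\setminus K_s$, $s\in[R,R']$, which together with their inverses are jointly $C^\infty$ in $(s,x)$, such that $\Phi_R=\mathrm{id}$ and $\frac{\Psi}{\|\Psi\|}\circ\Phi_s=\frac{\Psi}{\|\Psi\|}$, and if there are neighbourhoods $N_s$ of $K_s$ and fibrations $h_s:N_s\setminus K_s\to B^p\setminus\{0\}$ as in the definition of open book, over one and the same ball $B^p$, with $\Phi_s(N_R\setminus K_R)=N_s\setminus K_s$ and $h_s\circ\Phi_s=h_R$ on $N_R\setminus K_R$. Theorem. Assume that $V$ has codimension $p$ at infinity and that $\overline{M(\Psi)\setminus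 V}\cap V$ is bounded. Then the following are equivalent: (a) there is $R_0>0$ such that $(K_R,\Psi/\|\Psi\|)$ is an open book with singular binding on $S_R^{m-1}$ for every $R\ge R_0$, and such that for all $R'\ge R\ge R_0$ the open books $(K_s,\Psi/\|\Psi\|)$ are $C^\infty$ isotopic for $s\in[R,R']$; (b) $M(\Psi/\|\Psi\|)$ is bounded. -/

import Mathlib

open Set Filter Topology Metric
open scoped ContDiff

noncomputable section

namespace SingularOpenBook

/-! ### Real algebraic sets, dimension, codimension at infinity -/

/-- The common zero set in Euclidean space of a set of real polynomials. -/
def zeroSet {m : ℕ} (S : Set (MvPolynomial (Fin m) ℝ)) : Set (EuclideanSpace ℝ (Fin m)) :=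
  {x | ∀ f ∈ S, MvPolynomial.eval (fun i => x i) f = 0}

def IsAlgebraicSet {m : ℕ} (W : Set (EuclideanSpace ℝ (Fin m))) : Prop :=
  ∃ S : Set (MvPolynomial (Fin m) ℝ), W = zeroSet S

/-- Irreducible real algebraic sets: nonempty, and not the union of two proper algebraic
subsets. -/
def IsIrreducibleAlgebraic {m : ℕ} (W : Set (EuclideanSpace ℝ (Fin m))) : Prop :=
  IsAlgebraicSet W ∧ W.Nonempty ∧
    ∀ A B : Set (EuclideanSpace ℝ (Fin m)), IsAlgebraicSet A → IsAlgebraicSet B →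
      W ⊆ A ∪ B → W ⊆ A ∨ W ⊆ B

/-- `W` is an irreducible component of the algebraic set `V`. -/
def IsIrreducibleComponent {m : ℕ} (V W : Set (EuclideanSpace ℝ (Fin m))) : Prop :=
  Maximal (fun Z => IsIrreducibleAlgebraic Z ∧ Z ⊆ V) W

/-- `A` contains a (nonempty) smoothly immersed piece of dimension `d`. -/
def ContainsPiece {m : ℕ} (A : Set (EuclideanSpace ℝ (Fin m))) (d : ℕ) : Prop :=
  ∃ (U : Set (EuclideanSpace ℝ (Fin d)))
    (f : EuclideanSpace ℝ (Fin d) → EuclideanSpace ℝ (Fin m)),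
    IsOpen U ∧ U.Nonempty ∧ ContDiffOn ℝ ∞ f U ∧
      (∀ u ∈ U, Function.Injective (fderiv ℝ f u)) ∧ MapsTo f U A

/-- The dimension of a (semi-analytic) set is `d`: the largest dimension of a smooth
submanifold contained in it. (An immersion is locally an embedding, so immersed pieces may be
used.) The empty set has no dimension. -/
def HasDim {m : ℕ} (A : Set (EuclideanSpace ℝ (Fin m))) (d : ℕ) : Prop :=
  ContainsPiece A d ∧ ∀ e : ℕ, ContainsPiece A e → e ≤ d

/-- `A` has codimension `p` in an ambient manifold of dimension `n`. -/
def HasCodim {m : ℕ} (n p : ℕ) (A : Set (EuclideanSpace ℝ (Fin m))) : Prop :=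
  ∃ d : ℕ, d + p = n ∧ HasDim A d

/-- The algebraic set `V` has codimension `p` at infinity: for all large `R` the part of `V`
outside the open ball of radius `R` has codimension `p`, and so does the part outside that ball
of every irreducible component of `V`. -/
def HasCodimAtInfinity {m : ℕ} (p : ℕ) (V : Set (EuclideanSpace ℝ (Fin m))) : Prop :=
  (∀ᶠ R : ℝ in atTop, HasCodim m p (V \ ball 0 R)) ∧
    ∀ W, IsIrreducibleComponent V W → ∀ᶠ R : ℝ in atTop, HasCodim m p (W \ ball 0 R)

/-! ### Polynomial maps and Milnor sets -/

/-- The polynomial map `ℝᵐ → ℝᵖ` with the given components. -/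
def polyMap {m p : ℕ} (P : Fin p → MvPolynomial (Fin m) ℝ) :
    EuclideanSpace ℝ (Fin m) → EuclideanSpace ℝ (Fin p) :=
  fun x => WithLp.toLp 2 (fun i => MvPolynomial.eval (fun j => x j) (P i))

/-- The zero locus `V` of a map. -/
def zeroLocus {m p : ℕ} (Ψ : EuclideanSpace ℝ (Fin m) → EuclideanSpace ℝ (Fin p)) :
    Set (EuclideanSpace ℝ (Fin m)) :=
  {x | Ψ x = 0}

/-- The map `Ψ / ‖Ψ‖`, meaningful outside the zero locus of `Ψ`. -/
def normalized {m p : ℕ} (Ψ : EuclideanSpace ℝ (Fin m) → EuclideanSpace ℝ (Fin p)) :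
    EuclideanSpace ℝ (Fin m) → EuclideanSpace ℝ (Fin p) :=
  fun x => ‖Ψ x‖⁻¹ • Ψ x

/-- The Milnor set, with respect to the Euclidean distance `ρ` to the origin, of a map `ψ` on the
open set `U` with values in a `q`-dimensional submanifold of `ℝᵖ`: the points of `U` where the
fibres of `ψ` are not transverse to the spheres, i.e. where the differential of `(ρ, ψ)` does not
have the maximal rank `1 + q`. The functional `⟪x, ·⟫` is the differential of `ρ² / 2`. -/
def milnorSet {m p : ℕ} (U : Set (EuclideanSpace ℝ (Fin m))) (q : ℕ)
    (ψ : EuclideanSpace ℝ (Fin m) → EuclideanSpace ℝ (Fin p)) :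
    Set (EuclideanSpace ℝ (Fin m)) :=
  {x | x ∈ U ∧
    Module.finrank ℝ
      (LinearMap.range (((innerSL ℝ x).prod (fderiv ℝ ψ x) :
        EuclideanSpace ℝ (Fin m) →L[ℝ] ℝ × EuclideanSpace ℝ (Fin p)) :
        EuclideanSpace ℝ (Fin m) →ₗ[ℝ] ℝ × EuclideanSpace ℝ (Fin p))) < 1 + q}

/-! ### Smooth fibrations between submanifolds of Euclidean spaces -/

/-- `f` is a `C^∞` diffeomorphism from `A` onto `B`, with inverse `g`. On an embedded submanifold
(possibly with boundary) `ContDiffOn` is the same as smoothness in the sense of manifolds. -/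
structure IsDiffeo {E F : Type*} [NormedAddCommGroup E] [NormedSpace ℝ E]
    [NormedAddCommGroup F] [NormedSpace ℝ F]
    (f : E → F) (g : F → E) (A : Set E) (B : Set F) : Prop where
  smooth : ContDiffOn ℝ ∞ f A
  smooth_inv : ContDiffOn ℝ ∞ g B
  mapsTo : MapsTo f A B
  mapsTo_inv : MapsTo g B A
  leftInv : LeftInvOn g f A
  rightInv : RightInvOn g f B

/-- `π : X → B` is a locally trivial `C^∞` fibration of submanifolds: every `b ∈ B` has a
neighbourhood `U` in `B` with a diffeomorphism `π⁻¹(U) ≅ U × π⁻¹(b)` over `U`. -/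
structure IsSmoothFibration {E F : Type*} [NormedAddCommGroup E] [NormedSpace ℝ E]
    [NormedAddCommGroup F] [NormedSpace ℝ F]
    (π : E → F) (X : Set E) (B : Set F) : Prop where
  smooth : ContDiffOn ℝ ∞ π X
  mapsTo : MapsTo π X B
  surjOn : SurjOn π X B
  locallyTrivial : ∀ b ∈ B, ∃ U : Set F, IsOpen U ∧ b ∈ U ∧
    ∃ (r : E → E) (g : F × E → E),
      IsDiffeo (fun x => (π x, r x)) g (X ∩ π ⁻¹' U) ((B ∩ U) ×ˢ (X ∩ π ⁻¹' {b}))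

/-! ### Open books with singular binding -/

/-- `K` is a real analytic subvariety of `M`: a subset which near every point of `M` is the zero
set in `M` of finitely many analytic functions. -/
def IsAnalyticSubvariety {m : ℕ} (M K : Set (EuclideanSpace ℝ (Fin m))) : Prop :=
  K ⊆ M ∧ ∀ x ∈ M, ∃ U : Set (EuclideanSpace ℝ (Fin m)), IsOpen U ∧ x ∈ U ∧
    ∃ (k : ℕ) (f : EuclideanSpace ℝ (Fin m) → EuclideanSpace ℝ (Fin k)),
      AnalyticOnNhd ℝ f U ∧ K ∩ U = {y | y ∈ M ∩ U ∧ f y = 0}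

/-- `N` is an (open) neighbourhood of `K` in `M` and `h` is a locally trivial fibration of `N \ K`
over the punctured open ball of radius `δ` in `ℝᵖ`, such that `θ = h / ‖h‖` on `N \ K`. -/
structure IsBindingTube {m p : ℕ} (M K : Set (EuclideanSpace ℝ (Fin m)))
    (θ : EuclideanSpace ℝ (Fin m) → EuclideanSpace ℝ (Fin p))
    (N : Set (EuclideanSpace ℝ (Fin m))) (δ : ℝ)
    (h : EuclideanSpace ℝ (Fin m) → EuclideanSpace ℝ (Fin p)) : Prop where
  nhd : ∃ O : Set (EuclideanSpace ℝ (Fin m)), IsOpen O ∧ K ⊆ O ∧ N = M ∩ O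
  radius_pos : 0 < δ
  fibration : IsSmoothFibration h (N \ K) (ball 0 δ \ {0})
  radial : ∀ x ∈ N \ K, θ x = ‖h x‖⁻¹ • h x

/-- `(K, θ)` is a (higher) open book structure with singular binding `K` on the analytic manifold
`M ⊆ ℝᵐ` of dimension `n`. -/
structure IsSingularOpenBook {m p : ℕ} (n : ℕ) (M K : Set (EuclideanSpace ℝ (Fin m)))
    (θ : EuclideanSpace ℝ (Fin m) → EuclideanSpace ℝ (Fin p)) : Prop where
  two_le : 2 ≤ p
  le_dim : p ≤ n
  subvariety : IsAnalyticSubvariety M K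
  codim : HasCodim n p K
  fibration : IsSmoothFibration θ (M \ K) (sphere 0 1)
  tube : ∃ (N : Set (EuclideanSpace ℝ (Fin m))) (δ : ℝ)
    (h : EuclideanSpace ℝ (Fin m) → EuclideanSpace ℝ (Fin p)), IsBindingTube M K θ N δ h

/-- For a family `(K s, θ)` on manifolds `M s`, `a ≤ s ≤ b`: a `C^∞` isotopy of open books with
singular binding, i.e. a family of diffeomorphisms `Φ s : M a \ K a → M s \ K s`, smooth in
`(s, x)` together with the inverses, with `Φ a = id` and `θ ∘ Φ s = θ`, which also identifies the
fibrations of suitable punctured neighbourhoods `N s \ K s` of the bindings. (As the bindings are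
singular, the diffeomorphisms are between their complements.) -/
def IsotopicAlong {m p : ℕ} (M K : ℝ → Set (EuclideanSpace ℝ (Fin m)))
    (θ : EuclideanSpace ℝ (Fin m) → EuclideanSpace ℝ (Fin p)) (a b : ℝ) : Prop :=
  ∃ (Φ Φinv : ℝ × EuclideanSpace ℝ (Fin m) → EuclideanSpace ℝ (Fin m))
    (N : ℝ → Set (EuclideanSpace ℝ (Fin m))) (δ : ℝ)
    (h : ℝ → EuclideanSpace ℝ (Fin m) → EuclideanSpace ℝ (Fin p)),
    IsDiffeo (fun q : ℝ × EuclideanSpace ℝ (Fin m) => (q.1, Φ q))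
      (fun q : ℝ × EuclideanSpace ℝ (Fin m) => (q.1, Φinv q))
      (Icc a b ×ˢ (M a \ K a)) {q | q.1 ∈ Icc a b ∧ q.2 ∈ M q.1 \ K q.1} ∧
    (∀ x ∈ M a \ K a, Φ (a, x) = x) ∧
    (∀ s ∈ Icc a b, ∀ x ∈ M a \ K a, θ (Φ (s, x)) = θ x) ∧
    ∀ s ∈ Icc a b,
      IsBindingTube (M s) (K s) θ (N s) δ (h s) ∧
      (fun x => Φ (s, x)) '' (N a \ K a) = N s \ K s ∧
      ∀ x ∈ N a \ K a, h s (Φ (s, x)) = h a x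

/-- The link `K_R` of the zero locus on the sphere of radius `R`. -/
def link {m p : ℕ} (Ψ : EuclideanSpace ℝ (Fin m) → EuclideanSpace ℝ (Fin p)) (R : ℝ) :
    Set (EuclideanSpace ℝ (Fin m)) :=
  zeroLocus Ψ ∩ sphere 0 R

/-- For all large enough radii `R`, the pair `(K_R, Ψ / ‖Ψ‖)` is an open book with singular
binding on the sphere of radius `R`, and these open books for different `R` are `C^∞` isotopic. -/
def InducesOpenBookAtInfinity {m p : ℕ}
    (Ψ : EuclideanSpace ℝ (Fin m) → EuclideanSpace ℝ (Fin p)) : Prop :=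
  ∃ R₀ : ℝ, 0 < R₀ ∧
    (∀ R : ℝ, R₀ ≤ R →
      IsSingularOpenBook (m - 1) (sphere 0 R) (link Ψ R) (normalized Ψ)) ∧
    ∀ R R' : ℝ, R₀ ≤ R → R ≤ R' →
      IsotopicAlong (fun s => sphere 0 s) (link Ψ) (normalized Ψ) R R'

end SingularOpenBook

end

noncomputable section

namespace SingularOpenBook

/-! ### Smooth dependence of solutions of differential equations on the initial value -/

section Superposition

universe u

variable {K : Type*} [TopologicalSpace K] [CompactSpace K]

/-- Pointwise application of a family of operators to a family of vectors. -/
def pointwiseApply (K : Type*) [TopologicalSpace K] [CompactSpace K]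
    (E F : Type*) [NormedAddCommGroup E] [NormedSpace ℝ E]
    [NormedAddCommGroup F] [NormedSpace ℝ F] :
    C(K, E →L[ℝ] F) →L[ℝ] C(K, E) →L[ℝ] C(K, F) :=
  LinearMap.mkContinuous₂
    (LinearMap.mk₂ ℝ (fun (A : C(K, E →L[ℝ] F)) (η : C(K, E)) => (⟨fun s => A s (η s), by fun_prop⟩ : C(K, F)))
      (fun _ _ _ => by ext; simp) (fun _ _ _ => by ext; simp)
      (fun _ _ _ => by ext; simp) (fun _ _ _ => by ext; simp)) 1
    (fun A η => by
      rw [one_mul, ContinuousMap.norm_le _ (by positivity)]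
      intro s
      exact ((A s).le_opNorm _).trans (mul_le_mul (A.norm_coe_le_norm s) (η.norm_coe_le_norm s)
        (norm_nonneg _) (norm_nonneg A)))

/-- `Y'` is uniformly continuous near the compact range of `γ`, so the mean value inequality bounds
the remainder by the same `ε` at all points of `K`, hence in the supremum norm. -/
theorem hasFDerivAt_superposition {E F : Type*} [NormedAddCommGroup E] [NormedSpace ℝ E]
    [NormedAddCommGroup F] [NormedSpace ℝ F] (Y : C(E, F)) (Y' : C(E, E →L[ℝ] F))
    (h : ∀ x, HasFDerivAt Y (Y' x) x) (γ : C(K, E)) :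
    HasFDerivAt (fun γ : C(K, E) => Y.comp γ) (pointwiseApply K E F (Y'.comp γ)) γ := by
  rw [hasFDerivAt_iff_isLittleO, Asymptotics.isLittleO_iff]
  intro ε hε
  have hc : IsCompact (range γ) := isCompact_range γ.continuous
  have hu := hc.uniformContinuousAt_of_continuousAt Y' (fun a _ => Y'.continuous.continuousAt)
    (Metric.dist_mem_uniformity hε)
  obtain ⟨δ, hδ, hu⟩ := Metric.mem_uniformity_dist.1 hu
  filter_upwards [Metric.ball_mem_nhds γ hδ] with η hη
  rw [ContinuousMap.norm_le _ (by positivity)]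
  intro s
  have hs : dist (η s) (γ s) < δ := (ContinuousMap.dist_apply_le_dist s).trans_lt hη
  have key := (convex_ball (γ s) δ).norm_image_sub_le_of_norm_hasFDerivWithin_le' (f := Y)
    (f' := Y') (φ := Y' (γ s)) (C := ε) (x := γ s) (y := η s)
    (fun x _ => (h x).hasFDerivWithinAt) (fun x hx => by
      have := @hu (γ s) x (by rw [dist_comm]; exact hx) ⟨s, rfl⟩
      rw [← dist_eq_norm, dist_comm]
      exact le_of_lt this) (mem_ball_self hδ) hs
  have h2 : ‖η s - γ s‖ ≤ ‖η - γ‖ := (η - γ).norm_coe_le_norm s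
  calc _ = ‖Y (η s) - Y (γ s) - Y' (γ s) (η s - γ s)‖ := rfl
    _ ≤ ε * ‖η s - γ s‖ := key
    _ ≤ ε * ‖η - γ‖ := by gcongr

/-- The derivative is again a superposition operator, that of `Y'` with values in `E →L[ℝ] F`. The
induction therefore varies `F`, and the common universe keeps `E →L[ℝ] F` an admissible target. -/
theorem contDiff_superposition_nat {E : Type u} [NormedAddCommGroup E] [NormedSpace ℝ E]
    (n : ℕ) {F : Type u} [NormedAddCommGroup F] [NormedSpace ℝ F] (Y : C(E, F))
    (h : ContDiff ℝ n Y) : ContDiff ℝ n (fun γ : C(K, E) => Y.comp γ) := by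
  induction n generalizing F with
  | zero =>
    simp only [CharP.cast_eq_zero, contDiff_zero]
    exact ContinuousMap.continuous_postcomp Y
  | succ n ih =>
    push_cast at h ⊢
    obtain ⟨Y', hY', hd⟩ := contDiff_succ_iff_hasFDerivAt.1 h
    refine contDiff_succ_iff_hasFDerivAt.2 ⟨fun γ => pointwiseApply K E F
      ((⟨Y', hY'.continuous⟩ : C(E, E →L[ℝ] F)).comp γ), ?_, fun γ =>
        hasFDerivAt_superposition Y ⟨Y', hY'.continuous⟩ hd γ⟩
    exact (pointwiseApply K E F).contDiff.comp (ih (⟨Y', hY'.continuous⟩ : C(E, E →L[ℝ] F)) hY')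

theorem contDiff_superposition {E F : Type u} [NormedAddCommGroup E] [NormedSpace ℝ E]
    [NormedAddCommGroup F] [NormedSpace ℝ F] (Y : C(E, F))
    (h : ContDiff ℝ ∞ Y) : ContDiff ℝ ∞ (fun γ : C(K, E) => Y.comp γ) :=
  contDiff_infty.2 fun n => contDiff_superposition_nat n Y (contDiff_infty.1 h n)

end Superposition

/-- A smooth contractive perturbation of the identity of a Banach space has a smooth inverse. -/
theorem exists_contDiff_inverse_id_sub {B : Type*} [NormedAddCommGroup B] [NormedSpace ℝ B]
    [CompleteSpace B] (T : B → B) (hT : ContDiff ℝ ∞ T) (c : NNReal) (hc : c < 1)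
    (hL : LipschitzWith c T) : ∃ G : B → B, ContDiff ℝ ∞ G ∧ ∀ η, G η - T (G η) = η := by
  have hK : ∀ η, ContractingWith c (fun ξ => η + T ξ) := fun η =>
    ⟨hc, by simpa using (LipschitzWith.const η).add hL⟩
  have hG : ∀ η, ∃ ξ, ξ - T ξ = η := fun η =>
    ⟨_, sub_eq_iff_eq_add.2 ((hK η).fixedPoint_isFixedPt).symm⟩
  choose G hG using hG
  have hinj : ∀ ξ ξ', ξ - T ξ = ξ' - T ξ' → ξ = ξ' := by
    intro ξ ξ' h
    have h1 := (hK (ξ - T ξ)).fixedPoint_unique' (x := ξ) (y := ξ')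
      (by simp [Function.IsFixedPt]) (by simp [Function.IsFixedPt, h])
    exact h1
  refine ⟨G, contDiff_iff_contDiffAt.2 fun η => ?_, hG⟩
  set D := fderiv ℝ T (G η)
  have hD : ‖D‖ < 1 := (norm_fderiv_le_of_lipschitz ℝ hL).trans_lt (by exact_mod_cast hc)
  set e : B ≃L[ℝ] B := ContinuousLinearEquiv.unitsEquiv ℝ B (Units.oneSub D hD)
  have hH : ContDiff ℝ ∞ (fun ξ => ξ - T ξ) := contDiff_id.sub hT
  have hH' : HasFDerivAt (fun ξ => ξ - T ξ) (e : B →L[ℝ] B) (G η) := by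
    have := (hasFDerivAt_id (𝕜 := ℝ) (G η)).sub
      ((hT.differentiable (by simp)).differentiableAt (x := G η)).hasFDerivAt
    exact this
  have hn : (∞ : WithTop ℕ∞) ≠ 0 := by simp
  have h1 := (hH.contDiffAt (x := G η)).to_localInverse hH' hn
  have h2 := ((hH.contDiffAt (x := G η)).hasStrictFDerivAt' hH' hn).eventually_right_inverse
  rw [hG] at h1 h2
  -- The local inverse from the inverse function theorem and `G` solve the same equation, whose
  -- solution is unique.
  refine h1.congr_of_eventuallyEq ?_
  filter_upwards [h2] with y hy
  exact hinj _ _ ((hG y).trans hy.symm)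

/-- The primitive, multiplied by a decreasing exponential weight. -/
def weightedPrimitive (E : Type*) [NormedAddCommGroup E] [NormedSpace ℝ E] (k : ℝ) :
    C(Icc (0 : ℝ) 1, E) →ₗ[ℝ] C(Icc (0 : ℝ) 1, E) where
  toFun η := ⟨fun t => Real.exp (-k * t) • ∫ s in (0 : ℝ)..t, η (projIcc 0 1 zero_le_one s), by
    have h : Continuous fun s => η (projIcc 0 1 zero_le_one s) :=
      η.continuous.comp continuous_projIcc
    have := intervalIntegral.continuous_primitive (μ := MeasureTheory.volume)
      (fun a b => h.intervalIntegrable a b) 0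
    fun_prop⟩
  map_add' η ξ := by
    have h : ∀ η : C(Icc (0 : ℝ) 1, E), Continuous fun s => η (projIcc 0 1 zero_le_one s) :=
      fun η => η.continuous.comp continuous_projIcc
    ext t
    simp [intervalIntegral.integral_add ((h η).intervalIntegrable _ _)
      ((h ξ).intervalIntegrable _ _)]
  map_smul' c η := by
    ext t
    simp [intervalIntegral.integral_smul, smul_comm c]

/-- Multiplication by an exponential weight. -/
def expWeight (E : Type*) [NormedAddCommGroup E] [NormedSpace ℝ E] (k : ℝ) :
    C(Icc (0 : ℝ) 1, E) →L[ℝ] C(Icc (0 : ℝ) 1, E) :=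
  pointwiseApply (Icc (0 : ℝ) 1) E E
    ⟨fun t => Real.exp (k * t) • ContinuousLinearMap.id ℝ E, by fun_prop⟩

theorem expWeight_apply {E : Type*} [NormedAddCommGroup E] [NormedSpace ℝ E] (k : ℝ)
    (ξ : C(Icc (0 : ℝ) 1, E)) (t) : expWeight E k ξ t = Real.exp (k * t) • ξ t := rfl

/-- The inclusion of the constant paths. -/
def constCLM (E : Type*) [NormedAddCommGroup E] [NormedSpace ℝ E] :
    E →L[ℝ] C(Icc (0 : ℝ) 1, E) where
  toFun z := ContinuousMap.const (Icc (0 : ℝ) 1) z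
  map_add' _ _ := rfl
  map_smul' _ _ := rfl
  cont := ContinuousMap.continuous_const'

/-- Integrating `exp (k s)` gains the factor `1 / k`, and the weight `exp (-k t)` cancels the
growth. -/
theorem norm_weightedPrimitive_le {E : Type*} [NormedAddCommGroup E] [NormedSpace ℝ E]
    {k C : ℝ} (hk : 0 < k) (hC : 0 ≤ C) (η : C(Icc (0 : ℝ) 1, E))
    (h : ∀ t, ‖η t‖ ≤ C * Real.exp (k * t)) : ‖weightedPrimitive E k η‖ ≤ C / k := by
  rw [ContinuousMap.norm_le _ (by positivity)]
  intro t
  have ht := t.2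
  have h1 : ‖∫ s in (0 : ℝ)..t, η (projIcc 0 1 zero_le_one s)‖
      ≤ ∫ s in (0 : ℝ)..t, C * Real.exp (k * s) := by
    refine intervalIntegral.norm_integral_le_of_norm_le ht.1 ?_
      ((by fun_prop : Continuous fun s => C * Real.exp (k * s)).intervalIntegrable _ _)
    refine Filter.Eventually.of_forall fun s hs => ?_
    have := h (projIcc 0 1 zero_le_one s)
    rwa [projIcc_of_mem zero_le_one (⟨hs.1.le, hs.2.trans ht.2⟩ : s ∈ Icc (0 : ℝ) 1)] at this ⊢
  have h2 : ∫ s in (0 : ℝ)..t, C * Real.exp (k * s) = C / k * (Real.exp (k * t) - 1) := by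
    have : ∀ s ∈ uIcc (0 : ℝ) t,
        HasDerivAt (fun s => C / k * Real.exp (k * s)) (C * Real.exp (k * s)) s := by
      intro s _
      have := ((((hasDerivAt_id s).const_mul k).exp).const_mul (C / k))
      refine this.congr_deriv ?_
      simp only [id, mul_one]
      field_simp
    rw [intervalIntegral.integral_eq_sub_of_hasDerivAt this
      ((by fun_prop : Continuous fun s => C * Real.exp (k * s)).intervalIntegrable _ _)]
    simp
    ring
  calc _ = Real.exp (-k * t) * ‖∫ s in (0 : ℝ)..t, η (projIcc 0 1 zero_le_one s)‖ := by
        simp only [weightedPrimitive, LinearMap.coe_mk, AddHom.coe_mk, ContinuousMap.coe_mk,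
          norm_smul, Real.norm_eq_abs, Real.abs_exp]
    _ ≤ Real.exp (-k * t) * (C / k * (Real.exp (k * t) - 1)) := by
        rw [← h2]; gcongr
    _ ≤ Real.exp (-k * t) * (C / k * (Real.exp (k * t))) := by gcongr; linarith
    _ = C / k := by
        rw [mul_left_comm, ← Real.exp_add]; simp

/-- The time-one map of a smooth globally Lipschitz vector field exists and is smooth. -/
theorem exists_contDiff_timeOne {E : Type*} [NormedAddCommGroup E] [NormedSpace ℝ E]
    [CompleteSpace E] (Y : E → E) (hY : ContDiff ℝ ∞ Y) (K : NNReal) (hK : LipschitzWith K Y) :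
    ∃ F : E → E, ContDiff ℝ ∞ F ∧ ∀ z, ∃ γ : ℝ → E, γ 0 = z ∧ γ 1 = F z ∧
      ∀ t ∈ Icc (0 : ℝ) 1, HasDerivWithinAt γ (Y (γ t)) (Icc 0 1) t := by
  -- With paths written as `exp (k t) • ξ t`, the Picard operator has Lipschitz constant `K / k < 1`
  -- on the whole of `[0, 1]`, so no short-time solutions have to be glued.
  set k : ℝ := K + 1
  have hk : 0 < k := by positivity
  set Yc : C(E, E) := ⟨Y, hY.continuous⟩
  set W : C(Icc (0 : ℝ) 1, E) →L[ℝ] C(Icc (0 : ℝ) 1, E) :=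
    (weightedPrimitive E k).mkContinuous (1 / k) (fun η => by
      have := norm_weightedPrimitive_le hk (norm_nonneg η) η (fun t => by
        refine (η.norm_coe_le_norm t).trans (le_mul_of_one_le_right (norm_nonneg _) ?_)
        exact Real.one_le_exp (mul_nonneg hk.le t.2.1))
      rwa [div_eq_inv_mul, ← one_div] at this)
  set M := expWeight E k
  set T : C(Icc (0 : ℝ) 1, E) → C(Icc (0 : ℝ) 1, E) := fun ξ => W (Yc.comp (M ξ))
  have hT : ContDiff ℝ ∞ T :=
    W.contDiff.comp ((contDiff_superposition Yc hY).comp M.contDiff)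
  have hL : LipschitzWith (K / (K + 1)) T := by
    refine LipschitzWith.of_dist_le_mul fun ξ ξ' => ?_
    rw [dist_eq_norm, dist_eq_norm, ← map_sub]
    have := norm_weightedPrimitive_le hk (C := K * ‖ξ - ξ'‖) (by positivity)
      (Yc.comp (M ξ) - Yc.comp (M ξ')) (fun t => by
        have h1 := hK.dist_le_mul (M ξ t) (M ξ' t)
        rw [dist_eq_norm, dist_eq_norm, expWeight_apply, expWeight_apply, ← smul_sub, norm_smul,
          Real.norm_eq_abs, Real.abs_exp] at h1
        have h2 : ‖ξ t - ξ' t‖ ≤ ‖ξ - ξ'‖ := (ξ - ξ').norm_coe_le_norm t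
        calc ‖Y (Real.exp (k * t) • ξ t) - Y (Real.exp (k * t) • ξ' t)‖ ≤ _ := h1
          _ ≤ K * (Real.exp (k * t) * ‖ξ - ξ'‖) := by gcongr
          _ = K * ‖ξ - ξ'‖ * Real.exp (k * t) := by ring)
    refine this.trans_eq ?_
    push_cast
    ring
  obtain ⟨G, hG, hGT⟩ := exists_contDiff_inverse_id_sub T hT _
    (by rw [div_lt_one (by positivity)]; exact lt_add_one K) hL
  -- In the weighted unknown, the integral equation with initial value `z` reads `ξ - T ξ = cst z`;
  -- its solution `G (cst z)` is smooth in `z`.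
  set cst : E →L[ℝ] C(Icc (0 : ℝ) 1, E) :=
    (expWeight E (-k)).comp (constCLM E)
  have hcst : ∀ z t, cst z t = Real.exp (-k * t) • z := fun z t => rfl
  have h0 : (0 : ℝ) ∈ Icc (0 : ℝ) 1 := by simp
  have h1 : (1 : ℝ) ∈ Icc (0 : ℝ) 1 := by simp
  refine ⟨fun z => M (G (cst z)) ⟨1, h1⟩, ?_, fun z => ?_⟩
  · exact (ContinuousMap.evalCLM ℝ (⟨1, h1⟩ : Icc (0 : ℝ) 1)).contDiff.comp
      (M.contDiff.comp (hG.comp cst.contDiff))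
  · set ξ := M (G (cst z))
    have hc : Continuous fun s => Y (ξ (projIcc 0 1 zero_le_one s)) :=
      hY.continuous.comp (ξ.continuous.comp continuous_projIcc)
    have key : ∀ t : Icc (0 : ℝ) 1,
        ξ t = z + ∫ s in (0 : ℝ)..t, Y (ξ (projIcc 0 1 zero_le_one s)) := by
      intro t
      have h3 := DFunLike.congr_fun (hGT (cst z)) t
      have h4 : G (cst z) t - Real.exp (-k * t) •
        (∫ s in (0 : ℝ)..t, Y (ξ (projIcc 0 1 zero_le_one s))) = Real.exp (-k * t) • z := h3
      rw [sub_eq_iff_eq_add, ← smul_add] at h4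
      change Real.exp (k * t) • G (cst z) t = _
      rw [h4, smul_smul, ← Real.exp_add]
      simp
    refine ⟨fun t => z + ∫ s in (0 : ℝ)..t, Y (ξ (projIcc 0 1 zero_le_one s)), by simp,
      (key ⟨1, h1⟩).symm, fun t ht => ?_⟩
    have h5 := key ⟨t, ht⟩
    simp only at h5
    beta_reduce
    rw [← h5]
    have := (intervalIntegral.integral_hasDerivAt_right (hc.intervalIntegrable 0 t)
      (hc.stronglyMeasurableAtFilter _ _) hc.continuousAt).const_add z
    simp only [projIcc_of_mem zero_le_one ht] at this
    exact this.hasDerivWithinAt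

/-! ### Flows of vector fields on open sets -/

section Flow

variable {E : Type*} [NormedAddCommGroup E] [NormedSpace ℝ E]

/-- `γ` is an integral curve in `Ω` of the vector field `Z` on the interval `[0, T]`. -/
def IsFlowLine (Z : E → E) (Ω : Set E) (T : ℝ) (γ : ℝ → E) : Prop :=
  ∀ t ∈ Icc 0 T, γ t ∈ Ω ∧ HasDerivWithinAt γ (Z (γ t)) (Icc 0 T) t

theorem IsFlowLine.continuousOn {Z : E → E} {Ω : Set E} {T : ℝ} {γ : ℝ → E}
    (h : IsFlowLine Z Ω T γ) : ContinuousOn γ (Icc 0 T) :=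
  fun t ht => (h t ht).2.continuousWithinAt

theorem hasDerivWithinAt_Ici_of_Icc {γ : ℝ → E} {v : E} {T t : ℝ}
    (h : HasDerivWithinAt γ v (Icc 0 T) t) (ht : t ∈ Ico 0 T) :
    HasDerivWithinAt γ v (Ici t) t :=
  h.mono_of_mem_nhdsWithin
    (mem_of_superset (Icc_mem_nhdsGE ht.2) (Icc_subset_Icc_left ht.1))

/-- A curve that cannot leave the open set `O` without having been in the closed subset `C` all
the time before stays in `C`. -/
theorem mem_of_forall_not_exit {X : Type*} [TopologicalSpace X] {γ : ℝ → X} {O C : Set X}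
    (hγ : ContinuousOn γ (Icc 0 1)) (hO : IsOpen O) (hC : IsClosed C) (hCO : C ⊆ O)
    (h0 : γ 0 ∈ C) (hstep : ∀ T ∈ Icc (0 : ℝ) 1, (∀ t ∈ Icc 0 T, γ t ∈ O) → γ T ∈ C) :
    ∀ t ∈ Icc (0 : ℝ) 1, γ t ∈ C := by
  have hall : ∀ t ∈ Icc (0 : ℝ) 1, γ t ∈ O := by
    by_contra! hne
    set B := Icc (0 : ℝ) 1 ∩ γ ⁻¹' Oᶜ
    have hB : IsCompact B := isCompact_Icc.of_isClosed_subset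
      (hγ.preimage_isClosed_of_isClosed isClosed_Icc hO.isClosed_compl) inter_subset_left
    -- At the first time `t1` outside `O`, the curve has been in the closed set `C` at all earlier
    -- times, so it is still in `C ⊆ O`.
    obtain ⟨t1, ht1, hmin⟩ := hB.exists_isLeast (by obtain ⟨t, ht, h⟩ := hne; exact ⟨t, ht, h⟩)
    have h01 : 0 < t1 := lt_of_le_of_ne ht1.1.1 (by rintro rfl; exact ht1.2 (hCO h0))
    have hlt : ∀ t ∈ Ico 0 t1, γ t ∈ C := by
      intro t ht
      refine hstep t ⟨ht.1, ht.2.le.trans ht1.1.2⟩ fun s hs => ?_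
      by_contra hs'
      have := hmin ⟨⟨hs.1, hs.2.trans (ht.2.le.trans ht1.1.2)⟩, hs'⟩
      linarith [hs.2, ht.2]
    have hcl : t1 ∈ closure (Ico 0 t1) := by
      rw [closure_Ico h01.ne]; exact ⟨h01.le, le_rfl⟩
    have : γ t1 ∈ closure C :=
      ((hγ t1 ht1.1).mono (fun t ht => ⟨ht.1, ht.2.le.trans ht1.1.2⟩ :
        Ico 0 t1 ⊆ Icc 0 1)).mem_closure hcl hlt
    rw [hC.closure_eq] at this
    exact ht1.2 (hCO this)
  exact fun t ht => hstep t ht fun s hs => hall s ⟨hs.1, hs.2.trans ht.2⟩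

/-- Grönwall's inequality. It serves for uniqueness and for keeping neighbouring solutions close to
a given one. -/
theorem IsFlowLine.eq_on_of_lipschitz {Z : E → E} {Ω : Set E} {K : NNReal}
    (hK : LipschitzWith K Z) {γ₁ γ₂ : ℝ → E} {Ω' : Set E} (h₁ : IsFlowLine Z Ω 1 γ₁)
    (h₂ : IsFlowLine Z Ω' 1 γ₂) : ∀ t ∈ Icc (0 : ℝ) 1,
      dist (γ₁ t) (γ₂ t) ≤ dist (γ₁ 0) (γ₂ 0) * Real.exp (K * t) := by
  intro t ht
  have := dist_le_of_trajectories_ODE (v := fun _ => Z) (fun _ => hK) h₁.continuousOn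
    (fun t ht => hasDerivWithinAt_Ici_of_Icc (h₁ t ⟨ht.1, ht.2.le⟩).2 ht) h₂.continuousOn
    (fun t ht => hasDerivWithinAt_Ici_of_Icc (h₂ t ⟨ht.1, ht.2.le⟩).2 ht) le_rfl t ht
  rwa [sub_zero] at this

/-- A smooth vector field on an open set agrees near a given compact set with a smooth
globally Lipschitz vector field. -/
theorem exists_global_field [FiniteDimensional ℝ E]
    {Z : E → E} {Ω C : Set E} (hΩ : IsOpen Ω)
    (hZ : ContDiffOn ℝ ∞ Z Ω) (hC : IsCompact C) (hCΩ : C ⊆ Ω) :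
    ∃ (Y : E → E) (K : NNReal) (O : Set E), ContDiff ℝ ∞ Y ∧ LipschitzWith K Y ∧ IsOpen O ∧
      C ⊆ O ∧ O ⊆ Ω ∧ EqOn Y Z O := by
  obtain ⟨L, hL, hCL, hLΩ⟩ := exists_compact_between hC hΩ hCΩ
  obtain ⟨χ, h1, h0, -⟩ := exists_contMDiffMap_one_nhds_of_subset_interior
    (n := ⊤) (modelWithCornersSelf ℝ E) hC.isClosed hCL
  have hχ : ContDiff ℝ ∞ χ := χ.contMDiff.contDiff
  have hsm : ContDiff ℝ ∞ (fun x => χ x • Z x) := by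
    rw [contDiff_iff_contDiffAt]
    intro x
    by_cases hx : x ∈ Ω
    · exact hχ.contDiffAt.smul (hZ.contDiffAt (hΩ.mem_nhds hx))
    · refine (contDiffAt_const (c := (0 : E))).congr_of_eventuallyEq ?_
      filter_upwards [hL.isClosed.isOpen_compl.mem_nhds (fun h => hx (hLΩ h))] with y hy
      rw [h0 y hy, zero_smul]
  have hcs : HasCompactSupport (fun x => χ x • Z x) :=
    HasCompactSupport.intro hL fun x hx => by rw [h0 x hx, zero_smul]
  obtain ⟨K, hK⟩ := hsm.lipschitzWith_of_hasCompactSupport hcs (by simp)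
  obtain ⟨O, hO, hCO, hO1⟩ := eventually_nhdsSet_iff_exists.1
    (h1.and ((hΩ.mem_nhdsSet.2 hCΩ : ∀ᶠ x in 𝓝ˢ C, x ∈ Ω)))
  exact ⟨_, K, O, hsm, hK, hO, hCO, fun x hx => (hO1 x hx).2,
    fun x hx => by
      have := (hO1 x hx).1
      simp [this]⟩

theorem IsFlowLine.congr {Z Y : E → E} {Ω O : Set E} {T : ℝ} {γ : ℝ → E}
    (h : IsFlowLine Z Ω T γ) (hYZ : EqOn Y Z O) (hO : ∀ t ∈ Icc 0 T, γ t ∈ O) :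
    IsFlowLine Y O T γ :=
  fun t ht => ⟨hO t ht, by rw [hYZ (hO t ht)]; exact (h t ht).2⟩

theorem IsFlowLine.mono {Z : E → E} {Ω Ω' : Set E} {T : ℝ} {γ : ℝ → E}
    (h : IsFlowLine Z Ω T γ) (hΩ : Ω ⊆ Ω') : IsFlowLine Z Ω' T γ :=
  fun t ht => ⟨hΩ (h t ht).1, (h t ht).2⟩

theorem IsFlowLine.restrict {Z : E → E} {Ω : Set E} {T S : ℝ} {γ : ℝ → E}
    (h : IsFlowLine Z Ω T γ) (hS : S ≤ T) : IsFlowLine Z Ω S γ :=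
  fun t ht => ⟨(h t ⟨ht.1, ht.2.trans hS⟩).1,
    (h t ⟨ht.1, ht.2.trans hS⟩).2.mono (Icc_subset_Icc_right hS)⟩

/-- The two curves together have compact image in `Ω`, near which the field may be replaced by a
globally Lipschitz one. -/
theorem IsFlowLine.unique [FiniteDimensional ℝ E]
    {Z : E → E} {Ω : Set E} (hΩ : IsOpen Ω) (hZ : ContDiffOn ℝ ∞ Z Ω)
    {γ₁ γ₂ : ℝ → E} (h₁ : IsFlowLine Z Ω 1 γ₁) (h₂ : IsFlowLine Z Ω 1 γ₂)
    (h0 : γ₁ 0 = γ₂ 0) : γ₁ 1 = γ₂ 1 := by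
  have hC : IsCompact (γ₁ '' Icc 0 1 ∪ γ₂ '' Icc 0 1) :=
    (isCompact_Icc.image_of_continuousOn h₁.continuousOn).union
      (isCompact_Icc.image_of_continuousOn h₂.continuousOn)
  obtain ⟨Y, K, O, -, hK, -, hCO, -, hYZ⟩ := exists_global_field hΩ hZ hC (by
    rintro _ (⟨t, ht, rfl⟩ | ⟨t, ht, rfl⟩)
    exacts [(h₁ t ht).1, (h₂ t ht).1])
  have := (h₁.congr hYZ fun t ht => hCO (Or.inl ⟨t, ht, rfl⟩)).eq_on_of_lipschitz hK
    (h₂.congr hYZ fun t ht => hCO (Or.inr ⟨t, ht, rfl⟩)) 1 (by simp)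
  rw [h0, dist_self, zero_mul] at this
  exact dist_le_zero.1 this

/-- The globalised field has a smooth time-one map. Solutions starting close enough to `γ₀ 0` stay
where the two fields agree, and so are flow lines of `Z`. -/
theorem IsFlowLine.exists_contDiff [FiniteDimensional ℝ E]
    {Z : E → E} {Ω : Set E} (hΩ : IsOpen Ω)
    (hZ : ContDiffOn ℝ ∞ Z Ω) {γ₀ : ℝ → E} (h₀ : IsFlowLine Z Ω 1 γ₀) :
    ∃ F : E → E, ContDiff ℝ ∞ F ∧ ∀ᶠ z in 𝓝 (γ₀ 0), ∃ γ, IsFlowLine Z Ω 1 γ ∧ γ 0 = z ∧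
      γ 1 = F z := by
  have hC : IsCompact (γ₀ '' Icc 0 1) := isCompact_Icc.image_of_continuousOn h₀.continuousOn
  obtain ⟨Y, K, O, hY, hK, hO, hCO, hOΩ, hYZ⟩ := exists_global_field hΩ hZ hC (by
    rintro _ ⟨t, ht, rfl⟩
    exact (h₀ t ht).1)
  obtain ⟨F, hF, hγ⟩ := exists_contDiff_timeOne Y hY K hK
  refine ⟨F, hF, ?_⟩
  obtain ⟨ε, hε, hεO⟩ := hC.exists_thickening_subset_open hO hCO
  -- On `[0, 1]` distances between solutions grow at most by the factor `exp K`.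
  have hpos : 0 < ε / Real.exp K := by positivity
  filter_upwards [Metric.ball_mem_nhds (γ₀ 0) hpos] with z hz
  obtain ⟨γ, hγ0, hγ1, hγ⟩ := hγ z
  have hfl : IsFlowLine Y univ 1 γ := fun t ht => ⟨trivial, hγ t ht⟩
  have hmem : ∀ t ∈ Icc (0 : ℝ) 1, γ t ∈ O := by
    intro t ht
    refine hεO (Metric.mem_thickening_iff.2 ⟨γ₀ t, ⟨t, ht, rfl⟩, ?_⟩)
    have := hfl.eq_on_of_lipschitz hK (h₀.congr hYZ fun t ht => hCO ⟨t, ht, rfl⟩) t ht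
    rw [hγ0] at this
    refine this.trans_lt ?_
    have hz' : dist z (γ₀ 0) < ε / Real.exp K := hz
    rw [lt_div_iff₀ (Real.exp_pos _)] at hz'
    refine lt_of_le_of_lt ?_ hz'
    gcongr
    nlinarith [ht.2, K.2]
  exact ⟨γ, (hfl.congr hYZ.symm hmem).mono hOΩ, hγ0, hγ1⟩

/-- An a priori bound gives existence: `hap` forbids solutions to end outside the compact set `C`,
so the solution of the globalised field never leaves the region where it agrees with `Z`. -/
theorem exists_isFlowLine [FiniteDimensional ℝ E]
    {Z : E → E} {Ω C : Set E} (hΩ : IsOpen Ω)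
    (hZ : ContDiffOn ℝ ∞ Z Ω) (hC : IsCompact C) (hCΩ : C ⊆ Ω) {z : E} (hz : z ∈ C)
    (hap : ∀ T ∈ Icc (0 : ℝ) 1, ∀ γ, IsFlowLine Z Ω T γ → γ 0 = z → γ T ∈ C) :
    ∃ γ, IsFlowLine Z Ω 1 γ ∧ γ 0 = z := by
  obtain ⟨Y, K, O, hY, hK, hO, hCO, hOΩ, hYZ⟩ := exists_global_field hΩ hZ hC hCΩ
  obtain ⟨F, -, hγ⟩ := exists_contDiff_timeOne Y hY K hK
  obtain ⟨γ, hγ0, -, hγ⟩ := hγ z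
  have hfl : IsFlowLine Y univ 1 γ := fun t ht => ⟨trivial, hγ t ht⟩
  have hmem : ∀ t ∈ Icc (0 : ℝ) 1, γ t ∈ C :=
    mem_of_forall_not_exit hfl.continuousOn hO hC.isClosed hCO (by rwa [hγ0]) fun T hT h =>
      hap T hT γ (((hfl.restrict hT.2).congr hYZ.symm h).mono hOΩ) hγ0
  exact ⟨γ, (hfl.congr hYZ.symm fun t ht => hCO (hmem t ht)).mono hOΩ, hγ0⟩

end Flow

/-! ### Flows of fields depending linearly on a parameter. -/

section ParametricFlow

variable {E Λ : Type*} [NormedAddCommGroup E] [NormedSpace ℝ E]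
  [NormedAddCommGroup Λ] [NormedSpace ℝ Λ]

/-- The flow of the vector field `X(·) lam` on `Ω` takes `x` to `y` in time one. -/
def Reaches (X : E → Λ →L[ℝ] E) (Ω : Set E) (lam : Λ) (x y : E) : Prop :=
  ∃ γ : ℝ → E, IsFlowLine (fun x => X x lam) Ω 1 γ ∧ γ 0 = x ∧ γ 1 = y

/-- Linearity in the parameter turns time reversal into a change of sign, so inverses of time-one
maps are again time-one maps. -/
theorem Reaches.symm {X : E → Λ →L[ℝ] E} {Ω : Set E} {lam : Λ} {x y : E}
    (h : Reaches X Ω lam x y) : Reaches X Ω (-lam) y x := by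
  obtain ⟨γ, hγ, h0, h1⟩ := h
  refine ⟨fun t => γ (1 - t), fun t ht => ?_, by simpa using h1, by simpa using h0⟩
  have ht' : 1 - t ∈ Icc (0 : ℝ) 1 := ⟨by linarith [ht.2], by linarith [ht.1]⟩
  refine ⟨(hγ _ ht').1, ?_⟩
  have hm : MapsTo (fun s : ℝ => 1 - s) (Icc 0 1) (Icc 0 1) :=
    fun s hs => ⟨by linarith [hs.2], by linarith [hs.1]⟩
  have := (hγ _ ht').2.scomp t ((hasDerivAt_id t).const_sub 1).hasDerivWithinAt hm
  simpa [Function.comp_def] using this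

/-- The parameter becomes a coordinate that the flow leaves fixed; smooth dependence on initial
values then includes smooth dependence on the parameter. -/
theorem contDiffOn_parametricField {X : E → Λ →L[ℝ] E} {Ω : Set E} (hX : ContDiffOn ℝ ∞ X Ω) :
    ContDiffOn ℝ ∞ (fun q : Λ × E => ((0 : Λ), X q.2 q.1)) (univ ×ˢ Ω) := by
  have : ContDiffOn ℝ ∞ (fun q : Λ × E => X q.2) (univ ×ˢ Ω) :=
    hX.comp contDiffOn_snd fun q hq => hq.2
  exact contDiffOn_const.prodMk (this.clm_apply contDiffOn_fst)

theorem isFlowLine_parametric {X : E → Λ →L[ℝ] E} {Ω : Set E} {lam : Λ} {γ : ℝ → E} {T : ℝ}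
    (h : IsFlowLine (fun x => X x lam) Ω T γ) :
    IsFlowLine (fun q : Λ × E => ((0 : Λ), X q.2 q.1)) (univ ×ˢ Ω) T (fun t => (lam, γ t)) :=
  fun t ht => ⟨⟨trivial, (h t ht).1⟩, (hasDerivWithinAt_const t _ lam).prodMk (h t ht).2⟩

theorem isFlowLine_of_parametric {X : E → Λ →L[ℝ] E} {Ω : Set E} {γ : ℝ → Λ × E} {T : ℝ}
    (h : IsFlowLine (fun q : Λ × E => ((0 : Λ), X q.2 q.1)) (univ ×ˢ Ω) T γ) :
    (∀ t ∈ Icc 0 T, (γ t).1 = (γ 0).1) ∧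
      IsFlowLine (fun x => X x (γ 0).1) Ω T (fun t => (γ t).2) := by
  have hc : ∀ t ∈ Icc 0 T, (γ t).1 = (γ 0).1 :=
    constant_of_has_deriv_right_zero (continuous_fst.comp_continuousOn h.continuousOn)
      fun t ht => by
        have := (hasDerivWithinAt_Ici_of_Icc (h t ⟨ht.1, ht.2.le⟩).2 ht)
        exact (hasFDerivAt_fst (𝕜 := ℝ) (p := γ t)).comp_hasDerivWithinAt t this
  refine ⟨hc, fun t ht => ⟨(h t ht).1.2, ?_⟩⟩
  have := (hasFDerivAt_snd (𝕜 := ℝ) (p := γ t)).comp_hasDerivWithinAt t (h t ht).2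
  rw [← hc t ht]
  exact this

theorem Reaches.unique [FiniteDimensional ℝ E]
    {X : E → Λ →L[ℝ] E} {Ω : Set E} (hΩ : IsOpen Ω)
    (hX : ContDiffOn ℝ ∞ X Ω) {lam : Λ} {x y y' : E}
    (h : Reaches X Ω lam x y) (h' : Reaches X Ω lam x y') : y = y' := by
  obtain ⟨γ, hγ, h0, rfl⟩ := h
  obtain ⟨γ', hγ', h0', rfl⟩ := h'
  exact hγ.unique hΩ (hX.clm_apply contDiffOn_const) hγ' (h0.trans h0'.symm)

open Classical in
/-- The time-one map of the flow of the fields `X(·) lam` on `Ω`, with the parameter `lam` as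
first argument. -/
def timeOne (X : E → Λ →L[ℝ] E) (Ω : Set E) (q : Λ × E) : E :=
  if h : ∃ y, Reaches X Ω q.1 q.2 y then h.choose else 0

theorem Reaches.timeOne_eq [FiniteDimensional ℝ E]
    {X : E → Λ →L[ℝ] E} {Ω : Set E} (hΩ : IsOpen Ω)
    (hX : ContDiffOn ℝ ∞ X Ω) {lam : Λ} {x y : E} (h : Reaches X Ω lam x y) :
    timeOne X Ω (lam, x) = y := by
  have hex : ∃ y, Reaches X Ω (lam, x).1 (lam, x).2 y := ⟨y, h⟩
  rw [timeOne, dif_pos hex]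
  exact Reaches.unique hΩ hX hex.choose_spec h

theorem Reaches.contDiffAt_timeOne [FiniteDimensional ℝ E] [FiniteDimensional ℝ Λ]
    {X : E → Λ →L[ℝ] E} {Ω : Set E} (hΩ : IsOpen Ω)
    (hX : ContDiffOn ℝ ∞ X Ω) {lam : Λ} {x y : E} (h : Reaches X Ω lam x y) :
    ContDiffAt ℝ ∞ (timeOne X Ω) (lam, x) := by
  obtain ⟨γ, hγ, h0, -⟩ := h
  obtain ⟨F, hF, hev⟩ := (isFlowLine_parametric hγ).exists_contDiff (isOpen_univ.prod hΩ)
    (contDiffOn_parametricField hX)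
  rw [h0] at hev
  refine (contDiff_snd.comp hF).contDiffAt.congr_of_eventuallyEq ?_
  -- `timeOne` is defined by choice, but uniqueness of flow lines identifies it with the smooth map
  -- `F` near `(lam, x)`.
  filter_upwards [hev] with q hq
  obtain ⟨γ', hγ', h0', h1'⟩ := hq
  have := isFlowLine_of_parametric hγ'
  refine Reaches.timeOne_eq hΩ hX (lam := q.1) (x := q.2) ⟨fun t => (γ' t).2, ?_, ?_, ?_⟩
  · rw [← h0']; exact this.2
  · simp only [h0']
  · simp only [h1', Function.comp_apply]

theorem exists_reaches [FiniteDimensional ℝ E]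
    {X : E → Λ →L[ℝ] E} {Ω C : Set E} (hΩ : IsOpen Ω)
    (hX : ContDiffOn ℝ ∞ X Ω) (hC : IsCompact C) (hCΩ : C ⊆ Ω) {lam : Λ} {x : E} (hx : x ∈ C)
    (hap : ∀ T ∈ Icc (0 : ℝ) 1, ∀ γ, IsFlowLine (fun x => X x lam) Ω T γ → γ 0 = x → γ T ∈ C) :
    ∃ γ : ℝ → E, IsFlowLine (fun x => X x lam) Ω 1 γ ∧ γ 0 = x :=
  exists_isFlowLine hΩ (hX.clm_apply contDiffOn_const) hC hCΩ hx hap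

end ParametricFlow

/-! ### Smooth right inverses -/

/-- The right inverse is `L* (L L*)⁻¹`. Surjectivity of `L` makes `L L*` invertible, and inversion
is smooth at invertible operators. -/
theorem exists_smooth_rightInverse_of_inner {E F : Type*} [NormedAddCommGroup E]
    [InnerProductSpace ℝ E] [FiniteDimensional ℝ E] [NormedAddCommGroup F]
    [InnerProductSpace ℝ F] [FiniteDimensional ℝ F] :
    ∃ R : (E →L[ℝ] F) → (F →L[ℝ] E), ∀ L : E →L[ℝ] F, Function.Surjective L →
      ContDiffAt ℝ ∞ R L ∧ ∀ v, L (R L v) = v := by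
  have : CompleteSpace E := FiniteDimensional.complete ℝ E
  have : CompleteSpace F := FiniteDimensional.complete ℝ F
  refine ⟨fun L => (ContinuousLinearMap.adjoint L).comp
    (L.comp (ContinuousLinearMap.adjoint L)).inverse, fun L hL => ?_⟩
  have hinj : Function.Injective (L.comp (ContinuousLinearMap.adjoint L)) := by
    rw [injective_iff_map_eq_zero]
    intro y hy
    have h1 : ContinuousLinearMap.adjoint L y = 0 := by
      have : inner ℝ (L (ContinuousLinearMap.adjoint L y)) y = 0 := by
        rw [show L (ContinuousLinearMap.adjoint L y) = 0 from hy, inner_zero_left]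
      rw [← ContinuousLinearMap.adjoint_inner_right] at this
      exact inner_self_eq_zero.1 this
    obtain ⟨z, rfl⟩ := hL y
    have : inner ℝ (L z) (L z) = 0 := by
      rw [← ContinuousLinearMap.adjoint_inner_right, h1, inner_zero_right]
    exact inner_self_eq_zero.1 this
  set e : F ≃L[ℝ] F := (LinearEquiv.ofInjectiveEndo
    (L.comp (ContinuousLinearMap.adjoint L) : F →ₗ[ℝ] F) hinj).toContinuousLinearEquiv
  have he : (e : F →L[ℝ] F) = L.comp (ContinuousLinearMap.adjoint L) := by
    ext; rfl
  have hadj : ContDiff ℝ ∞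
      (fun L : E →L[ℝ] F => (ContinuousLinearMap.adjoint L : F →L[ℝ] E)) := by
    refine IsBoundedLinearMap.contDiff ⟨⟨map_add _, fun c x => by simp⟩, 1, one_pos, fun x => ?_⟩
    simp
  constructor
  · refine hadj.contDiffAt.clm_comp ?_
    have h1 : ContDiffAt ℝ ∞ (fun L : E →L[ℝ] F => L.comp (ContinuousLinearMap.adjoint L)) L :=
      contDiffAt_id.clm_comp hadj.contDiffAt
    have h2 : ContDiffAt ℝ ∞ ContinuousLinearMap.inverse
      (L.comp (ContinuousLinearMap.adjoint L)) := by
      rw [← he]; exact contDiffAt_map_inverse e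
    exact h2.comp L h1
  · intro v
    have : L.comp (ContinuousLinearMap.adjoint L)
      ((L.comp (ContinuousLinearMap.adjoint L)).inverse v) = v := by
      rw [← he, ContinuousLinearMap.inverse_equiv]
      exact e.apply_symm_apply v
    exact this

/-- Surjective linear maps between finite-dimensional spaces have right inverses which depend
smoothly on the map. -/
theorem exists_smooth_rightInverse {E F : Type*} [NormedAddCommGroup E]
    [NormedSpace ℝ E] [FiniteDimensional ℝ E] [NormedAddCommGroup F]
    [NormedSpace ℝ F] [FiniteDimensional ℝ F] :
    ∃ R : (E →L[ℝ] F) → (F →L[ℝ] E), ∀ L : E →L[ℝ] F, Function.Surjective L →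
      ContDiffAt ℝ ∞ R L ∧ ∀ v, L (R L v) = v := by
  obtain ⟨R, hR⟩ := exists_smooth_rightInverse_of_inner
    (E := EuclideanSpace ℝ (Fin (Module.finrank ℝ E)))
    (F := EuclideanSpace ℝ (Fin (Module.finrank ℝ F)))
  set a : E ≃L[ℝ] EuclideanSpace ℝ (Fin (Module.finrank ℝ E)) := toEuclidean
  set b : F ≃L[ℝ] EuclideanSpace ℝ (Fin (Module.finrank ℝ F)) := toEuclidean
  refine ⟨fun L => (a.symm.toContinuousLinearMap.comp (R (b.toContinuousLinearMap.comp
    (L.comp a.symm.toContinuousLinearMap)))).comp b.toContinuousLinearMap, fun L hL => ?_⟩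
  have hs : Function.Surjective (b.toContinuousLinearMap.comp (L.comp a.symm.toContinuousLinearMap)) :=
    b.surjective.comp (hL.comp a.symm.surjective)
  obtain ⟨h1, h2⟩ := hR _ hs
  constructor
  · refine ContDiffAt.clm_comp (contDiffAt_const.clm_comp ?_) contDiffAt_const
    exact h1.comp L (contDiffAt_const.clm_comp (contDiffAt_id.clm_comp contDiffAt_const))
  · intro v
    have := h2 (b v)
    exact b.injective this

/-! ### Vector fields lifting the motion of the radius and of the value -/

section Lift

variable {m p : ℕ}

/-- The differential at `x` of `(‖·‖ ^ 2 / 2, Ψ)`, together with a multiple of the direction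
of `Ψ x`. -/
def extendedDifferential (Ψ : EuclideanSpace ℝ (Fin m) → EuclideanSpace ℝ (Fin p))
    (c : EuclideanSpace ℝ (Fin m) → ℝ) (x : EuclideanSpace ℝ (Fin m)) :
    EuclideanSpace ℝ (Fin m) × ℝ →L[ℝ] ℝ × EuclideanSpace ℝ (Fin p) :=
  ((innerSL ℝ x).prod (fderiv ℝ Ψ x)).coprod
    ((ContinuousLinearMap.inr ℝ ℝ (EuclideanSpace ℝ (Fin p))).comp
      (ContinuousLinearMap.toSpanSingleton ℝ (c x • Ψ x)))

theorem extendedDifferential_apply (Ψ : EuclideanSpace ℝ (Fin m) → EuclideanSpace ℝ (Fin p))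
    (c : EuclideanSpace ℝ (Fin m) → ℝ) (x w : EuclideanSpace ℝ (Fin m)) (s : ℝ) :
    extendedDifferential Ψ c x (w, s) = (inner ℝ x w, fderiv ℝ Ψ x w + s • c x • Ψ x) := by
  simp [extendedDifferential]

theorem contDiff_extendedDifferential
    {Ψ : EuclideanSpace ℝ (Fin m) → EuclideanSpace ℝ (Fin p)}
    {c : EuclideanSpace ℝ (Fin m) → ℝ} (hΨ : ContDiff ℝ ∞ Ψ) (hc : ContDiff ℝ ∞ c) :
    ContDiff ℝ ∞ (extendedDifferential Ψ c) := by
  have h1 : ContDiff ℝ ∞ (fderiv ℝ Ψ) := hΨ.fderiv_right (by simp)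
  have h2 : ContDiff ℝ ∞ (fun x => c x • Ψ x) := hc.smul hΨ
  have h3 : ContDiff ℝ ∞ (fun x : EuclideanSpace ℝ (Fin m) => innerSL ℝ x) :=
    (innerSL ℝ).contDiff
  rw [contDiff_clm_apply_iff]
  rintro ⟨w, s⟩
  simp only [extendedDifferential_apply]
  exact (contDiff_id.inner ℝ contDiff_const).prodMk
    ((h1.clm_apply contDiff_const).add (contDiff_const (c := s) |>.smul h2))

theorem surjective_of_notMem_milnorSet
    {Ψ : EuclideanSpace ℝ (Fin m) → EuclideanSpace ℝ (Fin p)} {x : EuclideanSpace ℝ (Fin m)}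
    (hx : x ∉ milnorSet univ p Ψ) :
    Function.Surjective ((innerSL ℝ x).prod (fderiv ℝ Ψ x)) := by
  simp only [milnorSet, mem_univ, true_and, mem_ofPred_eq, not_lt] at hx
  have h := LinearMap.range_eq_top.1 (Submodule.eq_top_of_finrank_eq
    (le_antisymm (Submodule.finrank_le _) ((by simp :
      Module.finrank ℝ (ℝ × EuclideanSpace ℝ (Fin p)) = 1 + p).trans_le hx)))
  exact h

theorem hasFDerivAt_normalized
    {Ψ : EuclideanSpace ℝ (Fin m) → EuclideanSpace ℝ (Fin p)} {x : EuclideanSpace ℝ (Fin m)}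
    (hΨ : DifferentiableAt ℝ Ψ x) (hx : Ψ x ≠ 0) :
    DifferentiableAt ℝ (normalized Ψ) x ∧ ∃ l : EuclideanSpace ℝ (Fin m) →L[ℝ] ℝ,
      ∀ w, fderiv ℝ (normalized Ψ) x w = ‖Ψ x‖⁻¹ • fderiv ℝ Ψ x w + l w • Ψ x := by
  have h1 : DifferentiableAt ℝ (fun x => ‖Ψ x‖⁻¹) x :=
    (hΨ.norm ℝ hx).inv (norm_ne_zero_iff.2 hx)
  have h2 := h1.hasFDerivAt.smul hΨ.hasFDerivAt
  refine ⟨h2.differentiableAt, fderiv ℝ (fun x => ‖Ψ x‖⁻¹) x, fun w => ?_⟩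
  have h3 : fderiv ℝ (normalized Ψ) x = _ := h2.fderiv
  rw [h3]
  simp

theorem norm_normalized {Ψ : EuclideanSpace ℝ (Fin m) → EuclideanSpace ℝ (Fin p)}
    {x : EuclideanSpace ℝ (Fin m)} (hx : Ψ x ≠ 0) : ‖normalized Ψ x‖ = 1 := by
  rw [normalized, norm_smul, norm_inv, norm_norm, inv_mul_cancel₀ (norm_ne_zero_iff.2 hx)]

theorem inner_fderiv_normalized
    {Ψ : EuclideanSpace ℝ (Fin m) → EuclideanSpace ℝ (Fin p)} {x : EuclideanSpace ℝ (Fin m)}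
    (hΨ : DifferentiableAt ℝ Ψ x) (hx : Ψ x ≠ 0) (w : EuclideanSpace ℝ (Fin m)) :
    inner ℝ (Ψ x) (fderiv ℝ (normalized Ψ) x w) = 0 := by
  have hd := (hasFDerivAt_normalized hΨ hx).1
  have h1 := (hd.hasFDerivAt.inner ℝ hd.hasFDerivAt)
  have h2 : HasFDerivAt (fun y => inner ℝ (normalized Ψ y) (normalized Ψ y))
      (0 : EuclideanSpace ℝ (Fin m) →L[ℝ] ℝ) x := by
    refine (hasFDerivAt_const (1 : ℝ) x).congr_of_eventuallyEq ?_
    filter_upwards [hΨ.continuousAt.eventually_ne hx] with y hy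
    rw [real_inner_self_eq_norm_sq, norm_normalized hy, one_pow]
  have h3 := DFunLike.congr_fun (h1.unique h2) w
  simp only [ContinuousLinearMap.comp_apply, ContinuousLinearMap.prod_apply,
    fderivInnerCLM_apply, zero_apply] at h3
  rw [real_inner_comm (normalized Ψ x) (fderiv ℝ (normalized Ψ) x w)] at h3
  have h4 : inner ℝ (normalized Ψ x) (fderiv ℝ (normalized Ψ) x w) = 0 := by
    rw [real_inner_comm] at h3 ⊢
    linarith
  rw [normalized, inner_smul_left] at h4
  simpa [hx] using h4

/-- The differential of `(ρ, Ψ/‖Ψ‖)` takes values in `ℝ × (Ψ x)ᗮ`, of dimension `p`, and off the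
Milnor set fills it. Up to the factor `‖Ψ x‖`, the differential of `Ψ` differs from that of `Ψ/‖Ψ‖`
by a multiple of `Ψ x`, which the scalar variable supplies when `c x ≠ 0`. -/
theorem surjective_extendedDifferential
    {Ψ : EuclideanSpace ℝ (Fin m) → EuclideanSpace ℝ (Fin p)} {x : EuclideanSpace ℝ (Fin m)}
    (hp : 1 ≤ p) (hΨ : DifferentiableAt ℝ Ψ x) (hx : Ψ x ≠ 0)
    (hM : x ∉ milnorSet (zeroLocus Ψ)ᶜ (p - 1) (normalized Ψ))
    {c : EuclideanSpace ℝ (Fin m) → ℝ} (hc : c x ≠ 0) :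
    Function.Surjective (extendedDifferential Ψ c x) := by
  obtain ⟨-, l, hl⟩ := hasFDerivAt_normalized hΨ hx
  have hV : x ∈ (zeroLocus Ψ)ᶜ := hx
  simp only [milnorSet, hV, true_and, mem_ofPred_eq, not_lt] at hM
  set L : EuclideanSpace ℝ (Fin m) →ₗ[ℝ] ℝ × EuclideanSpace ℝ (Fin p) :=
    (((innerSL ℝ x).prod (fderiv ℝ (normalized Ψ) x) :
        EuclideanSpace ℝ (Fin m) →L[ℝ] ℝ × EuclideanSpace ℝ (Fin p)) :
        EuclideanSpace ℝ (Fin m) →ₗ[ℝ] ℝ × EuclideanSpace ℝ (Fin p))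
  set f : ℝ × EuclideanSpace ℝ (Fin p) →ₗ[ℝ] ℝ :=
    (innerSL ℝ (Ψ x) : EuclideanSpace ℝ (Fin p) →ₗ[ℝ] ℝ).comp (LinearMap.snd ℝ ℝ _)
  have hf : f ≠ 0 := by
    intro h
    have := DFunLike.congr_fun h (0, Ψ x)
    simp [f] at this
    exact hx this
  have hle : LinearMap.range L ≤ LinearMap.ker f := by
    rintro _ ⟨w, rfl⟩
    exact inner_fderiv_normalized hΨ hx w
  have hker : Module.finrank ℝ (LinearMap.ker f) = p := by
    have h1 := Module.Dual.finrank_ker_add_one_of_ne_zero (f := f) hf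
    have h2 : Module.finrank ℝ (ℝ × EuclideanSpace ℝ (Fin p)) = 1 + p := by simp
    omega
  have heq : LinearMap.range L = LinearMap.ker f :=
    Submodule.eq_of_le_of_finrank_le hle (by omega)
  rintro ⟨a, v⟩
  -- `k • Ψ x` is the orthogonal projection of `v` to the line of `Ψ x`.
  set k := inner ℝ (Ψ x) v / ‖Ψ x‖ ^ 2
  have hn : ‖Ψ x‖ ≠ 0 := norm_ne_zero_iff.2 hx
  have hmem : (a, ‖Ψ x‖⁻¹ • (v - k • Ψ x)) ∈ LinearMap.ker f := by
    change inner ℝ (Ψ x) (‖Ψ x‖⁻¹ • (v - k • Ψ x)) = 0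
    rw [inner_smul_right, inner_sub_right, inner_smul_right, real_inner_self_eq_norm_sq]
    simp only [k]
    field_simp
    simp
  rw [← heq] at hmem
  obtain ⟨w, hw⟩ := hmem
  have hw1 : inner ℝ x w = a := congrArg Prod.fst hw
  have hw2 : fderiv ℝ (normalized Ψ) x w = ‖Ψ x‖⁻¹ • (v - k • Ψ x) := congrArg Prod.snd hw
  rw [hl] at hw2
  refine ⟨(w, (k + ‖Ψ x‖ * l w) / c x), ?_⟩
  rw [extendedDifferential_apply, hw1, smul_smul, div_mul_cancel₀ _ hc]
  congr 1
  have hw3 := congrArg (fun u => ‖Ψ x‖ • u) hw2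
  simp only [smul_add, smul_smul, mul_inv_cancel₀ hn, one_smul] at hw3
  rw [add_smul, add_comm (k • Ψ x), ← add_assoc, hw3, sub_add_cancel]

/-- The data of vector fields on an open shell minus the zero locus which move the radius and the
value of `Ψ` in a prescribed way, up to multiples of `Ψ`, and exactly near the zero locus. -/
structure LiftData (Ψ : EuclideanSpace ℝ (Fin m) → EuclideanSpace ℝ (Fin p)) (a b δ T : ℝ)
    (A : EuclideanSpace ℝ (Fin m) →
      ℝ × EuclideanSpace ℝ (Fin p) →L[ℝ] EuclideanSpace ℝ (Fin m))
    (σ : EuclideanSpace ℝ (Fin m) → ℝ × EuclideanSpace ℝ (Fin p) →L[ℝ] ℝ) : Prop where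
  smooth_map : ContDiff ℝ ∞ Ψ
  pos : 0 < a
  radius_pos : 0 < δ
  smooth : ContDiffOn ℝ ∞ A {x | a < ‖x‖ ∧ ‖x‖ < b ∧ Ψ x ≠ 0}
  bound : ∀ x, a < ‖x‖ → ‖x‖ < b → Ψ x ≠ 0 → ‖σ x‖ ≤ T
  near : ∀ x, a < ‖x‖ → ‖x‖ < b → Ψ x ≠ 0 → ‖Ψ x‖ < δ → σ x = 0
  inner_eq : ∀ x, a < ‖x‖ → ‖x‖ < b → Ψ x ≠ 0 → ∀ q, inner ℝ x (A x q) = q.1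
  fderiv_eq : ∀ x, a < ‖x‖ → ‖x‖ < b → Ψ x ≠ 0 → ∀ q,
    fderiv ℝ Ψ x (A x q) = q.2 - σ x q • Ψ x

/-- The cut-off `c` vanishes near `V`, where the differential of `(ρ, Ψ)` alone is onto by `hM'`;
elsewhere `hM` applies, with the multiple of `Ψ` switched on. So `extendedDifferential Ψ c` is onto
throughout the shell off `V`, and one smooth right inverse yields both the field and its correction.
-/
theorem exists_liftData {Ψ : EuclideanSpace ℝ (Fin m) → EuclideanSpace ℝ (Fin p)}
    (hp : 1 ≤ p) (hΨ : ContDiff ℝ ∞ Ψ) {a : ℝ} (ha : 0 < a)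
    (hM : milnorSet (zeroLocus Ψ)ᶜ (p - 1) (normalized Ψ) ⊆ ball 0 a)
    (hM' : closure (milnorSet univ p Ψ \ zeroLocus Ψ) ∩ zeroLocus Ψ ⊆ ball 0 a) (b : ℝ) :
    ∃ δ T A σ, LiftData Ψ a b δ T A σ := by
  have hcont := hΨ.continuous
  set S : Set (EuclideanSpace ℝ (Fin m)) := {x | a ≤ ‖x‖ ∧ ‖x‖ ≤ b}
  have hS : IsCompact S := by
    refine (isCompact_closedBall (0 : EuclideanSpace ℝ (Fin m)) b).of_isClosed_subset
      ((isClosed_le continuous_const continuous_norm).inter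
        (isClosed_le continuous_norm continuous_const)) fun x hx => ?_
    simpa using hx.2
  -- The closed Milnor set meets the compact shell in a compact set disjoint from `V`; `δ₀` is the
  -- minimum of `‖Ψ‖` there, or 1 if that set is empty.
  obtain ⟨δ₀, hδ₀, hδM⟩ : ∃ δ₀ > 0, ∀ x ∈ S, Ψ x ≠ 0 → ‖Ψ x‖ < δ₀ → x ∉ milnorSet univ p Ψ := by
    have hC : IsCompact (S ∩ closure (milnorSet univ p Ψ \ zeroLocus Ψ)) :=
      hS.inter_right isClosed_closure
    rcases (S ∩ closure (milnorSet univ p Ψ \ zeroLocus Ψ)).eq_empty_or_nonempty with he | hne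
    · refine ⟨1, one_pos, fun x hx hx0 _ hxM => ?_⟩
      have : x ∈ S ∩ closure (milnorSet univ p Ψ \ zeroLocus Ψ) :=
        ⟨hx, subset_closure ⟨hxM, hx0⟩⟩
      rw [he] at this
      exact this
    · obtain ⟨y, hy, hmin⟩ := hC.exists_isMinOn hne hcont.norm.continuousOn
      refine ⟨‖Ψ y‖, norm_pos_iff.2 fun h0 => ?_, fun x hx hx0 hlt hxM => ?_⟩
      · have := hM' ⟨hy.2, h0⟩
        rw [mem_ball_zero_iff] at this
        exact absurd hy.1.1 (not_le.2 this)
      · exact absurd (hmin ⟨hx, subset_closure ⟨hxM, hx0⟩⟩) (not_le.2 hlt)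
  -- Halving leaves a margin: `c` vanishes exactly where `‖Ψ‖ ≤ δ`, hence only where `‖Ψ‖ < δ₀`.
  set δ := δ₀ / 2
  have hδ : 0 < δ := by positivity
  set c : EuclideanSpace ℝ (Fin m) → ℝ := fun x =>
    Real.smoothTransition (‖Ψ x‖ ^ 2 - δ ^ 2)
  have hc : ContDiff ℝ ∞ c :=
    Real.smoothTransition.contDiff.comp ((hΨ.norm_sq ℝ).sub contDiff_const)
  have hc0 : ∀ x, ‖Ψ x‖ < δ → c x = 0 := fun x hx =>
    Real.smoothTransition.zero_of_nonpos (by nlinarith [norm_nonneg (Ψ x)])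
  have hc1 : ∀ x, c x = 0 → ‖Ψ x‖ < δ₀ := fun x hx => by
    have := Real.smoothTransition.zero_iff_nonpos.1 hx
    have h2 : ‖Ψ x‖ ≤ δ := by
      by_contra! h
      nlinarith
    exact h2.trans_lt (by simp only [δ]; linarith)
  obtain ⟨R, hR⟩ := exists_smooth_rightInverse (E := EuclideanSpace ℝ (Fin m) × ℝ)
    (F := ℝ × EuclideanSpace ℝ (Fin p))
  have hsurj : ∀ x ∈ S, Ψ x ≠ 0 → Function.Surjective (extendedDifferential Ψ c x) := by
    intro x hx hx0
    by_cases h : c x = 0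
    · have := surjective_of_notMem_milnorSet (hδM x hx hx0 (hc1 x h))
      intro q
      obtain ⟨w, hw⟩ := this q
      refine ⟨(w, 0), ?_⟩
      rw [extendedDifferential_apply, zero_smul, add_zero]
      exact hw
    · refine surjective_extendedDifferential hp (hΨ.differentiable (by simp) x) hx0
        (fun hxM => ?_) h
      have := hM hxM
      rw [mem_ball_zero_iff] at this
      exact absurd hx.1 (not_le.2 this)
  have hsm : ∀ x ∈ S, Ψ x ≠ 0 → ContDiffAt ℝ ∞ (fun x => R (extendedDifferential Ψ c x)) x :=
    fun x hx hx0 => (hR _ (hsurj x hx hx0)).1.comp x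
      (contDiff_extendedDifferential hΨ hc).contDiffAt
  set A : EuclideanSpace ℝ (Fin m) →
      ℝ × EuclideanSpace ℝ (Fin p) →L[ℝ] EuclideanSpace ℝ (Fin m) :=
    fun x => (ContinuousLinearMap.fst ℝ _ _).comp (R (extendedDifferential Ψ c x))
  set σ : EuclideanSpace ℝ (Fin m) → ℝ × EuclideanSpace ℝ (Fin p) →L[ℝ] ℝ :=
    fun x => c x • (ContinuousLinearMap.snd ℝ _ _).comp (R (extendedDifferential Ψ c x))
  -- Although the field need not be bounded near `V`, the correction is: it vanishes for `‖Ψ‖ < δ`,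
  -- and the rest of the shell is compact.
  obtain ⟨T, hT⟩ := (hS.inter_right (isClosed_le continuous_const hcont.norm :
      IsClosed {x | δ ≤ ‖Ψ x‖})).exists_bound_of_continuousOn (f := σ) (by
    intro x hx
    have hx0 : Ψ x ≠ 0 := norm_pos_iff.1 (hδ.trans_le hx.2)
    refine ContinuousAt.continuousWithinAt ?_
    exact hc.continuous.continuousAt.smul
      (continuousAt_const.clm_comp (hsm x hx.1 hx0).continuousAt))
  have key : ∀ x ∈ S, Ψ x ≠ 0 → ∀ q, inner ℝ x (A x q) = q.1 ∧
      fderiv ℝ Ψ x (A x q) = q.2 - σ x q • Ψ x := by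
    intro x hx hx0 q
    have := (hR _ (hsurj x hx hx0)).2 q
    rw [← Prod.mk.eta (p := R (extendedDifferential Ψ c x) q), extendedDifferential_apply] at this
    refine ⟨congrArg Prod.fst this, eq_sub_of_add_eq ?_⟩
    have h2 := congrArg Prod.snd this
    simp only [smul_smul, mul_comm _ (c x)] at h2
    exact h2
  refine ⟨δ, max T 0, A, σ, hΨ, ha, hδ, fun x hx => ?_, fun x h1 h2 h3 => ?_,
    fun x _ _ _ hlt => ?_, fun x h1 h2 h3 q => (key x ⟨h1.le, h2.le⟩ h3 q).1,
    fun x h1 h2 h3 q => (key x ⟨h1.le, h2.le⟩ h3 q).2⟩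
  · exact (contDiffAt_const.clm_comp (hsm x ⟨hx.1.le, hx.2.1.le⟩ hx.2.2)).contDiffWithinAt
  · rcases lt_or_ge ‖Ψ x‖ δ with h | h
    · simp [σ, hc0 x h]
    · exact (hT x ⟨⟨h1.le, h2.le⟩, h⟩).trans (le_max_left _ _)
  · simp [σ, hc0 x hlt]

end Lift

/-! ### Integral curves of the lifted fields -/

section Curves

theorem eq_add_smul_of_hasDerivWithinAt {G : Type*} [NormedAddCommGroup G] [NormedSpace ℝ G]
    {f : ℝ → G} {v : G} {T : ℝ}
    (h : ∀ t ∈ Icc 0 T, HasDerivWithinAt f v (Icc 0 T) t) :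
    ∀ t ∈ Icc 0 T, f t = f 0 + t • v := by
  intro t ht
  have h1 : ∀ t ∈ Icc 0 T, HasDerivWithinAt (fun t => f t - t • v) 0 (Icc 0 T) t := by
    intro t ht
    have := (h t ht).sub ((hasDerivWithinAt_id t (Icc 0 T)).smul_const v)
    rw [one_smul, sub_self] at this
    exact this
  have := constant_of_has_deriv_right_zero (fun t ht => (h1 t ht).continuousWithinAt)
    (fun t ht => hasDerivWithinAt_Ici_of_Icc (h1 t ⟨ht.1, ht.2.le⟩) ht) t ht
  simp only [zero_smul, sub_zero] at this
  rw [← this, sub_add_cancel]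

/-- A solution of `f' = -s f` with `|s| ≤ M` decays at most exponentially. -/
theorem norm_ge_of_hasDerivWithinAt {G : Type*} [NormedAddCommGroup G] [InnerProductSpace ℝ G]
    {f : ℝ → G} {s : ℝ → ℝ} {M T : ℝ} (hs : ∀ t ∈ Icc 0 T, |s t| ≤ M)
    (h : ∀ t ∈ Icc 0 T, HasDerivWithinAt f (-(s t • f t)) (Icc 0 T) t) :
    ∀ t ∈ Icc 0 T, ‖f 0‖ * Real.exp (-M * t) ≤ ‖f t‖ := by
  intro t ht
  -- This function is nondecreasing because `s t ≤ M`.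
  have h1 : ∀ t ∈ Icc 0 T, HasDerivWithinAt (fun t => ‖f t‖ ^ 2 * Real.exp (2 * M * t))
      (2 * (M - s t) * ‖f t‖ ^ 2 * Real.exp (2 * M * t)) (Icc 0 T) t := by
    intro t ht
    have h2 := (h t ht).norm_sq
    have h3 := (((hasDerivAt_id t).const_mul (2 * M)).exp).hasDerivWithinAt (s := Icc 0 T)
    refine (h2.mul h3).congr_deriv ?_
    rw [inner_neg_right, inner_smul_right, real_inner_self_eq_norm_sq]
    simp only [id]
    ring
  have hmono : MonotoneOn (fun t => ‖f t‖ ^ 2 * Real.exp (2 * M * t)) (Icc 0 T) := by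
    refine monotoneOn_of_hasDerivWithinAt_nonneg (convex_Icc 0 T)
      (fun t ht => (h1 t ht).continuousWithinAt)
      (fun t ht => (h1 t (interior_subset ht)).mono interior_subset) fun t ht => ?_
    have := (abs_le.1 (hs t (interior_subset ht))).2
    have h5 : 0 ≤ M - s t := by linarith
    positivity
  have h4 := hmono ⟨le_rfl, ht.1.trans ht.2⟩ ht ht.1
  simp only [mul_zero, Real.exp_zero, mul_one] at h4
  refine abs_le_of_sq_le_sq' ?_ (norm_nonneg _) |>.2
  rw [mul_pow, ← Real.exp_nat_mul]
  calc ‖f 0‖ ^ 2 * Real.exp ((2 : ℕ) * (-M * t))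
      ≤ ‖f t‖ ^ 2 * Real.exp (2 * M * t) * Real.exp ((2 : ℕ) * (-M * t)) := by gcongr
    _ = ‖f t‖ ^ 2 := by
      rw [mul_assoc, ← Real.exp_add]
      have : 2 * M * t + ((2 : ℕ) : ℝ) * (-M * t) = 0 := by push_cast; ring
      rw [this, Real.exp_zero, mul_one]

variable {m p : ℕ} {Ψ : EuclideanSpace ℝ (Fin m) → EuclideanSpace ℝ (Fin p)} {a b δ T : ℝ}
  {A : EuclideanSpace ℝ (Fin m) → ℝ × EuclideanSpace ℝ (Fin p) →L[ℝ] EuclideanSpace ℝ (Fin m)}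
  {σ : EuclideanSpace ℝ (Fin m) → ℝ × EuclideanSpace ℝ (Fin p) →L[ℝ] ℝ}

/-- The open shell with radii `a` and `b`, without the zero locus of `Ψ`. -/
def puncturedShell (Ψ : EuclideanSpace ℝ (Fin m) → EuclideanSpace ℝ (Fin p)) (a b : ℝ) :
    Set (EuclideanSpace ℝ (Fin m)) := {x | a < ‖x‖ ∧ ‖x‖ < b ∧ Ψ x ≠ 0}

theorem isOpen_puncturedShell (hΨ : Continuous Ψ) : IsOpen (puncturedShell Ψ a b) :=
  (isOpen_lt continuous_const continuous_norm).inter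
    ((isOpen_lt continuous_norm continuous_const).inter (isOpen_ne_fun hΨ continuous_const))

theorem IsFlowLine.hasDerivWithinAt_comp {Z : EuclideanSpace ℝ (Fin m) → EuclideanSpace ℝ (Fin m)}
    {Ω : Set (EuclideanSpace ℝ (Fin m))} {T₁ t : ℝ} {γ : ℝ → EuclideanSpace ℝ (Fin m)}
    (h : IsFlowLine Z Ω T₁ γ) (ht : t ∈ Icc 0 T₁) (hΨ : ContDiff ℝ ∞ Ψ) :
    HasDerivWithinAt (fun t => Ψ (γ t)) (fderiv ℝ Ψ (γ t) (Z (γ t))) (Icc 0 T₁) t :=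
  (hΨ.differentiable (by simp) (γ t)).hasFDerivAt.comp_hasDerivWithinAt t (h t ht).2

theorem IsFlowLine.norm_sq_eq {Z : EuclideanSpace ℝ (Fin m) → EuclideanSpace ℝ (Fin m)}
    {Ω : Set (EuclideanSpace ℝ (Fin m))} {T₁ c : ℝ} {γ : ℝ → EuclideanSpace ℝ (Fin m)}
    (h : IsFlowLine Z Ω T₁ γ) (hZ : ∀ x ∈ Ω, inner ℝ x (Z x) = c) :
    ∀ t ∈ Icc 0 T₁, ‖γ t‖ ^ 2 = ‖γ 0‖ ^ 2 + t * (2 * c) := by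
  refine eq_add_smul_of_hasDerivWithinAt (f := fun t => ‖γ t‖ ^ 2) fun t ht => ?_
  have := (h t ht).2.norm_sq
  rwa [hZ _ (h t ht).1] at this

theorem isClosed_normSq_mem_uIcc (r s : ℝ) :
    IsClosed {y : EuclideanSpace ℝ (Fin m) | ‖y‖ ^ 2 ∈ uIcc r s} :=
  isClosed_Icc.preimage (continuous_norm.pow 2)

theorem isCompact_normSq_mem_uIcc (r s : ℝ) :
    IsCompact {y : EuclideanSpace ℝ (Fin m) | ‖y‖ ^ 2 ∈ uIcc r s} := by
  refine (isCompact_closedBall (0 : EuclideanSpace ℝ (Fin m)) (1 + |max r s|)).of_isClosed_subset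
    (isClosed_normSq_mem_uIcc r s) fun y hy => ?_
  rw [mem_closedBall_zero_iff]
  have h1 : ‖y‖ ^ 2 ≤ |max r s| := hy.2.trans (le_abs_self _)
  nlinarith [norm_nonneg y, abs_nonneg (max r s)]

theorem norm_mem_of_normSq_mem_uIcc {r s : ℝ} (ha : 0 < a) (hr : a < r ∧ r < b)
    (hs : a < s ∧ s < b) {y : EuclideanSpace ℝ (Fin m)} (hy : ‖y‖ ^ 2 ∈ uIcc (r ^ 2) (s ^ 2)) :
    a < ‖y‖ ∧ ‖y‖ < b := by
  rw [mem_uIcc] at hy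
  constructor
  · refine lt_of_pow_lt_pow_left₀ 2 (norm_nonneg y) ?_
    have h1 : a ^ 2 < r ^ 2 := by nlinarith
    have h2 : a ^ 2 < s ^ 2 := by nlinarith
    rcases hy with h | h <;> linarith
  · refine lt_of_pow_lt_pow_left₀ 2 (by linarith) ?_
    have h1 : r ^ 2 < b ^ 2 := by nlinarith
    have h2 : s ^ 2 < b ^ 2 := by nlinarith
    rcases hy with h | h <;> linarith

theorem add_mul_mem_uIcc {u v t : ℝ} (ht : t ∈ Icc (0 : ℝ) 1) :
    u + t * (v - u) ∈ uIcc u v := by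
  rw [mem_uIcc]
  rcases le_total u v with h | h
  · left; constructor <;> nlinarith [ht.1, ht.2]
  · right; constructor <;> nlinarith [ht.1, ht.2]

/-- Near the zero locus one can move the radius and the value of `Ψ` at will. -/
theorem LiftData.exists_reaches_near (D : LiftData Ψ a b δ T A σ)
    {x : EuclideanSpace ℝ (Fin m)} (hx : a < ‖x‖ ∧ ‖x‖ < b) {r : ℝ} (hr : a < r ∧ r < b)
    {v : EuclideanSpace ℝ (Fin p)}
    (hv : ∀ t ∈ Icc (0 : ℝ) 1, Ψ x + t • v ≠ 0 ∧ ‖Ψ x + t • v‖ < δ) :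
    ∃ y, Reaches A (puncturedShell Ψ a b) ((r ^ 2 - ‖x‖ ^ 2) / 2, v) x y ∧ ‖y‖ = r ∧
      Ψ y = Ψ x + v := by
  -- The half makes `‖γ t‖ ^ 2` affine in `t` with slope `2 * c`, so that it equals `r ^ 2` at time
  -- one.
  set c := (r ^ 2 - ‖x‖ ^ 2) / 2
  set Q := (fun t : ℝ => Ψ x + t • v) '' Icc (0 : ℝ) 1
  have hQ : IsClosed Q := (isCompact_Icc.image (by fun_prop)).isClosed
  have hap : ∀ T₁ ∈ Icc (0 : ℝ) 1, ∀ γ,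
      IsFlowLine (fun x => A x (c, v)) (puncturedShell Ψ a b) T₁ γ → γ 0 = x →
        ‖γ T₁‖ ^ 2 = ‖x‖ ^ 2 + T₁ * (2 * c) ∧ Ψ (γ T₁) = Ψ x + T₁ • v := by
    intro T₁ hT₁ γ hγ h0
    have hnorm := hγ.norm_sq_eq (fun x hx => D.inner_eq x hx.1 hx.2.1 hx.2.2 _) T₁
      ⟨hT₁.1, le_rfl⟩
    rw [h0] at hnorm
    refine ⟨hnorm, ?_⟩
    rcases hT₁.1.eq_or_lt with h01 | hpos
    · rw [← h01, h0]; simp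
    have hcont : ContinuousOn (fun s : ℝ => (T₁ * s, Ψ (γ (T₁ * s)))) (Icc 0 1) := by
      have h1 : ContinuousOn (fun s : ℝ => γ (T₁ * s)) (Icc 0 1) :=
        hγ.continuousOn.comp (by fun_prop) fun s hs =>
          ⟨mul_nonneg hpos.le hs.1, mul_le_of_le_one_right hpos.le hs.2⟩
      exact ContinuousOn.prodMk (by fun_prop) (D.smooth_map.continuous.comp_continuousOn h1)
    -- A continuation argument: while `‖Ψ‖ < δ` the correction vanishes and `Ψ` moves along the
    -- segment, and the segment lies in that open set. Time is rescaled to `[0, 1]` and carried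
    -- along as a coordinate, so that `C` can record the position expected at each moment.
    have := mem_of_forall_not_exit (O := {q : ℝ × EuclideanSpace ℝ (Fin p) | ‖q.2‖ < δ})
      (C := {q : ℝ × EuclideanSpace ℝ (Fin p) | q.1 ∈ Icc (0 : ℝ) 1 ∧ q.2 = Ψ x + q.1 • v})
      hcont (isOpen_lt (by fun_prop) continuous_const)
      ((isClosed_Icc.preimage continuous_fst).inter (isClosed_eq (by fun_prop) (by fun_prop)))
      (fun q hq => by
        have := (hv q.1 hq.1).2
        rw [← hq.2] at this
        exact this) (by simp [h0]) (fun S hS hnear => by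
        have hTS : T₁ * S ≤ T₁ := mul_le_of_le_one_right hpos.le hS.2
        refine ⟨⟨mul_nonneg hpos.le hS.1, hTS.trans hT₁.2⟩, ?_⟩
        have hγ' := hγ.restrict hTS
        have h2 := eq_add_smul_of_hasDerivWithinAt (f := fun t => Ψ (γ t)) (v := v)
          (fun t ht => by
            have h3 := hγ'.hasDerivWithinAt_comp ht D.smooth_map
            have h4 := (hγ' t ht).1
            have h5 : ‖Ψ (γ t)‖ < δ := by
              have := hnear (t / T₁) ⟨div_nonneg ht.1 hpos.le, by
                rw [div_le_iff₀ hpos, mul_comm]; exact ht.2⟩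
              simp only [mul_div_cancel₀ t hpos.ne'] at this
              exact this
            rw [D.fderiv_eq _ h4.1 h4.2.1 h4.2.2, D.near _ h4.1 h4.2.1 h4.2.2 h5] at h3
            simpa using h3) (T₁ * S) ⟨mul_nonneg hpos.le hS.1, le_rfl⟩
        simpa [h0] using h2) 1 (by simp)
    simpa using this.2
  obtain ⟨γ, hγ, h0⟩ := exists_reaches (isOpen_puncturedShell D.smooth_map.continuous) D.smooth
    (C := {y | ‖y‖ ^ 2 ∈ uIcc (‖x‖ ^ 2) (r ^ 2) ∧ Ψ y ∈ Q}) (lam := (c, v)) (x := x)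
    ((isCompact_normSq_mem_uIcc _ _).inter_right (hQ.preimage D.smooth_map.continuous))
    (fun y hy => by
      have := norm_mem_of_normSq_mem_uIcc D.pos hx hr hy.1
      refine ⟨this.1, this.2, ?_⟩
      obtain ⟨t, ht, h⟩ := hy.2
      rw [← h]
      exact (hv t ht).1) ⟨left_mem_uIcc, ⟨0, by simp, by simp⟩⟩
    (fun T₁ hT₁ γ hγ h0 => by
      obtain ⟨h1, h2⟩ := hap T₁ hT₁ γ hγ h0
      refine ⟨?_, ⟨T₁, hT₁, h2.symm⟩⟩
      have := add_mul_mem_uIcc (u := ‖x‖ ^ 2) (v := r ^ 2) hT₁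
      rw [show r ^ 2 - ‖x‖ ^ 2 = 2 * c by simp only [c]; ring] at this
      rw [h1]
      exact this)
  obtain ⟨h1, h2⟩ := hap 1 (by simp) γ hγ h0
  refine ⟨γ 1, ⟨γ, hγ, h0, rfl⟩, ?_, by simpa using h2⟩
  refine (pow_left_inj₀ (norm_nonneg _) (D.pos.trans hr.1).le two_ne_zero).1 ?_
  rw [h1]
  simp only [c]
  ring

/-- One can move the radius at will, without changing the direction of `Ψ`. -/
theorem LiftData.exists_reaches_radial (D : LiftData Ψ a b δ T A σ)
    {x : EuclideanSpace ℝ (Fin m)} (hx : x ∈ puncturedShell Ψ a b) {r : ℝ} (hr : a < r ∧ r < b) :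
    ∃ y, Reaches A (puncturedShell Ψ a b) ((r ^ 2 - ‖x‖ ^ 2) / 2, 0) x y ∧ ‖y‖ = r ∧
      Ψ y ≠ 0 ∧ normalized Ψ y = normalized Ψ x := by
  set c := (r ^ 2 - ‖x‖ ^ 2) / 2
  set lam : ℝ × EuclideanSpace ℝ (Fin p) := (c, 0)
  -- Along the flow `Ψ' = -s Ψ` with `|s| ≤ M`, so up to time one `‖Ψ‖` loses at most the factor
  -- `exp (-M)`.
  set M := T * ‖lam‖
  have hM : ∀ y ∈ puncturedShell Ψ a b, |σ y lam| ≤ M := fun y hy =>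
    ((σ y).le_opNorm lam).trans
      (mul_le_mul_of_nonneg_right (D.bound y hy.1 hy.2.1 hy.2.2) (norm_nonneg _))
  have hM0 : 0 ≤ M := (abs_nonneg _).trans (hM x hx)
  have hap : ∀ T₁ ∈ Icc (0 : ℝ) 1, ∀ γ,
      IsFlowLine (fun x => A x lam) (puncturedShell Ψ a b) T₁ γ → γ 0 = x →
        ‖γ T₁‖ ^ 2 = ‖x‖ ^ 2 + T₁ * (2 * c) ∧ ‖Ψ x‖ * Real.exp (-M) ≤ ‖Ψ (γ T₁)‖ ∧
          normalized Ψ (γ T₁) = normalized Ψ x := by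
    intro T₁ hT₁ γ hγ h0
    have hnorm := hγ.norm_sq_eq (fun x hx => D.inner_eq x hx.1 hx.2.1 hx.2.2 _) T₁
      ⟨hT₁.1, le_rfl⟩
    rw [h0] at hnorm
    refine ⟨hnorm, ?_, ?_⟩
    · have := norm_ge_of_hasDerivWithinAt (f := fun t => Ψ (γ t)) (s := fun t => σ (γ t) lam)
        (M := M) (fun t ht => hM _ (hγ t ht).1) (fun t ht => by
          have h3 := hγ.hasDerivWithinAt_comp ht D.smooth_map
          have h4 := (hγ t ht).1
          rw [D.fderiv_eq _ h4.1 h4.2.1 h4.2.2] at h3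
          simpa [lam] using h3) T₁ ⟨hT₁.1, le_rfl⟩
      rw [h0] at this
      refine le_trans ?_ this
      gcongr
      nlinarith [hT₁.2]
    · have := eq_add_smul_of_hasDerivWithinAt (f := fun t => normalized Ψ (γ t)) (v := 0)
        (fun t ht => by
          have h4 := (hγ t ht).1
          have hd := D.smooth_map.differentiable (by simp) (γ t)
          obtain ⟨h5, l, hl⟩ := hasFDerivAt_normalized hd h4.2.2
          have h6 := h5.hasFDerivAt.comp_hasDerivWithinAt t (hγ t ht).2
          have h7 := inner_fderiv_normalized hd h4.2.2 (A (γ t) lam)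
          have h8 := hl (A (γ t) lam)
          rw [D.fderiv_eq _ h4.1 h4.2.1 h4.2.2] at h8
          simp only [lam, zero_sub, smul_smul, ← neg_smul, ← add_smul] at h8
          -- The velocity of `Ψ/‖Ψ‖` is both a multiple of `Ψ` and orthogonal to `Ψ`, hence zero.
          rw [h8, inner_smul_right, real_inner_self_eq_norm_sq, mul_eq_zero] at h7
          have h9 := h7.resolve_right (pow_ne_zero 2 (norm_ne_zero_iff.2 h4.2.2))
          rw [h9, zero_smul] at h8
          rw [h8] at h6
          exact h6) T₁ ⟨hT₁.1, le_rfl⟩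
      simpa [h0] using this
  have hpos : 0 < ‖Ψ x‖ * Real.exp (-M) :=
    mul_pos (norm_pos_iff.2 hx.2.2) (Real.exp_pos _)
  obtain ⟨γ, hγ, h0⟩ := exists_reaches (isOpen_puncturedShell D.smooth_map.continuous) D.smooth
    (C := {y | ‖y‖ ^ 2 ∈ uIcc (‖x‖ ^ 2) (r ^ 2) ∧ ‖Ψ x‖ * Real.exp (-M) ≤ ‖Ψ y‖})
    (lam := lam) (x := x)
    ((isCompact_normSq_mem_uIcc _ _).inter_right
      (isClosed_le continuous_const D.smooth_map.continuous.norm))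
    (fun y hy => by
      have := norm_mem_of_normSq_mem_uIcc D.pos ⟨hx.1, hx.2.1⟩ hr hy.1
      exact ⟨this.1, this.2, norm_pos_iff.1 (hpos.trans_le hy.2)⟩)
    ⟨left_mem_uIcc, mul_le_of_le_one_right (norm_nonneg _) (Real.exp_le_one_iff.2 (by linarith))⟩
    (fun T₁ hT₁ γ hγ h0 => by
      obtain ⟨h1, h2, -⟩ := hap T₁ hT₁ γ hγ h0
      refine ⟨?_, h2⟩
      have := add_mul_mem_uIcc (u := ‖x‖ ^ 2) (v := r ^ 2) hT₁
      rw [show r ^ 2 - ‖x‖ ^ 2 = 2 * c by simp only [c]; ring] at this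
      rw [h1]
      exact this)
  obtain ⟨h1, h2, h3⟩ := hap 1 (by simp) γ hγ h0
  refine ⟨γ 1, ⟨γ, hγ, h0, rfl⟩, ?_, norm_pos_iff.1 (hpos.trans_le h2), h3⟩
  refine (pow_left_inj₀ (norm_nonneg _) (D.pos.trans hr.1).le two_ne_zero).1 ?_
  rw [h1]
  simp only [c]
  ring

/-- The field which moves `Ψ / ⟪Ψ, e⟫` with constant speed. -/
def pageField (Ψ : EuclideanSpace ℝ (Fin m) → EuclideanSpace ℝ (Fin p))
    (A : EuclideanSpace ℝ (Fin m) →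
      ℝ × EuclideanSpace ℝ (Fin p) →L[ℝ] EuclideanSpace ℝ (Fin m))
    (e : EuclideanSpace ℝ (Fin p)) (x : EuclideanSpace ℝ (Fin m)) :
    EuclideanSpace ℝ (Fin p) →L[ℝ] EuclideanSpace ℝ (Fin m) :=
  inner ℝ e (Ψ x) • (A x).comp (ContinuousLinearMap.inr ℝ ℝ (EuclideanSpace ℝ (Fin p)))

theorem LiftData.contDiffOn_pageField (D : LiftData Ψ a b δ T A σ)
    (e : EuclideanSpace ℝ (Fin p)) :
    ContDiffOn ℝ ∞ (pageField Ψ A e) (puncturedShell Ψ a b) :=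
  (contDiffOn_const.inner ℝ D.smooth_map.contDiffOn).smul (D.smooth.clm_comp contDiffOn_const)

/-- Central projection `u ↦ u / ⟪e, u⟫` is a chart of the half sphere around `e`. With `q = ⟪e, Ψ⟫`
and `w ⟂ e`, the flow satisfies `Ψ' = q w - s Ψ` and `q' = -s q`, so the unknown correction `s`
cancels and `(Ψ / q)' = w`. -/
theorem LiftData.exists_reaches_page (D : LiftData Ψ a b δ T A σ)
    {x : EuclideanSpace ℝ (Fin m)} (hx : x ∈ puncturedShell Ψ a b)
    {e w : EuclideanSpace ℝ (Fin p)} (he : 0 < inner ℝ e (Ψ x)) (hw : inner ℝ e w = 0) :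
    ∃ y, Reaches (pageField Ψ A e) (puncturedShell Ψ a b) w x y ∧ ‖y‖ = ‖x‖ ∧
      0 < inner ℝ e (Ψ y) ∧
      (inner ℝ e (Ψ y) : ℝ)⁻¹ • Ψ y = (inner ℝ e (Ψ x) : ℝ)⁻¹ • Ψ x + w := by
  have hcont := D.smooth_map.continuous
  obtain ⟨B, hB⟩ := (isCompact_normSq_mem_uIcc (‖x‖ ^ 2) (‖x‖ ^ 2)).exists_bound_of_continuousOn
    (f := fun y => (inner ℝ e (Ψ y) : ℝ)) (by fun_prop)
  have hT : 0 ≤ T := (norm_nonneg _).trans (D.bound x hx.1 hx.2.1 hx.2.2)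
  have hB0 : 0 ≤ B := (norm_nonneg _).trans (hB x (by simp))
  -- The radius is constant along the flow, so `|q| ≤ B` and the correction `σ (0, q w)` is at most
  -- `M`.
  set M := T * (B * ‖w‖)
  have hap : ∀ T₁ ∈ Icc (0 : ℝ) 1, ∀ γ,
      IsFlowLine (fun x => pageField Ψ A e x w) (puncturedShell Ψ a b) T₁ γ → γ 0 = x →
        ‖γ T₁‖ ^ 2 = ‖x‖ ^ 2 ∧ inner ℝ e (Ψ x) * Real.exp (-M) ≤ inner ℝ e (Ψ (γ T₁)) ∧
          (inner ℝ e (Ψ (γ T₁)) : ℝ)⁻¹ • Ψ (γ T₁) = (inner ℝ e (Ψ x) : ℝ)⁻¹ • Ψ x + T₁ • w := by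
    intro T₁ hT₁ γ hγ h0
    have hnorm : ∀ t ∈ Icc 0 T₁, ‖γ t‖ ^ 2 = ‖x‖ ^ 2 := by
      intro t ht
      have := hγ.norm_sq_eq (c := 0) (fun x hx => by
        simp only [pageField, smul_apply, ContinuousLinearMap.comp_apply,
          inner_smul_right]
        rw [D.inner_eq x hx.1 hx.2.1 hx.2.2]
        simp) t ht
      rw [this, h0]; ring
    set s : ℝ → ℝ := fun t => σ (γ t) (0, (inner ℝ e (Ψ (γ t)) : ℝ) • w)
    have hderiv : ∀ t ∈ Icc 0 T₁, HasDerivWithinAt (fun t => Ψ (γ t))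
        ((inner ℝ e (Ψ (γ t)) : ℝ) • w - s t • Ψ (γ t)) (Icc 0 T₁) t := by
      intro t ht
      have h3 := hγ.hasDerivWithinAt_comp ht D.smooth_map
      have h4 := (hγ t ht).1
      refine h3.congr_deriv ?_
      simp only [pageField, smul_apply, ContinuousLinearMap.comp_apply]
      rw [← map_smul (A (γ t)), D.fderiv_eq _ h4.1 h4.2.1 h4.2.2]
      simp [s]
    have hq : ∀ t ∈ Icc 0 T₁, HasDerivWithinAt (fun t => (inner ℝ e (Ψ (γ t)) : ℝ))
        (-(s t • (inner ℝ e (Ψ (γ t)) : ℝ))) (Icc 0 T₁) t := by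
      intro t ht
      have := (hasDerivWithinAt_const t (Icc 0 T₁) e).inner ℝ (hderiv t ht)
      refine this.congr_deriv ?_
      rw [inner_sub_right, inner_smul_right, inner_smul_right, hw]
      simp
    have habs : ∀ t ∈ Icc 0 T₁,
        inner ℝ e (Ψ x) * Real.exp (-M) ≤ |(inner ℝ e (Ψ (γ t)) : ℝ)| := by
      intro t ht
      have := norm_ge_of_hasDerivWithinAt (M := M) (fun t ht => by
        have h4 := (hγ t ht).1
        refine ((σ (γ t)).le_opNorm _).trans ?_
        refine mul_le_mul (D.bound _ h4.1 h4.2.1 h4.2.2) ?_ (norm_nonneg _) hT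
        rw [Prod.norm_def, norm_zero, norm_smul]
        refine max_le (by positivity) ?_
        gcongr
        refine hB _ ?_
        rw [mem_ofPred_eq, hnorm t ht]
        simp) hq t ht
      rw [h0, Real.norm_eq_abs, abs_of_pos he, Real.norm_eq_abs] at this
      refine le_trans ?_ this
      gcongr
      have hM : 0 ≤ M := by positivity
      nlinarith [ht.2, hT₁.2]
    -- The lower bound on `|q|` excludes zeros, so `q` keeps its initial sign.
    have hpos : ∀ t ∈ Icc 0 T₁, 0 < inner ℝ e (Ψ (γ t)) := by
      intro t ht
      have hne : ∀ t ∈ Icc 0 T₁, inner ℝ e (Ψ (γ t)) ≠ 0 := fun t ht h => by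
        have := habs t ht
        rw [h, abs_zero] at this
        exact absurd this (not_le.2 (by positivity))
      by_contra! hle
      have hc : ContinuousOn (fun t => (inner ℝ e (Ψ (γ t)) : ℝ)) (Icc 0 t) :=
        fun u hu => ((hq u ⟨hu.1, hu.2.trans ht.2⟩).continuousWithinAt).mono
          (Icc_subset_Icc_right ht.2)
      obtain ⟨u, hu, hu0⟩ := intermediate_value_Icc' ht.1 hc ⟨hle, by rw [h0]; exact he.le⟩
      exact hne u ⟨hu.1, hu.2.trans ht.2⟩ hu0
    refine ⟨hnorm T₁ ⟨hT₁.1, le_rfl⟩, ?_, ?_⟩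
    · have := habs T₁ ⟨hT₁.1, le_rfl⟩
      rwa [abs_of_pos (hpos T₁ ⟨hT₁.1, le_rfl⟩)] at this
    · have := eq_add_smul_of_hasDerivWithinAt
        (f := fun t => (inner ℝ e (Ψ (γ t)) : ℝ)⁻¹ • Ψ (γ t)) (v := w) (fun t ht => by
          have hp := (hpos t ht).ne'
          refine (((hq t ht).inv hp).smul (hderiv t ht)).congr_deriv ?_
          have h1 : (fun t => (inner ℝ e (Ψ (γ t)) : ℝ))⁻¹ t = (inner ℝ e (Ψ (γ t)) : ℝ)⁻¹ := rfl
          rw [h1, smul_sub, smul_smul, inv_mul_cancel₀ hp, one_smul, smul_smul, smul_eq_mul,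
            neg_neg, pow_two, mul_div_mul_right _ _ hp, div_eq_inv_mul, sub_add_cancel]) T₁
          ⟨hT₁.1, le_rfl⟩
      simpa only [h0] using this
  have hpos : 0 < inner ℝ e (Ψ x) * Real.exp (-M) := mul_pos he (Real.exp_pos _)
  obtain ⟨γ, hγ, h0⟩ := exists_reaches (isOpen_puncturedShell hcont) (D.contDiffOn_pageField e)
    (C := {y | ‖y‖ ^ 2 ∈ uIcc (‖x‖ ^ 2) (‖x‖ ^ 2) ∧
      inner ℝ e (Ψ x) * Real.exp (-M) ≤ inner ℝ e (Ψ y)})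
    (lam := w) (x := x)
    ((isCompact_normSq_mem_uIcc _ _).inter_right
      (isClosed_le (f := fun _ => inner ℝ e (Ψ x) * Real.exp (-M))
        (g := fun y => (inner ℝ e (Ψ y) : ℝ)) continuous_const (continuous_const.inner hcont)))
    (fun y hy => by
      have := norm_mem_of_normSq_mem_uIcc D.pos ⟨hx.1, hx.2.1⟩ ⟨hx.1, hx.2.1⟩ hy.1
      refine ⟨this.1, this.2, fun h => ?_⟩
      have h2 := hpos.trans_le hy.2
      rw [h, inner_zero_right] at h2
      exact lt_irrefl _ h2)
    ⟨left_mem_uIcc, mul_le_of_le_one_right he.le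
      (Real.exp_le_one_iff.2 (neg_nonpos.2 (by positivity)))⟩
    (fun T₁ hT₁ γ hγ h0 => by
      obtain ⟨h1, h2, -⟩ := hap T₁ hT₁ γ hγ h0
      refine ⟨?_, h2⟩
      rw [h1]
      exact left_mem_uIcc)
  obtain ⟨h1, h2, h3⟩ := hap 1 (by simp) γ hγ h0
  refine ⟨γ 1, ⟨γ, hγ, h0, rfl⟩, ?_, hpos.trans_le h2, by simpa using h3⟩
  exact (pow_left_inj₀ (norm_nonneg _) (norm_nonneg _) two_ne_zero).1 h1

end Curves

/-! ### Construction of the open books and of the isotopies -/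

section OpenBook

/-- Common shape of the local trivialisations of both fibrations: time one with parameter `l u`
carries the fibre over `b` to the fibre over `u`, and `-l u` carries it back. -/
theorem isDiffeo_of_reaches {E Λ F : Type*} [NormedAddCommGroup E] [NormedSpace ℝ E]
    [FiniteDimensional ℝ E] [NormedAddCommGroup Λ] [NormedSpace ℝ Λ] [FiniteDimensional ℝ Λ]
    [NormedAddCommGroup F] [NormedSpace ℝ F] {X : E → Λ →L[ℝ] E} {Ω : Set E} (hΩ : IsOpen Ω)
    (hX : ContDiffOn ℝ ∞ X Ω) {π : E → F} {l : F → Λ} {S : Set E} {B U : Set F} {b : F}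
    (hπ : ∀ x ∈ S, ContDiffAt ℝ ∞ π x) (hl : ∀ u ∈ B ∩ U, ContDiffAt ℝ ∞ l u)
    (hSB : MapsTo π S B)
    (hto : ∀ x ∈ S, π x ∈ U → ∃ y ∈ S, π y = b ∧ Reaches X Ω (-l (π x)) x y)
    (hfrom : ∀ u ∈ B ∩ U, ∀ y ∈ S, π y = b → ∃ x ∈ S, π x = u ∧ Reaches X Ω (l u) y x) :
    IsDiffeo (fun x => (π x, timeOne X Ω (-l (π x), x))) (fun q => timeOne X Ω (l q.1, q.2))
      (S ∩ π ⁻¹' U) ((B ∩ U) ×ˢ (S ∩ π ⁻¹' {b})) where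
  smooth := by
    rintro x ⟨hx, hxU⟩
    obtain ⟨y, -, -, hr⟩ := hto x hx hxU
    have h1 : ContDiffAt ℝ ∞ (fun x => (-l (π x), x)) x :=
      ((hl _ ⟨hSB hx, hxU⟩).comp x (hπ x hx)).neg.prodMk contDiffAt_id
    exact ((hπ x hx).prodMk ((hr.contDiffAt_timeOne hΩ hX).comp (f := fun x => (-l (π x), x)) x h1)).contDiffWithinAt
  smooth_inv := by
    rintro ⟨u, y⟩ ⟨hu, hy, hyb⟩
    obtain ⟨x, -, -, hr⟩ := hfrom u hu y hy hyb
    have h1 : ContDiffAt ℝ ∞ (fun q : F × E => (l q.1, q.2)) (u, y) :=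
      ((hl _ hu).comp (u, y) contDiffAt_fst).prodMk contDiffAt_snd
    exact ((hr.contDiffAt_timeOne hΩ hX).comp (u, y) h1).contDiffWithinAt
  mapsTo := by
    rintro x ⟨hx, hxU⟩
    obtain ⟨y, hy, hyb, hr⟩ := hto x hx hxU
    simp only [hr.timeOne_eq hΩ hX]
    exact ⟨⟨hSB hx, hxU⟩, hy, hyb⟩
  mapsTo_inv := by
    rintro ⟨u, y⟩ ⟨hu, hy, hyb⟩
    obtain ⟨x, hx, hxu, hr⟩ := hfrom u hu y hy hyb
    simp only [hr.timeOne_eq hΩ hX]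
    exact ⟨hx, by rw [mem_preimage, hxu]; exact hu.2⟩
  leftInv := by
    rintro x ⟨hx, hxU⟩
    obtain ⟨y, -, -, hr⟩ := hto x hx hxU
    have hr' := hr.symm
    rw [neg_neg] at hr'
    simp only [hr.timeOne_eq hΩ hX, hr'.timeOne_eq hΩ hX]
  rightInv := by
    rintro ⟨u, y⟩ ⟨hu, hy, hyb⟩
    obtain ⟨x, -, hxu, hr⟩ := hfrom u hu y hy hyb
    simp only [hr.timeOne_eq hΩ hX, hxu, hr.symm.timeOne_eq hΩ hX]

theorem isPreconnected_ball_diff_zero {p : ℕ} (hp : 2 ≤ p) (δ : ℝ) :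
    IsPreconnected (ball (0 : EuclideanSpace ℝ (Fin p)) δ \ {0}) := by
  have hrank : 1 < Module.rank ℝ (EuclideanSpace ℝ (Fin p)) := by
    rw [← Module.finrank_eq_rank, finrank_euclideanSpace_fin]
    exact_mod_cast hp
  have h1 : IsPreconnected ((Ioo 0 δ) ×ˢ (sphere (0 : EuclideanSpace ℝ (Fin p)) 1)) :=
    isPreconnected_Ioo.prod (isPreconnected_sphere hrank 0 1)
  have h2 := h1.image (fun q : ℝ × EuclideanSpace ℝ (Fin p) => q.1 • q.2) (by fun_prop)
  convert h2 using 1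
  ext z
  simp only [Set.mem_sdiff, mem_ball_zero_iff, mem_singleton_iff, mem_image, mem_prod, mem_Ioo,
    mem_sphere_zero_iff_norm, Prod.exists]
  constructor
  · rintro ⟨h, h0⟩
    exact ⟨‖z‖, ‖z‖⁻¹ • z, ⟨⟨norm_pos_iff.2 h0, h⟩,
      by rw [norm_smul, norm_inv, norm_norm, inv_mul_cancel₀ (norm_ne_zero_iff.2 h0)]⟩,
      smul_inv_smul₀ (norm_ne_zero_iff.2 h0) z⟩
  · rintro ⟨t, u, ⟨⟨h0, h1⟩, hu⟩, rfl⟩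
    have hn : ‖t • u‖ = t := by rw [norm_smul, hu, mul_one, Real.norm_of_nonneg h0.le]
    exact ⟨by rwa [hn], norm_pos_iff.1 (by rwa [hn])⟩

variable {m p : ℕ} {Ψ : EuclideanSpace ℝ (Fin m) → EuclideanSpace ℝ (Fin p)} {a b δ T R : ℝ}
  {A : EuclideanSpace ℝ (Fin m) → ℝ × EuclideanSpace ℝ (Fin p) →L[ℝ] EuclideanSpace ℝ (Fin m)}
  {σ : EuclideanSpace ℝ (Fin m) → ℝ × EuclideanSpace ℝ (Fin p) →L[ℝ] ℝ}

/-- The part of the sphere of radius `R` where `Ψ` is small. -/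
def tubeAt (Ψ : EuclideanSpace ℝ (Fin m) → EuclideanSpace ℝ (Fin p)) (δ R : ℝ) :
    Set (EuclideanSpace ℝ (Fin m)) := sphere 0 R ∩ {x | ‖Ψ x‖ < δ}

theorem mem_tubeAt_diff_link {x : EuclideanSpace ℝ (Fin m)} :
    x ∈ tubeAt Ψ δ R \ link Ψ R ↔ ‖x‖ = R ∧ ‖Ψ x‖ < δ ∧ Ψ x ≠ 0 := by
  simp only [tubeAt, link, zeroLocus, Set.mem_sdiff, mem_inter_iff, mem_sphere_zero_iff_norm,
    mem_ofPred_eq]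
  tauto

theorem mem_sphere_diff_link {x : EuclideanSpace ℝ (Fin m)} :
    x ∈ sphere 0 R \ link Ψ R ↔ ‖x‖ = R ∧ Ψ x ≠ 0 := by
  simp only [link, zeroLocus, Set.mem_sdiff, mem_inter_iff, mem_sphere_zero_iff_norm, mem_ofPred_eq]
  tauto

/-- Over a round ball in the punctured ball, values of `Ψ` are joined by segments, which stay in
that ball and avoid 0; this gives the trivialisations. It also shows that the image and its
complement in the base are open, so a nonempty tube maps onto the connected base. -/
theorem LiftData.isSmoothFibration_tube (D : LiftData Ψ a b δ T A σ) (hp : 2 ≤ p)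
    (hR : a < R ∧ R < b) (hne : (tubeAt Ψ δ R \ link Ψ R).Nonempty) :
    IsSmoothFibration Ψ (tubeAt Ψ δ R \ link Ψ R) (ball 0 δ \ {0}) := by
  set S := tubeAt Ψ δ R \ link Ψ R
  set B := ball (0 : EuclideanSpace ℝ (Fin p)) δ \ {0}
  have hB : IsOpen B := isOpen_ball.sdiff isClosed_singleton
  have hmaps : MapsTo Ψ S B := fun x hx => by
    have := mem_tubeAt_diff_link.1 hx
    exact ⟨mem_ball_zero_iff.2 this.2.1, this.2.2⟩
  have hmove : ∀ c : EuclideanSpace ℝ (Fin p), ∀ r, ball c r ⊆ B → ∀ x ∈ S, Ψ x ∈ ball c r →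
      ∀ u ∈ ball c r, ∃ y ∈ S, Ψ y = u ∧ Reaches A (puncturedShell Ψ a b) (0, u - Ψ x) x y := by
    intro c r hc x hx hxc u hu
    have hx' := mem_tubeAt_diff_link.1 hx
    obtain ⟨y, hy, hyR, hyu⟩ := D.exists_reaches_near (x := x) (by rwa [hx'.1]) hR
      (v := u - Ψ x) (fun t ht => by
        have : Ψ x + t • (u - Ψ x) ∈ B :=
          hc ((convex_ball c r).add_smul_sub_mem hxc hu ht)
        exact ⟨this.2, mem_ball_zero_iff.1 this.1⟩)
    rw [add_sub_cancel] at hyu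
    refine ⟨y, mem_tubeAt_diff_link.2 ⟨hyR, ?_⟩, hyu, ?_⟩
    · rw [hyu]
      exact ⟨mem_ball_zero_iff.1 (hc hu).1, (hc hu).2⟩
    · rwa [hx'.1, sub_self, zero_div] at hy
  refine ⟨D.smooth_map.contDiffOn, hmaps, ?_, ?_⟩
  · have hop : ∀ c ∈ B, ∃ r > 0, ball c r ⊆ B := Metric.isOpen_iff.1 hB
    have ho1 : IsOpen (Ψ '' S) := by
      rw [Metric.isOpen_iff]
      rintro _ ⟨x, hx, rfl⟩
      obtain ⟨r, hr, hrB⟩ := hop _ (hmaps hx)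
      refine ⟨r, hr, fun u hu => ?_⟩
      obtain ⟨y, hy, hyu, -⟩ := hmove _ r hrB x hx (mem_ball_self hr) u hu
      exact ⟨y, hy, hyu⟩
    have ho2 : IsOpen (B \ Ψ '' S) := by
      rw [Metric.isOpen_iff]
      rintro c ⟨hc, hcS⟩
      obtain ⟨r, hr, hrB⟩ := hop _ hc
      refine ⟨r, hr, fun u hu => ⟨hrB hu, ?_⟩⟩
      rintro ⟨x, hx, rfl⟩
      obtain ⟨y, hy, hyu, -⟩ := hmove _ r hrB x hx hu c (mem_ball_self hr)
      exact hcS ⟨y, hy, hyu⟩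
    intro c hc
    by_contra hcS
    obtain ⟨x, hx⟩ := hne
    obtain ⟨z, -, hz1, hz2⟩ := isPreconnected_ball_diff_zero hp δ _ _ ho1 ho2
      (fun u hu => by
        by_cases h : u ∈ Ψ '' S
        exacts [Or.inl h, Or.inr ⟨hu, h⟩]) ⟨Ψ x, hmaps hx, x, hx, rfl⟩ ⟨c, hc, hc, hcS⟩
    exact hz2.2 hz1
  · intro c hc
    obtain ⟨r, hr, hrB⟩ := Metric.isOpen_iff.1 hB c hc
    refine ⟨ball c r, isOpen_ball, mem_ball_self hr, _, _, isDiffeo_of_reaches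
      (isOpen_puncturedShell D.smooth_map.continuous) D.smooth
      (l := fun u => ((0 : ℝ), u - c)) (fun x _ => D.smooth_map.contDiffAt)
      (fun u _ => by fun_prop) hmaps ?_ ?_⟩
    · intro x hx hxU
      obtain ⟨y, hy, hyc, hr⟩ := hmove c r hrB x hx hxU c (mem_ball_self hr)
      refine ⟨y, hy, hyc, ?_⟩
      rwa [Prod.neg_mk, neg_zero, neg_sub]
    · intro u hu y hy hyc
      obtain ⟨x, hx, hxu, hr⟩ := hmove c r hrB y hy (by rw [hyc]; exact mem_ball_self hr) u hu.2
      rw [hyc] at hr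
      exact ⟨x, hx, hxu, hr⟩

theorem LiftData.isBindingTube (D : LiftData Ψ a b δ T A σ) (hp : 2 ≤ p)
    (hR : a < R ∧ R < b) (hne : (tubeAt Ψ δ R \ link Ψ R).Nonempty) :
    IsBindingTube (sphere 0 R) (link Ψ R) (normalized Ψ) (tubeAt Ψ δ R) δ Ψ where
  nhd := ⟨{x | ‖Ψ x‖ < δ}, isOpen_lt D.smooth_map.continuous.norm continuous_const,
    fun x hx => by
      have : Ψ x = 0 := hx.1
      rw [mem_ofPred_eq, this, norm_zero]
      exact D.radius_pos, rfl⟩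
  radius_pos := D.radius_pos
  fibration := D.isSmoothFibration_tube hp hR hne
  radial := fun _ _ => rfl

theorem norm_smul_normalized {x : EuclideanSpace ℝ (Fin m)} (hx : Ψ x ≠ 0) :
    ‖Ψ x‖ • normalized Ψ x = Ψ x := by
  rw [normalized, smul_inv_smul₀ (norm_ne_zero_iff.2 hx)]

/-- Central projection is injective on an open half sphere. -/
theorem normalized_eq_of_smul_eq {x : EuclideanSpace ℝ (Fin m)} {e u : EuclideanSpace ℝ (Fin p)}
    (hx : 0 < inner ℝ e (Ψ x)) (hu : 0 < inner ℝ e u) (hu1 : ‖u‖ = 1)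
    (h : (inner ℝ e (Ψ x) : ℝ)⁻¹ • Ψ x = (inner ℝ e u : ℝ)⁻¹ • u) : normalized Ψ x = u := by
  have h1 : Ψ x = ((inner ℝ e (Ψ x) : ℝ) * (inner ℝ e u : ℝ)⁻¹) • u := by
    rw [mul_smul, ← h, smul_inv_smul₀ hx.ne']
  have hpos : 0 < (inner ℝ e (Ψ x) : ℝ) * (inner ℝ e u : ℝ)⁻¹ := by positivity
  set c := (inner ℝ e (Ψ x) : ℝ) * (inner ℝ e u : ℝ)⁻¹
  rw [normalized, h1, norm_smul, hu1, mul_one, Real.norm_of_nonneg hpos.le,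
    inv_smul_smul₀ hpos.ne']

/-- Surjectivity is inherited from the tube, which already meets every direction. The trivialising
set around `e` is the half sphere `0 < ⟪e, u⟫`, where the parameter `u / ⟪e, u⟫ - e` is the
displacement from `e` after central projection. -/
theorem LiftData.isSmoothFibration_page (D : LiftData Ψ a b δ T A σ) (hp : 2 ≤ p)
    (hR : a < R ∧ R < b) (hne : (tubeAt Ψ δ R \ link Ψ R).Nonempty) :
    IsSmoothFibration (normalized Ψ) (sphere 0 R \ link Ψ R) (sphere 0 1) := by
  set S := sphere (0 : EuclideanSpace ℝ (Fin m)) R \ link Ψ R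
  have hsm : ∀ x, Ψ x ≠ 0 → ContDiffAt ℝ ∞ (normalized Ψ) x := fun x hx =>
    ((D.smooth_map.contDiffAt.norm ℝ hx).inv (norm_ne_zero_iff.2 hx)).smul
      D.smooth_map.contDiffAt
  have hmem : ∀ x ∈ S, x ∈ puncturedShell Ψ a b := fun x hx => by
    have := mem_sphere_diff_link.1 hx
    exact ⟨by rw [this.1]; exact hR.1, by rw [this.1]; exact hR.2, this.2⟩
  have hmaps : MapsTo (normalized Ψ) S (sphere 0 1) := fun x hx =>
    mem_sphere_zero_iff_norm.2 (norm_normalized (mem_sphere_diff_link.1 hx).2)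
  refine ⟨fun x hx => (hsm x (mem_sphere_diff_link.1 hx).2).contDiffWithinAt, hmaps, ?_, ?_⟩
  · intro u hu
    have hu1 : ‖u‖ = 1 := mem_sphere_zero_iff_norm.1 hu
    have hδ := D.radius_pos
    have hn : ‖(δ / 2) • u‖ = δ / 2 := by
      rw [norm_smul, hu1, mul_one, Real.norm_of_nonneg (by positivity)]
    obtain ⟨x, hx, hxu⟩ := (D.isSmoothFibration_tube hp hR hne).surjOn
      (⟨by rw [mem_ball_zero_iff, hn]; linarith, norm_pos_iff.1 (by rw [hn]; positivity)⟩ :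
        (δ / 2) • u ∈ ball (0 : EuclideanSpace ℝ (Fin p)) δ \ {0})
    have hx' := mem_tubeAt_diff_link.1 hx
    refine ⟨x, mem_sphere_diff_link.2 ⟨hx'.1, hx'.2.2⟩, ?_⟩
    rw [normalized, hxu, hn, inv_smul_smul₀ (by positivity)]
  · intro e he
    have he1 : ‖e‖ = 1 := mem_sphere_zero_iff_norm.1 he
    have hee : (inner ℝ e e : ℝ) = 1 := by rw [real_inner_self_eq_norm_sq, he1, one_pow]
    have hin : ∀ x, Ψ x ≠ 0 →
        (inner ℝ e (Ψ x) : ℝ) = ‖Ψ x‖ * inner ℝ e (normalized Ψ x) := fun x hx => by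
      rw [← inner_smul_right, norm_smul_normalized hx]
    have hpos : ∀ x, Ψ x ≠ 0 → 0 < inner ℝ e (normalized Ψ x) →
        0 < inner ℝ e (Ψ x) := fun x hx h => by
      rw [hin x hx]; exact mul_pos (norm_pos_iff.2 hx) h
    have hsmul : ∀ x, Ψ x ≠ 0 → (inner ℝ e (Ψ x) : ℝ)⁻¹ • Ψ x =
        (inner ℝ e (normalized Ψ x) : ℝ)⁻¹ • normalized Ψ x := fun x hx => by
      rw [hin x hx, mul_inv, mul_comm, mul_smul]
      rfl
    have horth : ∀ u : EuclideanSpace ℝ (Fin p), 0 < inner ℝ e u →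
        inner ℝ e ((inner ℝ e u : ℝ)⁻¹ • u - e) = 0 := fun u hu => by
      rw [inner_sub_right, inner_smul_right, hee, inv_mul_cancel₀ hu.ne', sub_self]
    refine ⟨{u | 0 < inner ℝ e u}, isOpen_lt continuous_const (by fun_prop),
      by rw [mem_ofPred_eq, hee]; exact one_pos, _, _, isDiffeo_of_reaches
      (isOpen_puncturedShell D.smooth_map.continuous) (D.contDiffOn_pageField e)
      (l := fun u => (inner ℝ e u : ℝ)⁻¹ • u - e)
      (fun x hx => hsm x (mem_sphere_diff_link.1 hx).2) (fun u hu => ?_) hmaps ?_ ?_⟩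
    · have h1 : ContDiffAt ℝ ∞ (fun u : EuclideanSpace ℝ (Fin p) => (inner ℝ e u : ℝ)) u :=
        contDiffAt_const.inner ℝ contDiffAt_id
      exact ((h1.inv (ne_of_gt hu.2)).smul contDiffAt_id).sub contDiffAt_const
    · intro x hx hxU
      have hx' := mem_sphere_diff_link.1 hx
      obtain ⟨y, hy, hyR, hypos, hye⟩ := D.exists_reaches_page (hmem x hx) (hpos x hx'.2 hxU)
        (w := -((inner ℝ e (normalized Ψ x) : ℝ)⁻¹ • normalized Ψ x - e))
        (by rw [inner_neg_right, horth _ hxU, neg_zero])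
      rw [hsmul x hx'.2, neg_sub, add_sub_cancel] at hye
      have hy0 : Ψ y ≠ 0 := fun h => by
        rw [h, inner_zero_right] at hypos
        exact lt_irrefl _ hypos
      refine ⟨y, mem_sphere_diff_link.2 ⟨hyR.trans hx'.1, hy0⟩, ?_, hy⟩
      exact normalized_eq_of_smul_eq hypos (by rw [hee]; exact one_pos) he1
        (by rw [hye, hee, inv_one, one_smul])
    · intro u hu y hy hye
      have hy' := mem_sphere_diff_link.1 hy
      obtain ⟨x, hx, hxR, hxpos, hxe⟩ := D.exists_reaches_page (hmem y hy)
        (hpos y hy'.2 (by rw [hye, hee]; exact one_pos))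
        (w := (inner ℝ e u : ℝ)⁻¹ • u - e) (horth u hu.2)
      rw [hsmul y hy'.2, hye, hee, inv_one, one_smul, add_sub_cancel] at hxe
      have hx0 : Ψ x ≠ 0 := fun h => by
        rw [h, inner_zero_right] at hxpos
        exact lt_irrefl _ hxpos
      exact ⟨x, mem_sphere_diff_link.2 ⟨hxR.trans hy'.1, hx0⟩,
        normalized_eq_of_smul_eq hxpos hu.2 (mem_sphere_zero_iff_norm.1 hu.1) hxe, hx⟩

/-- A point of the link is a limit of points off `V`. One that is close enough has small `Ψ`, and is
brought to radius `R` with `Ψ` unchanged. -/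
theorem LiftData.tube_nonempty (D : LiftData Ψ a b δ T A σ) (hR : a < R ∧ R < b)
    (hK : (link Ψ R).Nonempty) (hd : ∀ y, a < ‖y‖ → y ∈ closure {z | Ψ z ≠ 0}) :
    (tubeAt Ψ δ R \ link Ψ R).Nonempty := by
  obtain ⟨y, hy0, hyR⟩ := hK
  rw [mem_sphere_zero_iff_norm] at hyR
  have hy0 : Ψ y = 0 := hy0
  have hc := D.smooth_map.continuous
  obtain ⟨z, ⟨hz1, hz2, hz3⟩, hz⟩ := mem_closure_iff.1 (hd y (by rw [hyR]; exact hR.1))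
    {z | a < ‖z‖ ∧ ‖z‖ < b ∧ ‖Ψ z‖ < δ}
    ((isOpen_lt continuous_const continuous_norm).inter
      ((isOpen_lt continuous_norm continuous_const).inter (isOpen_lt hc.norm continuous_const)))
    ⟨by rw [hyR]; exact hR.1, by rw [hyR]; exact hR.2, by rw [hy0, norm_zero]; exact D.radius_pos⟩
  obtain ⟨x, -, hxR, hx⟩ := D.exists_reaches_near ⟨hz1, hz2⟩ hR (v := 0)
    (fun t _ => by rw [smul_zero, add_zero]; exact ⟨hz, hz3⟩)
  rw [add_zero] at hx
  exact ⟨x, mem_tubeAt_diff_link.2 ⟨hxR, by rw [hx]; exact ⟨hz3, hz⟩⟩⟩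

/-- The radial flow preserves the direction of `Ψ`, and where `‖Ψ‖ < δ` it preserves `Ψ` itself. It
is thus compatible with the pages and with the tubes `‖Ψ‖ < δ` over one common ball. -/
theorem LiftData.isotopicAlong (D : LiftData Ψ a b δ T A σ) (hp : 2 ≤ p) {R' : ℝ}
    (hR : a < R) (hRR : R ≤ R') (hR' : R' < b)
    (hne : ∀ s ∈ Icc R R', (tubeAt Ψ δ s \ link Ψ s).Nonempty) :
    IsotopicAlong (fun s => sphere 0 s) (link Ψ) (normalized Ψ) R R' := by
  have hΩ := isOpen_puncturedShell (a := a) (b := b) D.smooth_map.continuous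
  have hmem : ∀ s ∈ Icc R R', a < s ∧ s < b := fun s hs =>
    ⟨hR.trans_le hs.1, hs.2.trans_lt hR'⟩
  have hmem' : ∀ s ∈ Icc R R', ∀ x ∈ sphere 0 s \ link Ψ s, x ∈ puncturedShell Ψ a b :=
    fun s hs x hx => by
      have := mem_sphere_diff_link.1 hx
      exact ⟨by rw [this.1]; exact (hmem s hs).1, by rw [this.1]; exact (hmem s hs).2, this.2⟩
  have key : ∀ s ∈ Icc R R', ∀ r ∈ Icc R R', ∀ x ∈ sphere 0 s \ link Ψ s,
      ∃ y ∈ sphere 0 r \ link Ψ r, Reaches A (puncturedShell Ψ a b) ((r ^ 2 - s ^ 2) / 2, 0) x y ∧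
        normalized Ψ y = normalized Ψ x ∧ (‖Ψ x‖ < δ → Ψ y = Ψ x) := by
    intro s hs r hr x hx
    have hx' := mem_sphere_diff_link.1 hx
    obtain ⟨y, hy, hyr, hy0, hyn⟩ := D.exists_reaches_radial (hmem' s hs x hx) (hmem r hr)
    rw [hx'.1] at hy
    refine ⟨y, mem_sphere_diff_link.2 ⟨hyr, hy0⟩, hy, hyn, fun hlt => ?_⟩
    obtain ⟨z, hz, -, hzx⟩ := D.exists_reaches_near (x := x)
      (by rw [hx'.1]; exact hmem s hs) (hmem r hr) (v := 0)
      (fun t _ => by rw [smul_zero, add_zero]; exact ⟨hx'.2, hlt⟩)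
    rw [hx'.1] at hz
    -- Both flows have the same parameter, so their endpoints coincide.
    rw [hy.unique hΩ D.smooth hz, hzx, add_zero]
  have hRm : R ∈ Icc R R' := ⟨le_rfl, hRR⟩
  set Φ : ℝ × EuclideanSpace ℝ (Fin m) → EuclideanSpace ℝ (Fin m) := fun q =>
    timeOne A (puncturedShell Ψ a b) (((q.1 ^ 2 - R ^ 2) / 2, 0), q.2)
  set Φinv : ℝ × EuclideanSpace ℝ (Fin m) → EuclideanSpace ℝ (Fin m) := fun q =>
    timeOne A (puncturedShell Ψ a b) (((R ^ 2 - q.1 ^ 2) / 2, 0), q.2)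
  have hsym : ∀ s r : ℝ, ∀ x y, Reaches A (puncturedShell Ψ a b) ((r ^ 2 - s ^ 2) / 2, 0) x y →
      Reaches A (puncturedShell Ψ a b) ((s ^ 2 - r ^ 2) / 2, 0) y x := by
    intro s r x y h
    have := h.symm
    rwa [Prod.neg_mk, neg_zero, ← neg_div, neg_sub] at this
  have htube : ∀ s ∈ Icc R R', ∀ r ∈ Icc R R', ∀ x ∈ tubeAt Ψ δ s \ link Ψ s,
      ∃ y ∈ tubeAt Ψ δ r \ link Ψ r,
        Reaches A (puncturedShell Ψ a b) ((r ^ 2 - s ^ 2) / 2, 0) x y ∧ Ψ y = Ψ x := by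
    intro s hs r hr x hx
    have hx' := mem_tubeAt_diff_link.1 hx
    obtain ⟨y, hy, hreach, -, hyx⟩ := key s hs r hr x (mem_sphere_diff_link.2 ⟨hx'.1, hx'.2.2⟩)
    have hyx := hyx hx'.2.1
    exact ⟨y, mem_tubeAt_diff_link.2 ⟨(mem_sphere_diff_link.1 hy).1, by rw [hyx]; exact hx'.2⟩,
      hreach, hyx⟩
  refine ⟨Φ, Φinv, fun s => tubeAt Ψ δ s, δ, fun _ => Ψ, ?_, ?_, ?_, ?_⟩
  · refine ⟨?_, ?_, ?_, ?_, ?_, ?_⟩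
    · rintro ⟨s, x⟩ ⟨hs, hx⟩
      obtain ⟨y, -, hreach, -⟩ := key R hRm s hs x hx
      have h1 : ContDiffAt ℝ ∞ (fun q : ℝ × EuclideanSpace ℝ (Fin m) =>
          ((((q.1 ^ 2 - R ^ 2) / 2, 0), q.2) :
            (ℝ × EuclideanSpace ℝ (Fin p)) × EuclideanSpace ℝ (Fin m))) (s, x) := by
        fun_prop
      exact (contDiffAt_fst.prodMk
        ((hreach.contDiffAt_timeOne hΩ D.smooth).comp (s, x) h1)).contDiffWithinAt
    · rintro ⟨s, x⟩ ⟨hs, hx⟩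
      obtain ⟨y, -, hreach, -⟩ := key s hs R hRm x hx
      have h1 : ContDiffAt ℝ ∞ (fun q : ℝ × EuclideanSpace ℝ (Fin m) =>
          ((((R ^ 2 - q.1 ^ 2) / 2, 0), q.2) :
            (ℝ × EuclideanSpace ℝ (Fin p)) × EuclideanSpace ℝ (Fin m))) (s, x) := by
        fun_prop
      exact (contDiffAt_fst.prodMk
        ((hreach.contDiffAt_timeOne hΩ D.smooth).comp (s, x) h1)).contDiffWithinAt
    · rintro ⟨s, x⟩ ⟨hs, hx⟩
      obtain ⟨y, hy, hreach, -⟩ := key R hRm s hs x hx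
      refine ⟨hs, ?_⟩
      simp only [Φ, hreach.timeOne_eq hΩ D.smooth]
      exact hy
    · rintro ⟨s, x⟩ ⟨hs, hx⟩
      obtain ⟨y, hy, hreach, -⟩ := key s hs R hRm x hx
      refine ⟨hs, ?_⟩
      simp only [Φinv, hreach.timeOne_eq hΩ D.smooth]
      exact hy
    · rintro ⟨s, x⟩ ⟨hs, hx⟩
      obtain ⟨y, -, hreach, -⟩ := key R hRm s hs x hx
      simp only [Φ, Φinv, hreach.timeOne_eq hΩ D.smooth,
        (hsym _ _ _ _ hreach).timeOne_eq hΩ D.smooth]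
    · rintro ⟨s, x⟩ ⟨hs, hx⟩
      obtain ⟨y, -, hreach, -⟩ := key s hs R hRm x hx
      simp only [Φ, Φinv, hreach.timeOne_eq hΩ D.smooth,
        (hsym _ _ _ _ hreach).timeOne_eq hΩ D.smooth]
  · intro x hx
    obtain ⟨y, -, hreach, -⟩ := key R hRm R hRm x hx
    have h1 := hsym _ _ _ _ hreach
    have h2 : Reaches A (puncturedShell Ψ a b) ((R ^ 2 - R ^ 2) / 2, 0) x x := by
      refine ⟨fun _ => x, fun t _ => ⟨hmem' R hRm x hx, ?_⟩, rfl, rfl⟩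
      rw [sub_self, zero_div, ← Prod.zero_eq_mk]
      simp only [map_zero]
      exact hasDerivWithinAt_const _ _ _
    exact h2.timeOne_eq hΩ D.smooth
  · intro s hs x hx
    obtain ⟨y, -, hreach, hyn, -⟩ := key R hRm s hs x hx
    simp only [Φ, hreach.timeOne_eq hΩ D.smooth]
    exact hyn
  · intro s hs
    refine ⟨D.isBindingTube hp (hmem s hs) (hne s hs), ?_, ?_⟩
    · apply Subset.antisymm
      · rintro _ ⟨x, hx, rfl⟩
        obtain ⟨y, hy, hreach, -⟩ := htube R hRm s hs x hx
        simp only [Φ, hreach.timeOne_eq hΩ D.smooth]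
        exact hy
      · intro y hy
        obtain ⟨x, hx, hreach, -⟩ := htube s hs R hRm y hy
        refine ⟨x, hx, ?_⟩
        simp only [Φ, (hsym _ _ _ _ hreach).timeOne_eq hΩ D.smooth]
    · intro x hx
      obtain ⟨y, -, hreach, hyx⟩ := htube R hRm s hs x hx
      simp only [Φ, hreach.timeOne_eq hΩ D.smooth]
      exact hyx

theorem HasCodim.nonempty {n q : ℕ} {K : Set (EuclideanSpace ℝ (Fin m))} (h : HasCodim n q K) :
    K.Nonempty := by
  obtain ⟨d, -, ⟨U, f, -, ⟨u, hu⟩, -, -, hf⟩, -⟩ := h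
  exact ⟨f u, hf hu⟩

/-- The constants in `LiftData` come from compactness of a shell and may degenerate as its outer
radius grows, so they are chosen anew for each `R` or `[R, R']`. Only the inner radius `a` is
uniform. -/
theorem inducesOpenBookAtInfinity_of_milnorSet_subset (hp : 2 ≤ p) (hpm : p ≤ m - 1)
    (hΨ : ContDiff ℝ ∞ Ψ) (hΨ' : AnalyticOnNhd ℝ Ψ univ) (ha : 0 < a)
    (hM : milnorSet (zeroLocus Ψ)ᶜ (p - 1) (normalized Ψ) ⊆ ball 0 a)
    (hM' : closure (milnorSet univ p Ψ \ zeroLocus Ψ) ∩ zeroLocus Ψ ⊆ ball 0 a)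
    (hK : ∀ R, a < R → HasCodim (m - 1) p (link Ψ R))
    (hd : ∀ y, a < ‖y‖ → y ∈ closure {z | Ψ z ≠ 0}) :
    InducesOpenBookAtInfinity Ψ := by
  have ha1 : a < a + 1 := by linarith
  refine ⟨a + 1, by linarith, fun R hR => ?_, fun R R' hR hRR' => ?_⟩
  · obtain ⟨δ, T, A, σ, D⟩ := exists_liftData (by omega) hΨ ha hM hM' (R + 1)
    have hRm : a < R ∧ R < R + 1 := ⟨by linarith, by linarith⟩
    have hne := D.tube_nonempty hRm (hK R hRm.1).nonempty hd
    exact ⟨hp, hpm, ⟨fun x hx => hx.2, fun x _ => ⟨univ, isOpen_univ, trivial, p, Ψ, hΨ', by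
      ext y
      simp only [link, zeroLocus, inter_univ, mem_inter_iff, mem_ofPred_eq]
      exact and_comm⟩⟩, hK R hRm.1, D.isSmoothFibration_page hp hRm hne,
      tubeAt Ψ δ R, δ, Ψ, D.isBindingTube hp hRm hne⟩
  · obtain ⟨δ, T, A, σ, D⟩ := exists_liftData (by omega) hΨ ha hM hM' (R' + 1)
    refine D.isotopicAlong hp (by linarith) hRR' (by linarith) fun s hs => ?_
    have hs' : a < s := by linarith [hs.1]
    exact D.tube_nonempty ⟨hs', by linarith [hs.2]⟩ (hK s hs').nonempty hd

end OpenBook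

/-! ### Pages of an open book are transverse to the spheres -/

section Transverse

variable {m p : ℕ} {Ψ : EuclideanSpace ℝ (Fin m) → EuclideanSpace ℝ (Fin p)}

theorem finrank_ker_inner_snd {z : EuclideanSpace ℝ (Fin p)} (hz : z ≠ 0) :
    Module.finrank ℝ (LinearMap.ker ((innerSL ℝ z : EuclideanSpace ℝ (Fin p) →ₗ[ℝ] ℝ).comp
      (LinearMap.snd ℝ ℝ (EuclideanSpace ℝ (Fin p))))) = p := by
  set f := (innerSL ℝ z : EuclideanSpace ℝ (Fin p) →ₗ[ℝ] ℝ).comp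
      (LinearMap.snd ℝ ℝ (EuclideanSpace ℝ (Fin p)))
  have hf : f ≠ 0 := by
    intro h
    have := DFunLike.congr_fun h (0, z)
    simp [f] at this
    exact hz this
  have h1 := Module.Dual.finrank_ker_add_one_of_ne_zero (f := f) hf
  have h2 : Module.finrank ℝ (ℝ × EuclideanSpace ℝ (Fin p)) = 1 + p := by simp
  omega

/-- Tangent vectors of the base of a smooth fibration over the unit sphere lift to tangent vectors
of the total space. -/
theorem exists_lift_of_isSmoothFibration {R : ℝ} {K : Set (EuclideanSpace ℝ (Fin m))}
    {θ : EuclideanSpace ℝ (Fin m) → EuclideanSpace ℝ (Fin p)}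
    (hθ : IsSmoothFibration θ (sphere 0 R \ K) (sphere 0 1)) {x : EuclideanSpace ℝ (Fin m)}
    (hx : x ∈ sphere 0 R \ K) (hd : DifferentiableAt ℝ θ x) {v : EuclideanSpace ℝ (Fin p)}
    (hv : inner ℝ (θ x) v = 0) : ∃ w, inner ℝ x w = 0 ∧ fderiv ℝ θ x w = v := by
  have hθ1 : ‖θ x‖ = 1 := mem_sphere_zero_iff_norm.1 (hθ.mapsTo hx)
  obtain ⟨U, hU, hxU, r, g, hg⟩ := hθ.locallyTrivial _ (hθ.mapsTo hx)
  have hrx := (hg.mapsTo ⟨hx, hxU⟩).2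
  have hn : ∀ t : ℝ, ‖θ x + t • v‖ ^ 2 = 1 + t ^ 2 * ‖v‖ ^ 2 := fun t => by
    rw [norm_add_sq_real, inner_smul_right, hv, norm_smul, hθ1, mul_pow, Real.norm_eq_abs, sq_abs]
    ring
  have hne : ∀ t : ℝ, θ x + t • v ≠ 0 := fun t h => by
    have := hn t
    rw [h, norm_zero] at this
    nlinarith [mul_nonneg (sq_nonneg t) (sq_nonneg ‖v‖)]
  set u : ℝ → EuclideanSpace ℝ (Fin p) := fun t => ‖θ x + t • v‖⁻¹ • (θ x + t • v)
  have hu0 : u 0 = θ x := by simp [u, hθ1]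
  have hus : ContDiff ℝ ∞ u := by
    have h1 : ContDiff ℝ ∞ fun t : ℝ => θ x + t • v := by fun_prop
    exact ((h1.norm ℝ hne).inv fun t => norm_ne_zero_iff.2 (hne t)).smul h1
  have hu1 : ∀ t, u t ∈ sphere (0 : EuclideanSpace ℝ (Fin p)) 1 := fun t => by
    rw [mem_sphere_zero_iff_norm, norm_smul, norm_inv, norm_norm,
      inv_mul_cancel₀ (norm_ne_zero_iff.2 (hne t))]
  -- Since `v ⟂ θ x`, the squared norm `1 + t² ‖v‖²` is stationary at 0, and normalising does not
  -- alter the velocity.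
  have hud : HasDerivAt u v 0 := by
    have h1 : HasDerivAt (fun t : ℝ => θ x + t • v) v 0 := by
      simpa using ((hasDerivAt_id (0 : ℝ)).smul_const v).const_add (θ x)
    have h2 : HasDerivAt (fun t : ℝ => ‖θ x + t • v‖ ^ 2) 0 0 := by
      simp only [hn]
      simpa using (((hasDerivAt_id (0 : ℝ)).pow 2).mul_const (‖v‖ ^ 2)).const_add 1
    have h3 : HasDerivAt (fun t : ℝ => ‖θ x + t • v‖) 0 0 := by
      have h4 := h2.sqrt (by simp [hθ1])
      simpa [Real.sqrt_sq (norm_nonneg _)] using h4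
    have h5 := (h3.inv (norm_ne_zero_iff.2 (hne 0))).smul h1
    refine h5.congr_deriv ?_
    simp [hθ1]
  have hev : ∀ᶠ t in 𝓝 (0 : ℝ), u t ∈ U :=
    hus.continuous.continuousAt.eventually (hU.mem_nhds (by rw [hu0]; exact hxU))
  set W : Set ℝ := u ⁻¹' U
  have hW : W ∈ 𝓝 (0 : ℝ) := hev
  have hmaps : MapsTo (fun t => (u t, r x)) W
      ((sphere 0 1 ∩ U) ×ˢ ((sphere 0 R \ K) ∩ θ ⁻¹' {θ x})) :=
    fun t ht => ⟨⟨hu1 t, ht⟩, hrx⟩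
  -- The curve `u` in the base is lifted with constant fibre coordinate; the velocity of the lift is
  -- the required `w`.
  set y : ℝ → EuclideanSpace ℝ (Fin m) := fun t => g (u t, r x)
  have hy : DifferentiableAt ℝ y 0 := by
    have h1 : ContDiffOn ℝ ∞ y W :=
      hg.smooth_inv.comp (f := fun t => (u t, r x)) (hus.contDiffOn.prodMk contDiffOn_const) hmaps
    exact (h1.contDiffAt hW).differentiableAt (by simp)
  have hy0 : y 0 = x := by
    have := hg.leftInv (⟨hx, hxU⟩ : x ∈ (sphere 0 R \ K) ∩ θ ⁻¹' U)
    simpa only [y, hu0] using this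
  have hyW : ∀ t ∈ W, θ (y t) = u t ∧ ‖y t‖ = R := fun t ht => by
    have h1 := hg.rightInv (hmaps ht)
    have h2 := hg.mapsTo_inv (hmaps ht)
    exact ⟨congrArg Prod.fst h1, mem_sphere_zero_iff_norm.1 h2.1.1⟩
  refine ⟨deriv y 0, ?_, ?_⟩
  · have h1 := hy.hasDerivAt.norm_sq
    have h2 : HasDerivAt (fun t => ‖y t‖ ^ 2) 0 0 :=
      (hasDerivAt_const (0 : ℝ) (R ^ 2)).congr_of_eventuallyEq (by
        filter_upwards [hW] with t ht
        rw [(hyW t ht).2])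
    have h3 := h1.unique h2
    rw [hy0] at h3
    linarith
  · have hd' : HasFDerivAt θ (fderiv ℝ θ x) (y 0) := by rw [hy0]; exact hd.hasFDerivAt
    have h1 := hd'.comp_hasDerivAt 0 hy.hasDerivAt
    have h2 : HasDerivAt (θ ∘ y) v 0 := hud.congr_of_eventuallyEq (by
      filter_upwards [hW] with t ht
      exact (hyW t ht).1)
    exact h1.unique h2

/-- Lifts tangent to the sphere fill `0 × (Ψ x)ᗮ`, and the vector `x` itself moves the radius. So
the range contains `ℝ × (Ψ x)ᗮ`, of dimension `p`. -/
theorem milnorSet_subset_of_isSmoothFibration (hp : 1 ≤ p) (hΨ : ContDiff ℝ ∞ Ψ) {R₀ : ℝ}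
    (hR₀ : 0 < R₀) (h : ∀ R, R₀ ≤ R →
      IsSmoothFibration (normalized Ψ) (sphere 0 R \ link Ψ R) (sphere 0 1)) :
    milnorSet (zeroLocus Ψ)ᶜ (p - 1) (normalized Ψ) ⊆ ball 0 R₀ := by
  rintro x ⟨hxV, hx⟩
  have hx0 : Ψ x ≠ 0 := hxV
  rw [mem_ball_zero_iff]
  by_contra! hxR
  have hd := hΨ.differentiable (by simp) x
  have hdn := (hasFDerivAt_normalized hd hx0).1
  have hxx : (inner ℝ x x : ℝ) ≠ 0 := by
    rw [real_inner_self_eq_norm_sq]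
    have : 0 < ‖x‖ := hR₀.trans_le hxR
    positivity
  have hlift : ∀ v, inner ℝ (Ψ x) v = 0 →
      ∃ w, inner ℝ x w = 0 ∧ fderiv ℝ (normalized Ψ) x w = v := fun v hv =>
    exists_lift_of_isSmoothFibration (h ‖x‖ hxR) (mem_sphere_diff_link.2 ⟨rfl, hx0⟩) hdn
      (by rw [normalized, inner_smul_left, hv, mul_zero])
  refine absurd hx (not_lt.2 ?_)
  have hle := Submodule.finrank_mono (R := ℝ) (M := ℝ × EuclideanSpace ℝ (Fin p))
    (s := LinearMap.ker ((innerSL ℝ (Ψ x) : EuclideanSpace ℝ (Fin p) →ₗ[ℝ] ℝ).comp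
      (LinearMap.snd ℝ ℝ (EuclideanSpace ℝ (Fin p)))))
    (t := LinearMap.range (((innerSL ℝ x).prod (fderiv ℝ (normalized Ψ) x) :
        EuclideanSpace ℝ (Fin m) →L[ℝ] ℝ × EuclideanSpace ℝ (Fin p)) :
        EuclideanSpace ℝ (Fin m) →ₗ[ℝ] ℝ × EuclideanSpace ℝ (Fin p))) (by
      rintro ⟨c, v⟩ hv
      have hv : inner ℝ (Ψ x) v = 0 := hv
      set k := c / inner ℝ x x
      obtain ⟨w, hw1, hw2⟩ := hlift (v - k • fderiv ℝ (normalized Ψ) x x) (by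
        rw [inner_sub_right, hv, inner_smul_right, inner_fderiv_normalized hd hx0, mul_zero,
          sub_zero])
      refine ⟨w + k • x, Prod.ext ?_ ?_⟩
      · change inner ℝ x (w + k • x) = c
        rw [inner_add_right, hw1, inner_smul_right, zero_add, div_mul_cancel₀ _ hxx]
      · change fderiv ℝ (normalized Ψ) x (w + k • x) = v
        rw [map_add, hw2, map_smul, sub_add_cancel])
  rw [finrank_ker_inner_snd hx0] at hle
  omega

end Transverse

/-! ### Germs of analytic functions -/

/-- The ring of germs at `u₀` of real analytic functions. -/
def analyticGerm {E : Type*} [NormedAddCommGroup E] [NormedSpace ℝ E] (u₀ : E) :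
    Subring (Germ (𝓝 u₀) ℝ) where
  carrier := {γ | ∃ f : E → ℝ, AnalyticAt ℝ f u₀ ∧ γ = (f : Germ (𝓝 u₀) ℝ)}
  mul_mem' := by
    rintro _ _ ⟨f, hf, rfl⟩ ⟨g, hg, rfl⟩
    exact ⟨f * g, hf.mul hg, rfl⟩
  add_mem' := by
    rintro _ _ ⟨f, hf, rfl⟩ ⟨g, hg, rfl⟩
    exact ⟨f + g, hf.add hg, rfl⟩
  neg_mem' := by
    rintro _ ⟨f, hf, rfl⟩
    exact ⟨-f, hf.neg, rfl⟩
  one_mem' := ⟨1, analyticAt_const, rfl⟩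
  zero_mem' := ⟨0, analyticAt_const, rfl⟩

namespace analyticGerm

variable {E : Type*} [NormedAddCommGroup E] [NormedSpace ℝ E] {u₀ : E}

/-- The value of a germ. -/
def value (u₀ : E) : analyticGerm u₀ →+* ℝ := Germ.valueRingHom.comp (analyticGerm u₀).subtype

/-- The germ of an analytic function. -/
def mk (f : E → ℝ) (hf : AnalyticAt ℝ f u₀) : analyticGerm u₀ := ⟨(f : Germ (𝓝 u₀) ℝ), f, hf, rfl⟩

/-- A function with a given germ. -/
def rep (γ : analyticGerm u₀) : E → ℝ := γ.2.choose

theorem analyticAt_rep (γ : analyticGerm u₀) : AnalyticAt ℝ (rep γ) u₀ := γ.2.choose_spec.1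

theorem coe_rep (γ : analyticGerm u₀) : ((rep γ : E → ℝ) : Germ (𝓝 u₀) ℝ) = γ :=
  γ.2.choose_spec.2.symm

theorem mk_rep (γ : analyticGerm u₀) : mk (rep γ) (analyticAt_rep γ) = γ :=
  Subtype.ext (coe_rep γ)

theorem rep_apply (γ : analyticGerm u₀) : rep γ u₀ = value u₀ γ := by
  conv_rhs => rw [← mk_rep γ]
  rfl

theorem eq_zero_of_mul_eq_zero {a b : analyticGerm u₀} (ha : value u₀ a ≠ 0) (h : a * b = 0) :
    b = 0 := by
  rw [← rep_apply] at ha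
  have h1 : rep a * rep b =ᶠ[𝓝 u₀] 0 := by
    rw [← mk_rep a, ← mk_rep b] at h
    exact Germ.coe_eq.1 (congrArg Subtype.val h)
  rw [← mk_rep b]
  refine Subtype.ext (Germ.coe_eq.2 ?_)
  filter_upwards [h1, (analyticAt_rep a).continuousAt.eventually_ne ha] with u hu hu'
  exact (mul_eq_zero.1 hu).resolve_left hu'

/-- The germ of a polynomial function. -/
def ofMvPolynomial {κ : Type*} [Fintype κ] (u₀ : κ → ℝ) :
    MvPolynomial κ ℝ →+* analyticGerm u₀ where
  toFun a := mk (fun u => MvPolynomial.eval u a) (AnalyticOnNhd.eval_mvPolynomial a u₀ (mem_univ _))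
  map_one' := Subtype.ext (congrArg Germ.ofFun (funext fun _ => map_one _))
  map_zero' := Subtype.ext (congrArg Germ.ofFun (funext fun _ => map_zero _))
  map_mul' a b := Subtype.ext (congrArg Germ.ofFun (funext fun _ => map_mul _ a b))
  map_add' a b := Subtype.ext (congrArg Germ.ofFun (funext fun _ => map_add _ a b))

/-- A simple root of the reduction of a polynomial over the ring of analytic germs lifts to a
root. -/
theorem exists_root [CompleteSpace E] (h : Polynomial (analyticGerm u₀)) (y₀ : ℝ)
    (h0 : h.eval₂ (value u₀) y₀ = 0) (h1 : h.derivative.eval₂ (value u₀) y₀ ≠ 0) :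
    ∃ y : analyticGerm u₀, value u₀ y = y₀ ∧ h.eval y = 0 := by
  -- Representatives of the coefficients turn `h` into an analytic function of base point and
  -- unknown; the implicit function theorem in class `C^ω` solves it.
  set f : E × ℝ → ℝ := fun p =>
    ∑ i ∈ Finset.range (h.natDegree + 1), rep (h.coeff i) p.1 * p.2 ^ i with hf
  have hfan : AnalyticAt ℝ f (u₀, y₀) := by
    refine Finset.analyticAt_fun_sum _ fun i _ => ?_
    exact ((analyticAt_rep (h.coeff i)).comp_of_eq analyticAt_fst rfl).mul (analyticAt_snd.pow i)
  have hcd : ContDiffAt ℝ ω f (u₀, y₀) := hfan.contDiffAt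
  have hf0 : f (u₀, y₀) = 0 := by
    rw [Polynomial.eval₂_eq_sum_range] at h0
    simpa only [hf, rep_apply] using h0
  have hder : HasDerivAt (fun y => f (u₀, y)) (h.derivative.eval₂ (value u₀) y₀) y₀ := by
    have e : (fun y => f (u₀, y)) = fun y => (h.map (value u₀)).eval y := by
      funext y
      rw [Polynomial.eval_map, Polynomial.eval₂_eq_sum_range]
      simp only [hf, rep_apply]
    rw [e, ← Polynomial.eval_map, ← Polynomial.derivative_map]
    exact Polynomial.hasDerivAt _ _
  have hL : ∀ s : ℝ, (fderiv ℝ f (u₀, y₀) ∘L .inr ℝ E ℝ) s =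
      s * h.derivative.eval₂ (value u₀) y₀ := by
    intro s
    have h2 : HasFDerivAt (fun y : ℝ => f (u₀, y)) (fderiv ℝ f (u₀, y₀) ∘L .inr ℝ E ℝ) y₀ :=
      HasFDerivAt.comp (g := f) y₀ (hfan.differentiableAt.hasFDerivAt) (hasFDerivAt_prodMk_right u₀ y₀)
    rw [h2.unique hder.hasFDerivAt]
    simp
  have hinv : (fderiv ℝ f (u₀, y₀) ∘L .inr ℝ E ℝ).IsInvertible := by
    refine ⟨ContinuousLinearEquiv.unitsEquivAut ℝ (Units.mk0 _ h1), ?_⟩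
    ext
    rw [hL]
    simp
  set σ := hcd.implicitFunction (by simp) hinv
  have hσ : AnalyticAt ℝ σ u₀ := by
    have h2 := hcd.contDiffAt_implicitFunction (by simp) hinv
    rw [← contDiffWithinAt_univ, contDiffWithinAt_omega_iff_analyticWithinAt,
      analyticWithinAt_univ] at h2
    exact h2
  refine ⟨mk σ hσ, hcd.implicitFunction_apply_self (by simp) hinv, ?_⟩
  have h3 : h.eval (mk σ hσ) = ∑ i ∈ Finset.range (h.natDegree + 1),
      mk (rep (h.coeff i)) (analyticAt_rep _) * mk σ hσ ^ i := by
    rw [Polynomial.eval_eq_sum_range]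
    simp only [mk_rep]
  rw [h3]
  have h4 : (fun u => f (u, σ u)) =ᶠ[𝓝 u₀] 0 := by
    filter_upwards [hcd.eventually_apply_implicitFunction (by simp) hinv] with u hu
    rw [hu, hf0]; rfl
  refine Subtype.ext ?_
  rw [show ((0 : analyticGerm u₀) : Germ (𝓝 u₀) ℝ) = ((0 : E → ℝ) : Germ (𝓝 u₀) ℝ) from rfl,
    ← Germ.coe_eq.2 h4]
  push_cast
  have h5 : (fun u => f (u, σ u)) =
      ∑ i ∈ Finset.range (h.natDegree + 1), rep (h.coeff i) * σ ^ i := by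
    funext u; simp [hf]
  rw [h5, ← Germ.coe_coeRingHom, map_sum]
  rfl

end analyticGerm

/-! ### Analytic sections of generically finite projections -/

section Sections

variable {κ B : Type*} [CommRing B] [Algebra (MvPolynomial κ ℝ) B]

/-- The image under a ring homomorphism of the coordinate functions. -/
def basePoint (v : B →+* ℝ) : κ → ℝ := fun k => v (algebraMap (MvPolynomial κ ℝ) B (.X k))

theorem apply_algebraMap_eq_eval (v : B →+* ℝ) (a : MvPolynomial κ ℝ) :
    v (algebraMap _ B a) = MvPolynomial.eval (basePoint v) a := by
  have : v.comp (algebraMap (MvPolynomial κ ℝ) B) = MvPolynomial.eval (basePoint v) := by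
    refine MvPolynomial.ringHom_ext (fun r => ?_) fun k => ?_
    · have := RingHom.congr_fun (Subsingleton.elim
        ((v.comp (algebraMap (MvPolynomial κ ℝ) B)).comp MvPolynomial.C) (RingHom.id ℝ)) r
      rw [MvPolynomial.eval_C]
      exact this
    · simp [basePoint]
  exact RingHom.congr_fun this a

variable [Fintype κ]

/-- The restriction of `v` to `C` extends to a family of evaluations of the elements of `C`
parametrized analytically by the base. -/
def ExtendsToGerms (C : Subalgebra (MvPolynomial κ ℝ) B) (v : B →+* ℝ) : Prop :=
  ∃ F : C →+* analyticGerm (basePoint (κ := κ) v),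
    (∀ c, analyticGerm.value _ (F c) = v c) ∧
    ∀ a, F (algebraMap _ C a) = analyticGerm.ofMvPolynomial _ a

theorem ExtendsToGerms.bot (hinj : Function.Injective (algebraMap (MvPolynomial κ ℝ) B))
    (v : B →+* ℝ) : ExtendsToGerms (⊥ : Subalgebra (MvPolynomial κ ℝ) B) v := by
  let e := Algebra.botEquivOfInjective hinj
  have he : ∀ a, e (algebraMap _ _ a) = a := fun a => e.commutes a
  refine ⟨(analyticGerm.ofMvPolynomial _).comp (e : _ →+* MvPolynomial κ ℝ), fun c => ?_, fun a => ?_⟩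
  · obtain ⟨a, rfl⟩ : ∃ a, algebraMap (MvPolynomial κ ℝ) (⊥ : Subalgebra (MvPolynomial κ ℝ) B) a = c :=
      ⟨e c, e.injective (he _)⟩
    change analyticGerm.value _ (analyticGerm.ofMvPolynomial _ (e (algebraMap _ _ a))) = _
    rw [he]
    exact (apply_algebraMap_eq_eval v a).symm
  · simp [he]

/-- `v x` is a simple root of the reduction of `g`, which lifts to an analytic root `y`; then `x` is
sent to `y`. For this to be well defined, `y` must satisfy every relation of `x`, which follows by
pseudo-division by `g`, a relation of least degree. -/
theorem ExtendsToGerms.adjoin [IsDomain B] {C : Subalgebra (MvPolynomial κ ℝ) B} {x : B}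
    {g : Polynomial C} (hg : g ≠ 0) (hgx : Polynomial.aeval x g = 0)
    (hmin : ∀ f : Polynomial C, f ≠ 0 → Polynomial.aeval x f = 0 → g.natDegree ≤ f.natDegree)
    {v : B →+* ℝ} (hl : v (g.leadingCoeff : B) ≠ 0)
    (hd : v (Polynomial.aeval x g.derivative) ≠ 0) (hC : ExtendsToGerms C v) :
    ExtendsToGerms ((Algebra.adjoin C {x}).restrictScalars (MvPolynomial κ ℝ)) v := by
  obtain ⟨F, hFv, hFa⟩ := hC
  have hval : (analyticGerm.value _).comp F = v.comp (algebraMap C B) := RingHom.ext hFv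
  have hval' : ∀ f : Polynomial C, (f.map F).eval₂ (analyticGerm.value _) (v x) =
      v (Polynomial.aeval x f) := by
    intro f
    rw [Polynomial.eval₂_map, hval, Polynomial.aeval_def, Polynomial.hom_eval₂]
  obtain ⟨y, hyv, hy⟩ := analyticGerm.exists_root (g.map F) (v x) (by rw [hval', hgx, map_zero])
    (by rw [Polynomial.derivative_map, hval']; exact hd)
  rw [Polynomial.eval_map] at hy
  have key : ∀ n, ∀ f : Polynomial C, f.natDegree ≤ n → Polynomial.aeval x f = 0 →
      f.eval₂ F y = 0 := by
    intro n
    induction n using Nat.strong_induction_on with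
    | _ n ih =>
    intro f hfn hfx
    by_cases hf : f = 0
    · simp [hf]
    have hle := hmin f hf hfx
    have hlc : g.leadingCoeff ≠ 0 := Polynomial.leadingCoeff_ne_zero.2 hg
    have hlf : f.leadingCoeff ≠ 0 := Polynomial.leadingCoeff_ne_zero.2 hf
    set r := Polynomial.C g.leadingCoeff * f -
      Polynomial.C f.leadingCoeff * Polynomial.X ^ (f.natDegree - g.natDegree) * g with hr
    have hrx : Polynomial.aeval x r = 0 := by simp [hr, hfx, hgx]
    have hr0 : r.eval₂ F y = 0 := by
      by_cases hr' : r = 0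
      · simp [hr']
      have hlt : r.natDegree < f.natDegree := by
        have h1 : (Polynomial.C g.leadingCoeff * f).degree = f.degree := by
          rw [Polynomial.degree_C_mul hlc]
        have h2 : r.degree < (Polynomial.C g.leadingCoeff * f).degree := by
          refine Polynomial.degree_sub_lt_left ?_ (by simp [hlc, hf]) ?_
          · rw [h1, Polynomial.degree_mul, Polynomial.degree_C_mul_X_pow _ hlf,
              Polynomial.degree_eq_natDegree hf, Polynomial.degree_eq_natDegree hg]
            norm_cast; omega
          · simp [mul_comm f.leadingCoeff]
        rw [h1] at h2
        exact Polynomial.natDegree_lt_natDegree hr' h2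
      exact ih r.natDegree (hlt.trans_le hfn) r le_rfl hrx
    rw [hr] at hr0
    simp only [Polynomial.eval₂_sub, Polynomial.eval₂_mul, Polynomial.eval₂_C, hy, mul_zero,
      sub_zero] at hr0
    -- The leading coefficient of `g` does not vanish at `v`, so its germ can be cancelled.
    exact analyticGerm.eq_zero_of_mul_eq_zero (by rw [hFv]; exact hl) hr0
  have hsurj : ∀ c : (Algebra.adjoin C {x}).restrictScalars (MvPolynomial κ ℝ),
      ∃ f : Polynomial C, Polynomial.aeval x f = (c : B) := by
    rintro ⟨c, hc⟩
    rw [Subalgebra.mem_restrictScalars, Algebra.adjoin_singleton_eq_range_aeval] at hc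
    exact hc
  choose! f hf using hsurj
  have hwd : ∀ a b : Polynomial C, Polynomial.aeval x a = Polynomial.aeval x b →
      a.eval₂ F y = b.eval₂ F y := by
    intro a b hab
    rw [← sub_eq_zero, ← Polynomial.eval₂_sub]
    exact key _ _ le_rfl (by simp [hab])
  refine ⟨{ toFun := fun c => (f c).eval₂ F y, map_one' := ?_, map_mul' := fun a b => ?_,
            map_zero' := ?_, map_add' := fun a b => ?_ }, fun c => ?_, fun a => ?_⟩
  · rw [hwd (f 1) 1 (by rw [hf]; simp)]; simp
  · rw [hwd (f (a * b)) (f a * f b) (by rw [hf, map_mul, hf, hf]; rfl), Polynomial.eval₂_mul]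
  · rw [hwd (f 0) 0 (by rw [hf]; simp)]; simp
  · rw [hwd (f (a + b)) (f a + f b) (by rw [hf, map_add, hf, hf]; rfl), Polynomial.eval₂_add]
  · change analyticGerm.value _ ((f c).eval₂ F y) = _
    rw [Polynomial.hom_eval₂, hval, hyv, ← hf c, Polynomial.aeval_def, Polynomial.hom_eval₂]
  · change (f _).eval₂ F y = _
    rw [hwd _ (Polynomial.C (algebraMap _ C a)) (by rw [hf, Polynomial.aeval_C]; rfl),
      Polynomial.eval₂_C, hFa]

/-- The elements of `S` are adjoined one at a time. The polynomial `s` excludes the points where a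
leading coefficient or the derivative of a least-degree relation vanishes. -/
theorem exists_extendsToGerms [IsDomain B] [Algebra.IsAlgebraic (MvPolynomial κ ℝ) B] [CharZero B]
    (hinj : Function.Injective (algebraMap (MvPolynomial κ ℝ) B)) (S : Finset B) :
    ∃ s : MvPolynomial κ ℝ, s ≠ 0 ∧ ∀ v : B →+* ℝ, v (algebraMap _ B s) ≠ 0 →
      ExtendsToGerms (Algebra.adjoin (MvPolynomial κ ℝ) (S : Set B)) v := by
  classical
  induction S using Finset.induction_on with
  | empty =>
    refine ⟨1, one_ne_zero, fun v _ => ?_⟩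
    rw [Finset.coe_empty, Algebra.adjoin_empty]
    exact .bot hinj v
  | insert x S _ ih =>
    obtain ⟨s, hs, hS⟩ := ih
    set C := Algebra.adjoin (MvPolynomial κ ℝ) (S : Set B) with hC
    have hinjC : Function.Injective (algebraMap (MvPolynomial κ ℝ) C) := fun a b hab =>
      hinj (congrArg (algebraMap C B) hab)
    have hex : ∃ n, ∃ g : Polynomial C, g ≠ 0 ∧ Polynomial.aeval x g = 0 ∧ g.natDegree = n := by
      obtain ⟨g, hg, hgx⟩ := (Algebra.IsAlgebraic.isAlgebraic (R := MvPolynomial κ ℝ) x).extendScalars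
        (S := C) hinjC
      exact ⟨_, g, hg, hgx, rfl⟩
    obtain ⟨g, hg, hgx, hgn⟩ := Nat.find_spec hex
    have hmin : ∀ f : Polynomial C, f ≠ 0 → Polynomial.aeval x f = 0 →
        g.natDegree ≤ f.natDegree := fun f hf hfx =>
      hgn.le.trans (Nat.find_min' hex ⟨f, hf, hfx, rfl⟩)
    have hpos : 0 < g.natDegree := by
      rw [Nat.pos_iff_ne_zero]
      intro h0
      rw [Polynomial.eq_C_of_natDegree_eq_zero h0, Polynomial.aeval_C] at hgx
      refine hg ?_
      rw [Polynomial.eq_C_of_natDegree_eq_zero h0, Subtype.ext (a1 := g.coeff 0) (a2 := 0) hgx,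
        Polynomial.C_0]
    have hd : Polynomial.aeval x g.derivative ≠ 0 := by
      intro h0
      have h1 : g.derivative ≠ 0 := fun h => hpos.ne' (Polynomial.derivative_eq_zero.1 h)
      exact absurd (hmin _ h1 h0) (not_le.2 (Polynomial.natDegree_derivative_lt hpos.ne'))
    have hl : (g.leadingCoeff : B) ≠ 0 := by
      simpa using Polynomial.leadingCoeff_ne_zero.2 hg
    -- A nonzero element of a domain algebraic over the polynomial ring divides the image of some
    -- nonzero polynomial `a`; where `a` does not vanish, neither do its factors.
    obtain ⟨a, ha, hdvd⟩ := (Algebra.IsAlgebraic.isAlgebraic (R := MvPolynomial κ ℝ)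
      ((g.leadingCoeff : B) * Polynomial.aeval x g.derivative)).exists_nonzero_dvd
      (mem_nonZeroDivisors_of_ne_zero (mul_ne_zero hl hd))
    refine ⟨s * a, mul_ne_zero hs ha, fun v hv => ?_⟩
    rw [map_mul, map_mul, mul_ne_zero_iff] at hv
    obtain ⟨b, hb⟩ := hdvd
    rw [hb, map_mul, map_mul, mul_ne_zero_iff, mul_ne_zero_iff] at hv
    have := (hS v hv.1).adjoin hg hgx hmin hv.2.1.1 hv.2.1.2
    rw [Finset.coe_insert, Set.insert_eq, Set.union_comm, Algebra.adjoin_union_eq_adjoin_adjoin]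
    exact this

end Sections

/-! ### Analytic sections of polynomial maps on real algebraic sets. -/

/-- The map between affine spaces whose components are the polynomials `φ`. -/
def evalMap {ι κ : Type*} (φ : κ → MvPolynomial ι ℝ) (x : ι → ℝ) : κ → ℝ :=
  fun k => MvPolynomial.eval x (φ k)

theorem eval_evalMap {ι κ : Type*} (φ : κ → MvPolynomial ι ℝ) (x : ι → ℝ) (q : MvPolynomial κ ℝ) :
    MvPolynomial.eval (evalMap φ x) q = MvPolynomial.eval x (MvPolynomial.aeval φ q) := by
  rw [← MvPolynomial.coe_aeval_eq_eval, ← MvPolynomial.coe_aeval_eq_eval]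
  exact (MvPolynomial.comp_aeval_apply φ (MvPolynomial.aeval x) q).symm

/-- Near `v ∈ Z` the map `evalMap φ : Z → ℝ^κ` has an analytic section through `v`. -/
def HasLocalSection {ι κ : Type*} [Fintype ι] [Fintype κ] (Z : Set (ι → ℝ))
    (φ : κ → MvPolynomial ι ℝ) (v : ι → ℝ) : Prop :=
  ∃ σ : (κ → ℝ) → ι → ℝ, AnalyticAt ℝ σ (evalMap φ v) ∧ σ (evalMap φ v) = v ∧
    ∀ᶠ u in 𝓝 (evalMap φ v), σ u ∈ Z ∧ evalMap φ (σ u) = u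

theorem mem_zeroLocus {ι : Type*} {I : Ideal (MvPolynomial ι ℝ)} {x : ι → ℝ} :
    x ∈ MvPolynomial.zeroLocus ℝ I ↔ ∀ f ∈ I, MvPolynomial.eval x f = 0 := by
  simp [MvPolynomial.mem_zeroLocus_iff, MvPolynomial.aeval_eq_eval]

theorem isClosed_zeroLocus {ι : Type*} (I : Ideal (MvPolynomial ι ℝ)) :
    IsClosed (MvPolynomial.zeroLocus ℝ I : Set (ι → ℝ)) := by
  have : (MvPolynomial.zeroLocus ℝ I : Set (ι → ℝ)) = ⋂ f ∈ I, {x | MvPolynomial.eval x f = 0} := by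
    ext x; simp
  rw [this]
  exact isClosed_biInter fun f _ => isClosed_eq (MvPolynomial.continuous_eval f) continuous_const

/-- A finite system of generators controls the zero locus. -/
theorem exists_finset_generators {ι : Type*} [Finite ι] (I : Ideal (MvPolynomial ι ℝ)) :
    ∃ S : Finset (MvPolynomial ι ℝ), (∀ f ∈ S, f ∈ I) ∧
      ∀ x : ι → ℝ, (∀ f ∈ S, MvPolynomial.eval x f = 0) → x ∈ MvPolynomial.zeroLocus ℝ I := by
  obtain ⟨S, hS⟩ := (isNoetherianRing_iff_ideal_fg _).1 inferInstance I
  refine ⟨S, fun f hf => hS ▸ Ideal.subset_span hf, fun x hx => ?_⟩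
  rw [mem_zeroLocus, ← hS]
  intro f hf
  have : Ideal.span (S : Set (MvPolynomial ι ℝ)) ≤ RingHom.ker (MvPolynomial.eval x) :=
    Ideal.span_le.2 hx
  exact this hf

/-- Roots of a polynomial whose coefficients are polynomial functions are locally bounded where the
leading coefficient does not vanish. -/
theorem exists_root_bound {κ : Type*} (g : Polynomial (MvPolynomial κ ℝ)) (c : κ → ℝ)
    (hc : MvPolynomial.eval c g.leadingCoeff ≠ 0) :
    ∃ M : ℝ, ∀ᶠ u in 𝓝 c, ∀ y : ℝ, (g.map (MvPolynomial.eval u)).eval y = 0 → |y| ≤ M := by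
  set L : (κ → ℝ) → ℝ := fun u => ∑ i ∈ Finset.range g.natDegree,
    |MvPolynomial.eval u (g.coeff i)| / |MvPolynomial.eval u g.leadingCoeff| + 1 with hL
  have hlc : ContinuousAt (fun u => MvPolynomial.eval u g.leadingCoeff) c :=
    (MvPolynomial.continuous_eval _).continuousAt
  have hcont : ContinuousAt L c := by
    refine ContinuousAt.add (tendsto_finsetSum _ fun i _ => ?_) continuousAt_const
    exact ContinuousAt.div ((MvPolynomial.continuous_eval _).continuousAt.abs) hlc.abs
      (abs_ne_zero.2 hc)
  refine ⟨L c + 1, ?_⟩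
  filter_upwards [hcont.eventually (gt_mem_nhds (lt_add_one (L c))), hlc.eventually_ne hc]
    with u hu hu' y hy
  refine le_trans ?_ hu.le
  have hne : g.map (MvPolynomial.eval u) ≠ 0 := by
    intro h0
    have := congrArg (fun p => p.coeff g.natDegree) h0
    simp only [Polynomial.coeff_map, Polynomial.coeff_zero] at this
    exact hu' this
  have h1 := Polynomial.IsRoot.norm_lt_cauchyBound hne (a := y) hy
  have h2 : ((g.map (MvPolynomial.eval u)).cauchyBound : ℝ) ≤ L u := by
    rw [Polynomial.cauchyBound, Polynomial.natDegree_map_of_leadingCoeff_ne_zero _ hu',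
      Polynomial.leadingCoeff_map_of_leadingCoeff_ne_zero _ hu', hL]
    push_cast
    rw [← Finset.sum_div]
    gcongr
    · have : (Finset.range g.natDegree).sup (fun i => ‖(g.map (MvPolynomial.eval u)).coeff i‖₊) ≤
          ∑ i ∈ Finset.range g.natDegree, ‖(g.map (MvPolynomial.eval u)).coeff i‖₊ :=
        Finset.sup_le fun i hi => Finset.single_le_sum (f := fun i =>
          ‖(g.map (MvPolynomial.eval u)).coeff i‖₊) (fun _ _ => zero_le) hi
      have := NNReal.coe_le_coe.2 this
      push_cast at this
      simpa using this
    · simp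
  have h3 : |y| < ((g.map (MvPolynomial.eval u)).cauchyBound : ℝ) := by
    have := NNReal.coe_lt_coe.2 h1
    simpa using this
  exact h3.le.trans h2

section Basis

variable {ι κ : Type*} [Fintype ι] {I : Ideal (MvPolynomial ι ℝ)}
  {φ : κ → MvPolynomial ι ℝ}

theorem isAlgebraic_of_isTranscendenceBasis {κ B : Type*} [CommRing B] [Algebra ℝ B] {x : κ → B}
    (h : IsTranscendenceBasis ℝ x) [Algebra (MvPolynomial κ ℝ) B]
    (hx : algebraMap (MvPolynomial κ ℝ) B = (MvPolynomial.aeval x : _ →ₐ[ℝ] B)) :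
    Algebra.IsAlgebraic (MvPolynomial κ ℝ) B := by
  have := h.isAlgebraic
  refine Algebra.IsAlgebraic.of_ringHom_of_comp_eq (S := Algebra.adjoin ℝ (range x)) (B := B)
    h.1.aevalEquiv (RingHom.id B) h.1.aevalEquiv.surjective (fun _ _ h => h) ?_
  rw [hx]
  ext <;> simp

/-- Each coordinate is a root of a polynomial over the transcendence basis, so Cauchy's root bound
holds locally uniformly off the zeros of the leading coefficients. This is properness of the
projection there. -/
theorem exists_locally_bounded_of_isTranscendenceBasis [I.IsPrime]
    (h : IsTranscendenceBasis ℝ fun k => Ideal.Quotient.mk I (φ k)) :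
    ∃ q : MvPolynomial κ ℝ, q ≠ 0 ∧ ∀ c, MvPolynomial.eval c q ≠ 0 → ∃ M : ℝ, ∀ᶠ u in 𝓝 c,
      ∀ v ∈ MvPolynomial.zeroLocus ℝ I, evalMap φ v = u → ‖v‖ ≤ M := by
  classical
  set B := MvPolynomial ι ℝ ⧸ I
  set x : κ → B := fun k => Ideal.Quotient.mk I (φ k)
  let _ : Algebra (MvPolynomial κ ℝ) B :=
    ((MvPolynomial.aeval x : MvPolynomial κ ℝ →ₐ[ℝ] B) : MvPolynomial κ ℝ →+* B).toAlgebra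
  have halg : algebraMap (MvPolynomial κ ℝ) B = (MvPolynomial.aeval x : _ →ₐ[ℝ] B) := rfl
  have := isAlgebraic_of_isTranscendenceBasis h halg
  have hex : ∀ i : ι, ∃ g : Polynomial (MvPolynomial κ ℝ), g ≠ 0 ∧
      Polynomial.aeval (Ideal.Quotient.mk I (.X i) : B) g = 0 :=
    fun i => Algebra.IsAlgebraic.isAlgebraic _
  choose g hg hgx using hex
  refine ⟨∏ i, (g i).leadingCoeff,
    Finset.prod_ne_zero_iff.2 fun i _ => Polynomial.leadingCoeff_ne_zero.2 (hg i), fun c hc => ?_⟩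
  rw [map_prod, Finset.prod_ne_zero_iff] at hc
  choose M hM using fun i => exists_root_bound (g i) c (hc i (Finset.mem_univ i))
  refine ⟨∑ i, |M i|, ?_⟩
  filter_upwards [Filter.eventually_all.2 hM] with u hu v hv hvu
  refine (pi_norm_le_iff_of_nonneg (Finset.sum_nonneg fun i _ => abs_nonneg _)).2 fun i => ?_
  refine le_trans ?_ (Finset.single_le_sum (fun i _ => abs_nonneg (M i)) (Finset.mem_univ i))
  refine le_trans (hu i (v i) ?_) (le_abs_self _)
  let w : B →+* ℝ := Ideal.Quotient.lift I (MvPolynomial.eval v) (mem_zeroLocus.1 hv)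
  have hw : ∀ f, w (Ideal.Quotient.mk I f) = MvPolynomial.eval v f := fun f => rfl
  have hbase : w.comp (algebraMap (MvPolynomial κ ℝ) B) = MvPolynomial.eval u := by
    refine RingHom.ext fun a => ?_
    rw [RingHom.comp_apply, apply_algebraMap_eq_eval, ← hvu]
    congr 2
    funext k
    simp [basePoint, halg, x, hw, evalMap]
  have := congrArg w (hgx i)
  rw [map_zero, Polynomial.aeval_def, Polynomial.hom_eval₂, hbase, hw, MvPolynomial.eval_X] at this
  rw [Polynomial.eval_map, this]

variable [Fintype κ]

/-- The germs assigned to the coordinate functions by `exists_extendsToGerms` are the components of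
`σ`. As they come from a ring homomorphism killing `I`, `σ` takes values in the zero locus; as it
fixes the base ring, `σ` is a section. -/
theorem exists_hasLocalSection_of_isTranscendenceBasis [I.IsPrime]
    (h : IsTranscendenceBasis ℝ fun k => Ideal.Quotient.mk I (φ k)) :
    ∃ q : MvPolynomial κ ℝ, q ≠ 0 ∧ ∀ v ∈ MvPolynomial.zeroLocus ℝ I,
      MvPolynomial.eval (evalMap φ v) q ≠ 0 →
        HasLocalSection (MvPolynomial.zeroLocus ℝ I) φ v := by
  classical
  set B := MvPolynomial ι ℝ ⧸ I
  set x : κ → B := fun k => Ideal.Quotient.mk I (φ k)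
  let _ : Algebra (MvPolynomial κ ℝ) B :=
    ((MvPolynomial.aeval x : MvPolynomial κ ℝ →ₐ[ℝ] B) : MvPolynomial κ ℝ →+* B).toAlgebra
  have halg : algebraMap (MvPolynomial κ ℝ) B = (MvPolynomial.aeval x : _ →ₐ[ℝ] B) := rfl
  have hinj : Function.Injective (algebraMap (MvPolynomial κ ℝ) B) := h.1
  have := isAlgebraic_of_isTranscendenceBasis h halg
  have : CharZero B := algebraRat.charZero B
  obtain ⟨q, hq, hS⟩ := exists_extendsToGerms hinj
    (Finset.univ.image fun i => Ideal.Quotient.mk I (.X i))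
  refine ⟨q, hq, fun v hv hqv => ?_⟩
  let w : B →+* ℝ := Ideal.Quotient.lift I (MvPolynomial.eval v) (mem_zeroLocus.1 hv)
  have hw : ∀ f, w (Ideal.Quotient.mk I f) = MvPolynomial.eval v f := fun f => rfl
  have hbase : basePoint (κ := κ) w = evalMap φ v := by
    funext k
    simp [basePoint, halg, x, hw, evalMap]
  set C := Algebra.adjoin (MvPolynomial κ ℝ)
    ((Finset.univ.image fun i => Ideal.Quotient.mk I (.X i) : Finset B) : Set B)
  obtain ⟨F, hFv, hFa⟩ := hS w (by rw [apply_algebraMap_eq_eval, hbase]; exact hqv)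
  have hC : ∀ f, Ideal.Quotient.mk I f ∈ C := by
    intro f
    induction f using MvPolynomial.induction_on with
    | C a =>
      have : Ideal.Quotient.mk I (MvPolynomial.C a) = algebraMap (MvPolynomial κ ℝ) B (.C a) := by
        rw [halg]; simp; rfl
      rw [this]
      exact C.algebraMap_mem _
    | add f g hf hg => rw [map_add]; exact add_mem hf hg
    | mul_X f i hf =>
      rw [map_mul]
      exact mul_mem hf (Algebra.subset_adjoin (by simp))
  let G : MvPolynomial ι ℝ →+* analyticGerm (basePoint (κ := κ) w) :=
    F.comp ((Ideal.Quotient.mk I).codRestrict C hC)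
  have hG : ∀ f a, Ideal.Quotient.mk I f = algebraMap (MvPolynomial κ ℝ) B a →
      G f = analyticGerm.ofMvPolynomial _ a := by
    intro f a hfa
    rw [← hFa]
    exact congrArg F (Subtype.ext (a1 := (⟨Ideal.Quotient.mk I f, hC f⟩ : C))
      (a2 := algebraMap _ C a) hfa)
  let σ : (κ → ℝ) → ι → ℝ := fun u i => analyticGerm.rep (G (.X i)) u
  have hσ : ∀ f, ((G f : analyticGerm _) : Germ (𝓝 (basePoint (κ := κ) w)) ℝ) =
      ((fun u => MvPolynomial.eval (σ u) f : (κ → ℝ) → ℝ) : Germ _ ℝ) := by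
    intro f
    induction f using MvPolynomial.induction_on with
    | C a =>
      rw [hG (.C a) (.C a) (by rw [halg]; simp; rfl)]
      exact congrArg Germ.ofFun (funext fun u => by simp)
    | add f g hf hg =>
      rw [map_add, Subring.coe_add, hf, hg, ← Germ.coe_add]
      exact congrArg Germ.ofFun (funext fun u => by simp)
    | mul_X f i hf =>
      rw [map_mul, Subring.coe_mul, hf, ← analyticGerm.coe_rep (G (.X i)), ← Germ.coe_mul]
      exact congrArg Germ.ofFun (funext fun u => by simp [σ])
  rw [HasLocalSection, ← hbase]
  refine ⟨σ, analyticAt_pi_iff.2 fun i => analyticGerm.analyticAt_rep _, ?_, ?_⟩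
  · funext i
    change analyticGerm.rep (G (.X i)) _ = _
    rw [analyticGerm.rep_apply]
    exact (hFv ⟨Ideal.Quotient.mk I (.X i), hC _⟩).trans ((hw (.X i)).trans (MvPolynomial.eval_X i))
  -- Finitely many generators suffice, so the identities of germs hold on a common neighbourhood.
  · obtain ⟨T, hTI, hT⟩ := exists_finset_generators I
    have h1 : ∀ᶠ u in 𝓝 (basePoint (κ := κ) w), ∀ f ∈ T, MvPolynomial.eval (σ u) f = 0 := by
      rw [Filter.eventually_all_finset]
      intro f hf
      have h0 : G f = 0 := by
        rw [hG f 0 (by rw [map_zero]; exact Ideal.Quotient.eq_zero_iff_mem.2 (hTI f hf)), map_zero]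
      have := hσ f
      rw [h0] at this
      exact (Germ.coe_eq.1 this).symm
    have h2 : ∀ᶠ u in 𝓝 (basePoint (κ := κ) w), ∀ k, MvPolynomial.eval (σ u) (φ k) = u k := by
      rw [Filter.eventually_all]
      intro k
      have := hσ (φ k)
      rw [hG (φ k) (.X k) (by rw [halg]; simp [x])] at this
      filter_upwards [Germ.coe_eq.1 this] with u hu
      rw [← hu, MvPolynomial.eval_X]
    filter_upwards [h1, h2] with u hu1 hu2
    exact ⟨hT _ hu1, funext hu2⟩

theorem exists_isTranscendenceBasis_sumElim {κ B : Type*} [Finite κ] [CommRing B] [IsDomain B]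
    [Algebra ℝ B] [Algebra.FiniteType ℝ B] {x : κ → B} (hx : AlgebraicIndependent ℝ x) :
    ∃ (n : ℕ) (y : Fin n → B), IsTranscendenceBasis ℝ (Sum.elim x y) := by
  obtain ⟨t, hxt, ht⟩ := exists_isTranscendenceBasis_superset
    ((algebraicIndependent_subtype_range hx.injective).2 hx)
  have hfin : Finite t := by
    have := ht.cardinalMk_eq_trdeg
    rw [← Cardinal.lt_aleph0_iff_finite, this]
    exact trdeg_lt_aleph0_of_finiteType
  have : Finite (t \ range x : Set B) := Set.Finite.sdiff (s := t) hfin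
  obtain ⟨n, ⟨e⟩⟩ := Finite.exists_equiv_fin (t \ range x : Set B)
  refine ⟨n, fun i => e.symm i, ?_⟩
  have hinj : Function.Injective (Sum.elim x fun i => ((e.symm i : (t \ range x : Set B)) : B)) := by
    refine hx.injective.sumElim (Subtype.val_injective.comp e.symm.injective) ?_
    intro a b hab
    exact (e.symm b).2.2 ⟨a, hab⟩
  have hrange : range (Sum.elim x fun i => ((e.symm i : (t \ range x : Set B)) : B)) = t := by
    rw [Set.Sum.elim_range]
    have : range (fun i => ((e.symm i : (t \ range x : Set B)) : B)) = t \ range x := by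
      rw [show (fun i => ((e.symm i : (t \ range x : Set B)) : B)) = Subtype.val ∘ e.symm from rfl,
        Set.range_comp, e.symm.surjective.range_eq, Set.image_univ, Subtype.range_coe]
    rw [this, Set.union_sdiff_cancel hxt]
  rw [← isTranscendenceBasis_subtype_range hinj, hrange]
  exact ht

/-- Algebraically independent functions on an irreducible algebraic set have analytic sections
off a proper algebraic subset. -/
theorem exists_hasLocalSection [I.IsPrime]
    (h : AlgebraicIndependent ℝ fun k => Ideal.Quotient.mk I (φ k)) :
    ∃ b : MvPolynomial ι ℝ, b ∉ I ∧ ∀ v ∈ MvPolynomial.zeroLocus ℝ I,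
      MvPolynomial.eval v b ≠ 0 → HasLocalSection (MvPolynomial.zeroLocus ℝ I) φ v := by
  obtain ⟨n, y, hy⟩ := exists_isTranscendenceBasis_sumElim h
  choose ψ hψ using fun i => Ideal.Quotient.mk_surjective (y i)
  have hφψ : (fun k => Ideal.Quotient.mk I (Sum.elim φ ψ k)) =
      Sum.elim (fun k => Ideal.Quotient.mk I (φ k)) y := by
    funext k; rcases k with k | k <;> simp [hψ]
  obtain ⟨q, hq, hS⟩ := exists_hasLocalSection_of_isTranscendenceBasis (φ := Sum.elim φ ψ)
    (I := I) (by rw [hφψ]; exact hy)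
  refine ⟨MvPolynomial.aeval (Sum.elim φ ψ) q, ?_, fun v hv hb => ?_⟩
  · intro hmem
    refine hq (hy.1 ?_)
    rw [map_zero, ← hφψ, ← Ideal.Quotient.eq_zero_iff_mem.2 hmem]
    exact (MvPolynomial.comp_aeval_apply (Sum.elim φ ψ) (Ideal.Quotient.mkₐ ℝ I) q).symm
  · rw [← eval_evalMap] at hb
    obtain ⟨σ, hσ, hσv, hσu⟩ := hS v hv hb
    have hbase : evalMap (Sum.elim φ ψ) v = Sum.elim (evalMap φ v) (evalMap ψ v) := by
      funext k; rcases k with k | k <;> rfl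
    -- The functions added to complete a transcendence basis are frozen at their values at `v`.
    set j : (κ → ℝ) → (κ ⊕ Fin n → ℝ) := fun u => Sum.elim u (evalMap ψ v) with hj
    have hjan : AnalyticAt ℝ j (evalMap φ v) := by
      rw [analyticAt_pi_iff]
      rintro (k | k)
      · exact (ContinuousLinearMap.proj (R := ℝ) (φ := fun _ : κ => ℝ) k).analyticAt _
      · exact analyticAt_const
    rw [hbase] at hσ hσv hσu
    refine ⟨σ ∘ j, AnalyticAt.comp (g := σ) (f := j) hσ hjan, hσv, ?_⟩
    filter_upwards [hjan.continuousAt.eventually hσu] with u hu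
    refine ⟨hu.1, funext fun k => ?_⟩
    exact congrFun hu.2 (Sum.inl k)

end Basis

/-! ### Independence of polynomial functions along a filter -/

section Independence

variable {ι κ : Type*}

/-- No polynomial relation between the functions `φ` holds on `Z` eventually along `F`. -/
def IndepAlong (F : Filter (ι → ℝ)) (Z : Set (ι → ℝ)) (φ : κ → MvPolynomial ι ℝ) : Prop :=
  ∀ Q : MvPolynomial κ ℝ, Q ≠ 0 → ∃ᶠ v in F, v ∈ Z ∧ MvPolynomial.eval (evalMap φ v) Q ≠ 0

/-- The polynomials which vanish on `Z` eventually along `F`. -/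
def eventuallyVanishingIdeal (F : Filter (ι → ℝ)) (Z : Set (ι → ℝ)) :
    Ideal (MvPolynomial ι ℝ) where
  carrier := {f | ∀ᶠ v in F, v ∈ Z → MvPolynomial.eval v f = 0}
  add_mem' {f g} hf hg := by
    filter_upwards [hf, hg] with v h1 h2 hv
    rw [map_add, h1 hv, h2 hv, add_zero]
  zero_mem' := Eventually.of_forall fun v _ => map_zero _
  smul_mem' c f hf := by
    filter_upwards [hf] with v h1 hv
    rw [smul_eq_mul, map_mul, h1 hv, mul_zero]

variable {F : Filter (ι → ℝ)} {Z : Set (ι → ℝ)}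

theorem mem_eventuallyVanishingIdeal {f : MvPolynomial ι ℝ} :
    f ∈ eventuallyVanishingIdeal F Z ↔ ∀ᶠ v in F, v ∈ Z → MvPolynomial.eval v f = 0 := Iff.rfl

theorem eventually_mem_zeroLocus_eventuallyVanishingIdeal [Finite ι] :
    ∀ᶠ v in F, v ∈ Z → v ∈ MvPolynomial.zeroLocus ℝ (eventuallyVanishingIdeal F Z) := by
  obtain ⟨S, hSI, hS⟩ := exists_finset_generators (eventuallyVanishingIdeal F Z)
  have := (Filter.eventually_all_finset S).2 fun f hf => mem_eventuallyVanishingIdeal.1 (hSI f hf)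
  filter_upwards [this] with v hv hvZ
  exact hS v fun f hf => hv f hf hvZ

theorem mem_zeroLocus_sup_span {I : Ideal (MvPolynomial ι ℝ)} {f : MvPolynomial ι ℝ} {v : ι → ℝ} :
    v ∈ MvPolynomial.zeroLocus ℝ (I ⊔ Ideal.span {f}) ↔
      v ∈ MvPolynomial.zeroLocus ℝ I ∧ MvPolynomial.eval v f = 0 := by
  have h : ∀ K : Ideal (MvPolynomial ι ℝ), v ∈ MvPolynomial.zeroLocus ℝ K ↔
      K ≤ RingHom.ker (MvPolynomial.eval v) := fun K => mem_zeroLocus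
  rw [h, h, sup_le_iff, Ideal.span_singleton_le_iff_mem, RingHom.mem_ker]

theorem lt_sup_span {I : Ideal (MvPolynomial ι ℝ)} {f : MvPolynomial ι ℝ} (hf : f ∉ I) :
    I < I ⊔ Ideal.span {f} :=
  lt_of_le_of_ne le_sup_left fun h =>
    hf (h ▸ Ideal.mem_sup_right (Ideal.mem_span_singleton_self f))

theorem exists_not_mem_of_not_isPrime {I : Ideal (MvPolynomial ι ℝ)} (hI : ¬ I.IsPrime)
    (htop : I ≠ ⊤) : ∃ f g, f * g ∈ I ∧ f ∉ I ∧ g ∉ I := by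
  by_contra! h
  refine hI ⟨htop, fun {f g} hfg => ?_⟩
  by_cases hf : f ∈ I
  · exact Or.inl hf
  · exact Or.inr (h f g hfg hf)

/-- Functions independent along a filter on an algebraic set are independent on an irreducible
algebraic subset which is dense along the filter. -/
theorem IndepAlong.exists_prime [Finite ι] {φ : κ → MvPolynomial ι ℝ}
    (J : Ideal (MvPolynomial ι ℝ)) (h : IndepAlong F (MvPolynomial.zeroLocus ℝ J) φ) :
    ∃ I : Ideal (MvPolynomial ι ℝ), I.IsPrime ∧ J ≤ I ∧
      (∀ f ∉ I, ∃ᶠ v in F, v ∈ MvPolynomial.zeroLocus ℝ I ∧ MvPolynomial.eval v f ≠ 0) ∧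
      AlgebraicIndependent ℝ fun k => Ideal.Quotient.mk I (φ k) := by
  induction J using WellFoundedGT.induction with
  | _ J ih =>
  set I := eventuallyVanishingIdeal F (MvPolynomial.zeroLocus ℝ J) with hI
  have hJI : J ≤ I := fun f hf => Eventually.of_forall fun v hv => mem_zeroLocus.1 hv f hf
  have hnot : ∀ f ∉ I, ∃ᶠ v in F, v ∈ MvPolynomial.zeroLocus ℝ I ∧ MvPolynomial.eval v f ≠ 0 := by
    intro f hf
    rw [mem_eventuallyVanishingIdeal, Filter.not_eventually] at hf
    refine (hf.and_eventually (eventually_mem_zeroLocus_eventuallyVanishingIdeal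
      (Z := MvPolynomial.zeroLocus ℝ J))).mono ?_
    rintro v ⟨h1, h2⟩
    rw [Classical.not_imp] at h1
    exact ⟨h2 h1.1, h1.2⟩
  have hrel : ∀ Q : MvPolynomial κ ℝ, Q ≠ 0 → MvPolynomial.aeval φ Q ∉ I := by
    intro Q hQ hmem
    refine h Q hQ (hmem.mono fun v hv hv' => hv'.2 ?_)
    rw [eval_evalMap]
    exact hv hv'.1
  by_cases hprime : I.IsPrime
  · refine ⟨I, hprime, hJI, hnot, ?_⟩
    rw [AlgebraicIndependent, injective_iff_map_eq_zero]
    intro Q hQ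
    by_contra hQ0
    refine hrel Q hQ0 (Ideal.Quotient.eq_zero_iff_mem.1 ?_)
    rw [← hQ]
    exact MvPolynomial.comp_aeval_apply φ (Ideal.Quotient.mkₐ ℝ I) Q
  have htop : I ≠ ⊤ := by
    intro htop
    refine hrel 1 one_ne_zero ?_
    rw [htop]; trivial
  obtain ⟨f, g, hfg, hf, hg⟩ := exists_not_mem_of_not_isPrime hprime htop
  have key : ∀ f, f ∉ I → IndepAlong F (MvPolynomial.zeroLocus ℝ (I ⊔ Ideal.span {f})) φ →
      ∃ I' : Ideal (MvPolynomial ι ℝ), I'.IsPrime ∧ J ≤ I' ∧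
      (∀ f ∉ I', ∃ᶠ v in F, v ∈ MvPolynomial.zeroLocus ℝ I' ∧ MvPolynomial.eval v f ≠ 0) ∧
      AlgebraicIndependent ℝ fun k => Ideal.Quotient.mk I' (φ k) := by
    intro f hf hind
    obtain ⟨I', h1, h2, h3⟩ := ih _ (hJI.trans_lt (lt_sup_span hf)) hind
    exact ⟨I', h1, hJI.trans (le_sup_left.trans h2), h3⟩
  -- If `φ` were dependent on both pieces `f = 0` and `g = 0`, the product of the two relations
  -- would hold on the zero locus of `J` eventually along `F`.
  by_contra hcon
  have hf' := mt (key f hf) hcon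
  have hg' := mt (key g hg) hcon
  simp only [IndepAlong] at hf' hg'
  push Not at hf' hg'
  obtain ⟨Q₁, hQ₁, h1⟩ := hf'
  obtain ⟨Q₂, hQ₂, h2⟩ := hg'
  refine h (Q₁ * Q₂) (mul_ne_zero hQ₁ hQ₂) ?_
  filter_upwards [h1, h2, mem_eventuallyVanishingIdeal.1 hfg,
    eventually_mem_zeroLocus_eventuallyVanishingIdeal (F := F) (Z := MvPolynomial.zeroLocus ℝ J)]
    with v h1 h2 h3 h4 hv
  have h5 := h3 hv.1
  rw [map_mul, mul_eq_zero] at h5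
  refine hv.2 ?_
  rw [map_mul]
  rcases h5 with h5 | h5
  · rw [h1 (mem_zeroLocus_sup_span.2 ⟨h4 hv.1, h5⟩), zero_mul]
  · rw [h2 (mem_zeroLocus_sup_span.2 ⟨h4 hv.1, h5⟩), mul_zero]

/-- Functions without polynomial relation on a relatively open subset of an algebraic set have an
analytic section there. -/
theorem IndepAlong.exists_hasLocalSection [Fintype ι] [Fintype κ] {φ : κ → MvPolynomial ι ℝ}
    {J : Ideal (MvPolynomial ι ℝ)} {O : Set (ι → ℝ)}
    (h : IndepAlong (𝓟 O) (MvPolynomial.zeroLocus ℝ J) φ) :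
    ∃ v ∈ O, HasLocalSection (MvPolynomial.zeroLocus ℝ J) φ v := by
  obtain ⟨I, hI, hJI, hdense, hind⟩ := h.exists_prime
  obtain ⟨b, hb, hS⟩ := SingularOpenBook.exists_hasLocalSection hind
  obtain ⟨v, hvO, hvI, hbv⟩ := frequently_principal.1 (hdense b hb)
  obtain ⟨σ, h1, h2, h3⟩ := hS v hvI hbv
  exact ⟨v, hvO, σ, h1, h2, h3.mono fun u hu => ⟨MvPolynomial.zeroLocus_anti_mono hJI hu.1, hu.2⟩⟩

end Independence

/-! ### Values at infinity of a polynomial on an algebraic set -/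

section Values

variable {ι : Type*}

/-- The square of the Euclidean distance to `a`. -/
def sqDist [Fintype ι] (a : ι → ℝ) : MvPolynomial ι ℝ :=
  ∑ i, (MvPolynomial.X i - MvPolynomial.C (a i)) ^ 2

theorem eval_sqDist [Fintype ι] (a v : ι → ℝ) :
    MvPolynomial.eval v (sqDist a) = ∑ i, (v i - a i) ^ 2 := by
  simp [sqDist]

theorem isBounded_sqDist_le [Fintype ι] (a : ι → ℝ) (c : ℝ) :
    Bornology.IsBounded {v : ι → ℝ | MvPolynomial.eval v (sqDist a) ≤ c} := by
  refine (isBounded_closedBall (x := a) (r := √c)).subset fun v hv => ?_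
  rw [mem_ofPred_eq, eval_sqDist] at hv
  rw [mem_closedBall, dist_pi_le_iff (Real.sqrt_nonneg c)]
  intro i
  rw [Real.dist_eq]
  refine Real.abs_le_sqrt (le_trans ?_ hv)
  exact Finset.single_le_sum (f := fun i => (v i - a i) ^ 2) (fun i _ => sq_nonneg _)
    (Finset.mem_univ i)

theorem eventually_eval_ne_zero {r : Polynomial ℝ} (hr : r ≠ 0) : ∀ᶠ T in atTop, r.eval T ≠ 0 := by
  have : {T | r.eval T = 0}.Finite := by
    simpa [Polynomial.IsRoot] using Polynomial.finite_setOfPred_isRoot hr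
  filter_upwards [this.eventually_cofinite_notMem.filter_mono atTop_le_cofinite] with T hT
  exact hT

theorem eventually_eval_unit_ne_zero {q : MvPolynomial Unit ℝ} (hq : q ≠ 0) :
    ∀ᶠ T : ℝ in atTop, MvPolynomial.eval (fun _ => T) q ≠ 0 := by
  have h0 : MvPolynomial.uniqueAlgEquiv ℝ Unit q ≠ 0 := (map_ne_zero_iff _
    (MvPolynomial.uniqueAlgEquiv ℝ Unit).injective).2 hq
  filter_upwards [eventually_eval_ne_zero h0] with T hT
  have : ∀ q : MvPolynomial Unit ℝ, (MvPolynomial.uniqueAlgEquiv ℝ Unit q).eval T =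
      MvPolynomial.eval (fun _ => T) q := by
    intro q
    induction q using MvPolynomial.induction_on with
    | C a => simp
    | add f g hf hg => rw [map_add, map_add, Polynomial.eval_add, hf, hg]
    | mul_X f i hf => rw [map_mul, map_mul, Polynomial.eval_mul, hf]; simp
  rwa [this] at hT

/-- On a level set of `t` in an irreducible algebraic set, the squared distance to `a` can only
be minimal on the exceptional set of the sections of `(t, sqDist a)`. -/
theorem exists_mem_eval_eq_zero [Fintype ι] {I : Ideal (MvPolynomial ι ℝ)} {t b : MvPolynomial ι ℝ}
    {a : ι → ℝ}
    (hS : ∀ v ∈ MvPolynomial.zeroLocus ℝ I, MvPolynomial.eval v b ≠ 0 →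
      HasLocalSection (MvPolynomial.zeroLocus ℝ I)
        (fun o : Option Unit => o.elim (sqDist a) fun _ => t) v)
    {v : ι → ℝ} (hv : v ∈ MvPolynomial.zeroLocus ℝ I) :
    ∃ w ∈ MvPolynomial.zeroLocus ℝ I, MvPolynomial.eval w b = 0 ∧
      MvPolynomial.eval w t = MvPolynomial.eval v t := by
  set s := sqDist a
  set K : Set (ι → ℝ) := (MvPolynomial.zeroLocus ℝ I ∩
    {w | MvPolynomial.eval w t = MvPolynomial.eval v t}) ∩
      {w | MvPolynomial.eval w s ≤ MvPolynomial.eval v s} with hK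
  have hKc : IsCompact K := by
    refine Metric.isCompact_of_isClosed_isBounded (((isClosed_zeroLocus I).inter ?_).inter ?_)
      ((isBounded_sqDist_le a _).subset inter_subset_right)
    · exact isClosed_eq (MvPolynomial.continuous_eval t) continuous_const
    · exact isClosed_le (MvPolynomial.continuous_eval s) continuous_const
  obtain ⟨w, hw, hmin⟩ := hKc.exists_isMinOn ⟨v, ⟨hv, rfl⟩,
    (le_refl _ : MvPolynomial.eval v s ≤ MvPolynomial.eval v s)⟩
    (MvPolynomial.continuous_eval s).continuousOn
  refine ⟨w, hw.1.1, ?_, hw.1.2⟩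
  by_contra hb
  -- At a minimum with `b ≠ 0`, the section lowers the distance by a small `ε` while keeping the
  -- value of `t`, a contradiction.
  obtain ⟨σ, -, -, hσ⟩ := hS w hw.1.1 hb
  set φ : Option Unit → MvPolynomial ι ℝ := fun o => o.elim s fun _ => t
  set u : ℝ → Option Unit → ℝ := fun ε o =>
    o.elim (MvPolynomial.eval w s - ε) fun _ => MvPolynomial.eval w t
  have hu : Continuous u := continuous_pi fun o => by
    cases o
    · exact continuous_const.sub continuous_id
    · exact continuous_const
  have hu0 : u 0 = evalMap φ w := by
    funext o
    cases o
    · exact sub_zero _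
    · rfl
  rw [← hu0] at hσ
  have h1 := (hu.continuousAt (x := 0)).eventually hσ
  obtain ⟨ε, hε, hε0⟩ := ((h1.filter_mono nhdsWithin_le_nhds).and
    (self_mem_nhdsWithin : Ioi (0 : ℝ) ∈ 𝓝[>] 0)).exists
  have hs : MvPolynomial.eval (σ (u ε)) s = MvPolynomial.eval w s - ε := congrFun hε.2 none
  have ht : MvPolynomial.eval (σ (u ε)) t = MvPolynomial.eval w t := congrFun hε.2 (some ())
  have hε0 : 0 < ε := hε0
  have hmem : σ (u ε) ∈ K := by
    refine ⟨⟨hε.1, ht.trans hw.1.2⟩, ?_⟩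
    have := hw.2
    rw [mem_ofPred_eq] at this ⊢
    linarith
  have := hmin hmem
  rw [mem_ofPred_eq] at this
  linarith

/-- Each coordinate is an affine combination of the squared distances to 0 and to a unit vector, so
it is algebraic over `t` once all squared distances are. -/
theorem isTranscendenceBasis_of_forall_sqDist [Fintype ι] {I : Ideal (MvPolynomial ι ℝ)} [I.IsPrime]
    {t : MvPolynomial ι ℝ}
    (ht : AlgebraicIndependent ℝ fun _ : Unit => Ideal.Quotient.mk I t)
    (hs : ∀ a, ¬ AlgebraicIndependent ℝ fun o : Option Unit =>
      Ideal.Quotient.mk I (o.elim (sqDist a) fun _ => t)) :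
    IsTranscendenceBasis ℝ fun _ : Unit => Ideal.Quotient.mk I t := by
  classical
  rw [ht.isTranscendenceBasis_iff_isAlgebraic]
  set R := Algebra.adjoin ℝ (range fun _ : Unit => Ideal.Quotient.mk I t)
  have halg : ∀ a, IsAlgebraic R (Ideal.Quotient.mk I (sqDist a)) := by
    intro a
    by_contra h
    refine hs a ?_
    have : (fun o : Option Unit => Ideal.Quotient.mk I (o.elim (sqDist a) fun _ => t)) =
        fun o : Option Unit => o.elim (Ideal.Quotient.mk I (sqDist a))
          fun _ => Ideal.Quotient.mk I t := by
      funext o; cases o <;> rfl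
    rw [this]
    exact AlgebraicIndependent.option_iff.2 ⟨ht, h⟩
  have hR : ∀ r : ℝ, IsAlgebraic R (Ideal.Quotient.mk I (MvPolynomial.C r)) := fun r =>
    isAlgebraic_algebraMap (algebraMap ℝ R r)
  have hX : ∀ i, IsAlgebraic R (Ideal.Quotient.mk I (.X i)) := by
    intro i
    have e : (MvPolynomial.X i : MvPolynomial ι ℝ) =
        MvPolynomial.C (1 / 2) * (MvPolynomial.C 1 - (sqDist (Pi.single i 1) - sqDist 0)) := by
      have h1 : sqDist (Pi.single i 1) - sqDist 0 =
          (MvPolynomial.C 1 - MvPolynomial.C 2 * MvPolynomial.X i : MvPolynomial ι ℝ) := by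
        rw [sqDist, sqDist, ← Finset.sum_sub_distrib, Finset.sum_eq_single i]
        · simp only [Pi.single_eq_same, Pi.zero_apply, map_zero, map_one,
            show (MvPolynomial.C 2 : MvPolynomial ι ℝ) = 2 from map_ofNat _ 2]
          ring
        · intro j _ hj
          simp [hj]
        · simp
      rw [h1, sub_sub_cancel, ← mul_assoc, ← map_mul]
      norm_num
    rw [e, map_mul, map_sub, map_sub]
    exact (hR _).mul ((hR _).sub ((halg _).sub (halg _)))
  refine ⟨fun x => ?_⟩
  obtain ⟨f, rfl⟩ := Ideal.Quotient.mk_surjective x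
  induction f using MvPolynomial.induction_on with
  | C r => exact hR r
  | add f g hf hg => rw [map_add]; exact hf.add hg
  | mul_X f i hf => rw [map_mul]; exact hf.mul (hX i)

/-- The function `t` takes all large values, or no large value, on `Z`. -/
def DecidedAtTop (Z : Set (ι → ℝ)) (t : MvPolynomial ι ℝ) : Prop :=
  (∀ᶠ T in atTop, ∃ v ∈ Z, MvPolynomial.eval v t = T) ∨
    ∀ᶠ T in atTop, ∀ v ∈ Z, MvPolynomial.eval v t ≠ T

theorem DecidedAtTop.union {Z Z' W : Set (ι → ℝ)} {t : MvPolynomial ι ℝ} (h : DecidedAtTop Z t)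
    (h' : DecidedAtTop Z' t) (hZ : Z ⊆ W) (hZ' : Z' ⊆ W) (hW : W ⊆ Z ∪ Z') : DecidedAtTop W t := by
  rcases h with h | h
  · exact Or.inl (h.mono fun T ⟨v, hv, hT⟩ => ⟨v, hZ hv, hT⟩)
  rcases h' with h' | h'
  · exact Or.inl (h'.mono fun T ⟨v, hv, hT⟩ => ⟨v, hZ' hv, hT⟩)
  refine Or.inr ?_
  filter_upwards [h, h'] with T h1 h2 v hv
  exact (hW hv).elim (h1 v) (h2 v)

/-- Beyond the zeros of the two exceptional polynomials, the set of values of `t` is open by local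
sections and relatively closed by local boundedness of the fibres; a half-line is connected. -/
theorem decidedAtTop_of_isTranscendenceBasis [Fintype ι] {I : Ideal (MvPolynomial ι ℝ)} [I.IsPrime]
    {t : MvPolynomial ι ℝ}
    (ht : IsTranscendenceBasis ℝ fun _ : Unit => Ideal.Quotient.mk I t) :
    DecidedAtTop (MvPolynomial.zeroLocus ℝ I) t := by
  obtain ⟨q₁, hq₁, hS⟩ := exists_hasLocalSection_of_isTranscendenceBasis (φ := fun _ : Unit => t) ht
  obtain ⟨q₂, hq₂, hB⟩ := exists_locally_bounded_of_isTranscendenceBasis (φ := fun _ : Unit => t) ht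
  obtain ⟨T₀, hT₀⟩ := eventually_atTop.1 ((eventually_eval_unit_ne_zero hq₁).and
    (eventually_eval_unit_ne_zero hq₂))
  set A : Set ℝ := {T | ∃ v ∈ MvPolynomial.zeroLocus ℝ I, MvPolynomial.eval v t = T}
  have hconst : Continuous fun T : ℝ => fun _ : Unit => T := continuous_pi fun _ => continuous_id
  have hopen : IsOpen (Ioi T₀ ∩ A) := by
    rw [isOpen_iff_mem_nhds]
    rintro T ⟨hT, v, hv, rfl⟩
    obtain ⟨σ, -, -, hσ⟩ := hS v hv (hT₀ _ (le_of_lt hT)).1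
    refine inter_mem (Ioi_mem_nhds hT) ?_
    filter_upwards [(hconst.continuousAt (x := MvPolynomial.eval v t)).eventually hσ] with T' hT'
    exact ⟨_, hT'.1, congrFun hT'.2 ()⟩
  have hopen' : IsOpen (Ioi T₀ ∩ Aᶜ) := by
    rw [isOpen_iff_mem_nhds]
    rintro T ⟨hT, hTA⟩
    obtain ⟨M, hM⟩ := hB (fun _ => T) (hT₀ _ (le_of_lt hT)).2
    refine inter_mem (Ioi_mem_nhds hT) ?_
    have hc : IsCompact ((fun v => MvPolynomial.eval v t) ''
        (closedBall (0 : ι → ℝ) M ∩ MvPolynomial.zeroLocus ℝ I)) :=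
      ((isCompact_closedBall 0 M).inter_right (isClosed_zeroLocus I)).image
        (MvPolynomial.continuous_eval t)
    have hT' : T ∈ ((fun v => MvPolynomial.eval v t) ''
        (closedBall (0 : ι → ℝ) M ∩ MvPolynomial.zeroLocus ℝ I))ᶜ := by
      rintro ⟨v, hv, rfl⟩
      exact hTA ⟨v, hv.2, rfl⟩
    filter_upwards [hc.isClosed.isOpen_compl.mem_nhds hT',
      (hconst.continuousAt (x := T)).eventually hM] with T' h1 h2
    rintro ⟨v, hv, rfl⟩
    exact h1 ⟨v, ⟨by simpa using h2 v hv rfl, hv⟩, rfl⟩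
  have hsub := isPreconnected_iff_subset_of_disjoint.1 (isPreconnected_Ioi (a := T₀)) _ _ hopen
    hopen' (fun T hT => (em (T ∈ A)).imp (fun h => ⟨hT, h⟩) fun h => ⟨hT, h⟩)
    (by ext T; simp; tauto)
  refine hsub.imp (fun h => ?_) fun h => ?_
  · filter_upwards [Ioi_mem_atTop T₀] with T hT
    exact (h hT).2
  · filter_upwards [Ioi_mem_atTop T₀] with T hT v hv hvT
    exact (h hT).2 ⟨v, hv, hvT⟩

/-- On a real algebraic set a polynomial takes either all large values or no large value. -/
theorem decidedAtTop_zeroLocus [Fintype ι] (t : MvPolynomial ι ℝ) (J : Ideal (MvPolynomial ι ℝ)) :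
    DecidedAtTop (MvPolynomial.zeroLocus ℝ J) t := by
  induction J using WellFoundedGT.induction with
  | _ J ih =>
  set I := MvPolynomial.vanishingIdeal ℝ (MvPolynomial.zeroLocus ℝ J : Set (ι → ℝ)) with hI
  have hJI : J ≤ I := MvPolynomial.le_vanishingIdeal_zeroLocus J
  have hZ : MvPolynomial.zeroLocus ℝ I = (MvPolynomial.zeroLocus ℝ J : Set (ι → ℝ)) :=
    Subset.antisymm (MvPolynomial.zeroLocus_anti_mono hJI) (MvPolynomial.zeroLocus_vanishingIdeal_le _)
  rw [← hZ]
  by_cases htop : I = ⊤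
  · refine Or.inr (Eventually.of_forall fun T v hv => ?_)
    have := mem_zeroLocus.1 hv 1 (by rw [htop]; trivial)
    simp at this
  by_cases hprime : I.IsPrime
  swap
  · obtain ⟨f, g, hfg, hf, hg⟩ := exists_not_mem_of_not_isPrime hprime htop
    refine (ih _ (hJI.trans_lt (lt_sup_span hf))).union (ih _ (hJI.trans_lt (lt_sup_span hg)))
      (MvPolynomial.zeroLocus_anti_mono le_sup_left) (MvPolynomial.zeroLocus_anti_mono le_sup_left)
      fun v hv => ?_
    have := mem_zeroLocus.1 hv _ hfg
    rw [map_mul, mul_eq_zero] at this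
    exact this.imp (fun h => mem_zeroLocus_sup_span.2 ⟨hv, h⟩)
      fun h => mem_zeroLocus_sup_span.2 ⟨hv, h⟩
  by_cases htr : AlgebraicIndependent ℝ fun _ : Unit => Ideal.Quotient.mk I t
  swap
  · rw [algebraicIndependent_unique_type_iff, Transcendental, not_not] at htr
    obtain ⟨r, hr, hrt⟩ := htr
    refine Or.inr ?_
    filter_upwards [eventually_eval_ne_zero hr] with T hT v hv hvT
    refine hT ?_
    have h1 : Polynomial.aeval t r ∈ I := by
      rw [← Ideal.Quotient.eq_zero_iff_mem, ← hrt]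
      exact (Polynomial.aeval_algHom_apply (Ideal.Quotient.mkₐ ℝ I) t r).symm
    have h2 := mem_zeroLocus.1 hv _ h1
    rw [Polynomial.aeval_def, Polynomial.hom_eval₂, hvT] at h2
    rw [← h2, Polynomial.eval₂_eq_eval_map]
    congr 1
    rw [show (MvPolynomial.eval v).comp (algebraMap ℝ (MvPolynomial ι ℝ)) = RingHom.id ℝ from
      Subsingleton.elim _ _, Polynomial.map_id]
  -- If some squared distance is independent of `t`, minimising it on the level sets of `t` shows
  -- that every value of `t` is already taken on the smaller set `b = 0`. If none is, `t` alone is a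
  -- transcendence basis.
  by_cases hs : ∃ a, AlgebraicIndependent ℝ fun o : Option Unit =>
      Ideal.Quotient.mk I (o.elim (sqDist a) fun _ => t)
  swap
  · exact decidedAtTop_of_isTranscendenceBasis
      (isTranscendenceBasis_of_forall_sqDist htr (not_exists.1 hs))
  obtain ⟨a, ha⟩ := hs
  obtain ⟨b, hb, hS⟩ := exists_hasLocalSection ha
  have hlow : ∀ v ∈ MvPolynomial.zeroLocus ℝ I,
      ∃ w ∈ MvPolynomial.zeroLocus ℝ (I ⊔ Ideal.span {b}),
        MvPolynomial.eval w t = MvPolynomial.eval v t := by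
    intro v hv
    obtain ⟨w, hw, hbw, hwt⟩ := exists_mem_eval_eq_zero hS hv
    exact ⟨w, mem_zeroLocus_sup_span.2 ⟨hw, hbw⟩, hwt⟩
  refine (ih _ (hJI.trans_lt (lt_sup_span hb))).imp (fun h => ?_) fun h => ?_
  · filter_upwards [h] with T ⟨v, hv, hvT⟩
    exact ⟨v, (mem_zeroLocus_sup_span.1 hv).1, hvT⟩
  · filter_upwards [h] with T hT v hv hvT
    obtain ⟨w, hw, hwt⟩ := hlow v hv
    exact hT w hw (hwt.trans hvT)

/-- Rabinowitsch's trick: with an extra coordinate inverse to `b`, the condition `b ≠ 0` becomes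
algebraic. -/
theorem decidedAtTop_inter_ne_zero [Fintype ι] (t b : MvPolynomial ι ℝ)
    (J : Ideal (MvPolynomial ι ℝ)) :
    DecidedAtTop (MvPolynomial.zeroLocus ℝ J ∩ {v | MvPolynomial.eval v b ≠ 0}) t := by
  set J' : Ideal (MvPolynomial (Option ι) ℝ) := J.map (MvPolynomial.rename some) ⊔
    Ideal.span {MvPolynomial.X none * MvPolynomial.rename some b - 1} with hJ'
  have hmem : ∀ w : Option ι → ℝ, w ∈ MvPolynomial.zeroLocus ℝ J' ↔
      w ∘ some ∈ MvPolynomial.zeroLocus ℝ J ∧ w none * MvPolynomial.eval (w ∘ some) b = 1 := by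
    intro w
    rw [hJ', mem_zeroLocus_sup_span]
    refine and_congr ?_ ?_
    · have h1 : ∀ f : MvPolynomial ι ℝ,
          MvPolynomial.eval w (MvPolynomial.rename some f) = MvPolynomial.eval (w ∘ some) f :=
        fun f => MvPolynomial.eval_rename _ _ _
      rw [mem_zeroLocus, mem_zeroLocus]
      refine ⟨fun h f hf => ?_, fun h f hf => ?_⟩
      · rw [← h1]; exact h _ (Ideal.mem_map_of_mem _ hf)
      · have : J.map (MvPolynomial.rename some) ≤ RingHom.ker (MvPolynomial.eval w) :=
          Ideal.map_le_iff_le_comap.2 fun f hf => by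
            rw [Ideal.mem_comap, RingHom.mem_ker, h1]; exact h f hf
        exact this hf
    · rw [map_sub, map_mul, map_one, MvPolynomial.eval_X, MvPolynomial.eval_rename, sub_eq_zero]
  refine (decidedAtTop_zeroLocus (MvPolynomial.rename some t) J').imp (fun h => ?_) fun h => ?_
  · filter_upwards [h] with T ⟨w, hw, hwT⟩
    rw [MvPolynomial.eval_rename] at hwT
    have h2 := (hmem w).1 hw
    exact ⟨w ∘ some, ⟨h2.1, right_ne_zero_of_mul_eq_one h2.2⟩, hwT⟩
  · filter_upwards [h] with T hT v hv hvT
    set w : Option ι → ℝ := fun o => o.elim (MvPolynomial.eval v b)⁻¹ v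
    have hw : w ∘ some = v := rfl
    refine hT w ((hmem w).2 ⟨hv.1, inv_mul_cancel₀ hv.2⟩) ?_
    rw [MvPolynomial.eval_rename, hw, hvT]

/-- If `(t, φ)` satisfies no polynomial relation on an algebraic set near `t = ∞`, then
`(t, φ)` has analytic sections over points with any given large value of `t`. -/
theorem IndepAlong.eventually_exists_hasLocalSection {κ : Type*} [Fintype ι] [Fintype κ]
    {t : MvPolynomial ι ℝ} {φ : κ → MvPolynomial ι ℝ} {J : Ideal (MvPolynomial ι ℝ)}
    (h : IndepAlong (comap (fun v => MvPolynomial.eval v t) atTop) (MvPolynomial.zeroLocus ℝ J)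
      fun o : Option κ => o.elim t φ) :
    ∀ᶠ T in atTop, ∃ v, MvPolynomial.eval v t = T ∧
      HasLocalSection (MvPolynomial.zeroLocus ℝ J) (fun o : Option κ => o.elim t φ) v := by
  obtain ⟨I, hI, hJI, hdense, hind⟩ := h.exists_prime
  obtain ⟨b, hb, hS⟩ := SingularOpenBook.exists_hasLocalSection hind
  rcases decidedAtTop_inter_ne_zero t b I with h1 | h1
  · filter_upwards [h1] with T ⟨v, hv, hvT⟩
    obtain ⟨σ, h2, h3, h4⟩ := hS v hv.1 hv.2
    exact ⟨v, hvT, σ, h2, h3, h4.mono fun u hu =>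
      ⟨MvPolynomial.zeroLocus_anti_mono hJI hu.1, hu.2⟩⟩
  -- The points with `b ≠ 0` recur along `t → ∞`, so it is impossible that no large value is taken.
  · obtain ⟨v, hv, hv'⟩ := ((hdense b hb).and_eventually (tendsto_comap.eventually h1)).exists
    exact absurd rfl (hv' v hv)

end Values

/-! ### Coordinates on smooth pieces -/

theorem surjective_pi_of_linearIndependent {E : Type*} [AddCommGroup E] [Module ℝ E] {k : ℕ}
    {l : Fin k → E →ₗ[ℝ] ℝ} (h : LinearIndependent ℝ l) :
    Function.Surjective (LinearMap.pi l) := by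
  rw [← LinearMap.dualMap_injective_iff, injective_iff_map_eq_zero]
  intro f hf
  have h1 : ∑ i, f (Pi.single i 1) • l i = 0 := by
    ext x
    have h2 : f (LinearMap.pi l x) = 0 := LinearMap.congr_fun hf x
    rw [LinearMap.pi_apply_eq_sum_univ] at h2
    simp only [smul_eq_mul] at h2
    simp only [LinearMap.coe_sum, Finset.sum_apply, LinearMap.smul_apply, smul_eq_mul,
      LinearMap.zero_apply]
    rw [← h2]
    refine Finset.sum_congr rfl fun i _ => ?_
    rw [mul_comm, LinearMap.pi_apply]
    congr 2
    funext j
    simp [Pi.single_apply, eq_comm]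
  have h3 := Fintype.linearIndependent_iff.1 h _ h1
  exact LinearMap.pi_ext' fun i => LinearMap.ext_ring (by simpa using h3 i)

/-- An injective linear map into a coordinate space becomes surjective after restriction to suitable
coordinates. -/
theorem exists_coordinates_surjective {E : Type*} [AddCommGroup E] [Module ℝ E]
    [FiniteDimensional ℝ E] {m k : ℕ} (A : E →ₗ[ℝ] Fin m → ℝ) (hA : Function.Injective A)
    (hk : k ≤ Module.finrank ℝ E) :
    ∃ J : Fin k → Fin m, ∀ w : Fin k → ℝ, ∃ x, ∀ i, A x (J i) = w i := by
  set l : Fin m → Module.Dual ℝ E := fun j => LinearMap.proj j ∘ₗ A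
  have hspan : Submodule.span ℝ (range l) = ⊤ := by
    rw [eq_top_iff]
    intro f _
    -- Injectivity means that the coordinate functionals have no common zero but 0, so they span the
    -- dual space, and independent ones can be selected.
    refine mem_span_of_iInf_ker_le_ker fun x hx => ?_
    rw [Submodule.mem_iInf] at hx
    have : x = 0 := hA (by rw [map_zero]; exact funext fun j => hx j)
    rw [this]; exact map_zero f
  obtain ⟨f, hf, -, hind⟩ := Submodule.exists_fun_fin_finrank_span_eq ℝ (range l)
  choose j hj using hf
  have hk' : k ≤ Module.finrank ℝ (Submodule.span ℝ (range l)) := by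
    rw [hspan, finrank_top, Subspace.dual_finrank_eq]
    exact hk
  have hsurj := surjective_pi_of_linearIndependent (hind.comp _ (Fin.castLE_injective hk'))
  refine ⟨fun i => j (Fin.castLE hk' i), fun w => ?_⟩
  obtain ⟨x, hx⟩ := hsurj w
  refine ⟨x, fun i => ?_⟩
  rw [← hx]
  exact LinearMap.congr_fun (hj (Fin.castLE hk' i)) x

/-- Coordinates that are independent on the kernel of `l` can be adjusted after `l` has been given
its value. -/
theorem exists_coordinates_surjective_with {E : Type*} [AddCommGroup E] [Module ℝ E]
    [FiniteDimensional ℝ E] {m k : ℕ} (A : E →ₗ[ℝ] Fin m → ℝ) (hA : Function.Injective A)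
    {l : E →ₗ[ℝ] ℝ} (hl : l ≠ 0) (hk : k + 1 ≤ Module.finrank ℝ E) :
    ∃ J : Fin k → Fin m, ∀ (c : ℝ) (w : Fin k → ℝ), ∃ x, l x = c ∧ ∀ i, A x (J i) = w i := by
  have hrank := l.finrank_range_add_finrank_ker
  rw [LinearMap.range_eq_top.2 (LinearMap.surjective hl), finrank_top, Module.finrank_self] at hrank
  obtain ⟨J, hJ⟩ := exists_coordinates_surjective (k := k) (A ∘ₗ (LinearMap.ker l).subtype)
    (hA.comp Subtype.val_injective) (by omega)
  refine ⟨J, fun c w => ?_⟩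
  obtain ⟨y, hy⟩ := LinearMap.surjective hl c
  obtain ⟨z, hz⟩ := hJ fun i => w i - A y (J i)
  refine ⟨y + z, ?_, fun i => ?_⟩
  · rw [map_add, hy, LinearMap.mem_ker.1 z.2, add_zero]
  · have := hz i
    rw [map_add, Pi.add_apply]
    simp only [LinearMap.comp_apply, Submodule.subtype_apply] at this
    rw [this]; ring

/-- A polynomial vanishing on a nonempty open set is zero. -/
theorem eq_zero_of_eventually_eval_eq_zero {κ : Type*} [Finite κ] {Q : MvPolynomial κ ℝ}
    {w : κ → ℝ} (h : ∀ᶠ y in 𝓝 w, MvPolynomial.eval y Q = 0) : Q = 0 := by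
  have := Fintype.ofFinite κ
  obtain ⟨ε, hε, hball⟩ := Metric.eventually_nhds_iff_ball.1 h
  refine MvPolynomial.funext_set (fun k => ball (w k) ε)
    (fun k => infinite_of_mem_nhds (w k) (ball_mem_nhds _ hε)) fun y hy => ?_
  rw [map_zero]
  refine hball y ?_
  rw [← ball_pi _ hε] at hy
  exact hy

/-- A map with surjective strict derivative is open at the point, so `Q` vanishes on a neighbourhood
of the image. -/
theorem eq_zero_of_eventually_comp_eq_zero {E κ : Type*} [NormedAddCommGroup E] [NormedSpace ℝ E]
    [CompleteSpace E] [Fintype κ] {Q : MvPolynomial κ ℝ} {g : E → κ → ℝ} {g' : κ → E →L[ℝ] ℝ} {u : E}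
    (hg : ∀ k, HasStrictFDerivAt (fun x => g x k) (g' k) u)
    (hsurj : ∀ w : κ → ℝ, ∃ x, ∀ k, g' k x = w k)
    (h : ∀ᶠ x in 𝓝 u, MvPolynomial.eval (g x) Q = 0) : Q = 0 := by
  have hd : HasStrictFDerivAt g (ContinuousLinearMap.pi g') u := hasStrictFDerivAt_pi.2 hg
  have hmap := hd.map_nhds_eq_of_surj (LinearMap.range_eq_top.2 fun w => by
    obtain ⟨x, hx⟩ := hsurj w
    exact ⟨x, funext hx⟩)
  refine eq_zero_of_eventually_eval_eq_zero (w := g u) ?_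
  rw [← hmap]
  exact h

/-- Some coefficient of `Q`, as a polynomial in the distinguished variable, is nonzero, and so has
no large roots. -/
theorem eventually_exists_specialization {κ : Type*} {Q : MvPolynomial (Option κ) ℝ} (hQ : Q ≠ 0) :
    ∀ᶠ T : ℝ in atTop, ∃ Q' : MvPolynomial κ ℝ, Q' ≠ 0 ∧
      ∀ w : κ → ℝ, MvPolynomial.eval w Q' = MvPolynomial.eval (fun o => o.elim T w) Q := by
  have h0 : MvPolynomial.optionEquivRight ℝ κ Q ≠ 0 :=
    (map_ne_zero_iff _ (MvPolynomial.optionEquivRight ℝ κ).injective).2 hQ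
  obtain ⟨n, hn⟩ := MvPolynomial.ne_zero_iff.1 h0
  filter_upwards [eventually_eval_ne_zero hn] with T hT
  refine ⟨(MvPolynomial.optionEquivRight ℝ κ Q).map (Polynomial.evalRingHom T), ?_, fun w => ?_⟩
  · refine MvPolynomial.ne_zero_iff.2 ⟨n, ?_⟩
    rw [MvPolynomial.coeff_map]
    exact hT
  · clear hT hn n h0 hQ
    induction Q using MvPolynomial.induction_on with
    | C a => simp
    | add f g hf hg => rw [map_add, map_add, map_add, map_add, hf, hg]
    | mul_X f o hf =>
      rw [map_mul, map_mul, map_mul, map_mul, hf]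
      cases o <;> simp

/-! ### The dimension of the links at infinity -/

section Link

variable {m : ℕ} {A : Set (EuclideanSpace ℝ (Fin m))}

theorem ContainsPiece.mono {B : Set (EuclideanSpace ℝ (Fin m))} {d : ℕ} (h : ContainsPiece A d)
    (hAB : A ⊆ B) : ContainsPiece B d := by
  obtain ⟨U, f, h1, h2, h3, h4, h5⟩ := h
  exact ⟨U, f, h1, h2, h3, h4, h5.mono_right hAB⟩

/-- The differentiable left inverse `g` forces the differential of `σ` to be injective. -/
theorem containsPiece_of_section {k : ℕ} {σ : (Fin k → ℝ) → Fin m → ℝ}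
    {g : (Fin m → ℝ) → Fin k → ℝ} {u₀ : Fin k → ℝ} (hσ : AnalyticAt ℝ σ u₀)
    (hg : Differentiable ℝ g) (h : ∀ᶠ u in 𝓝 u₀, WithLp.toLp 2 (σ u) ∈ A ∧ g (σ u) = u) :
    ContainsPiece A k := by
  obtain ⟨U, hU, hUo, hu₀⟩ := _root_.eventually_nhds_iff.1 (hσ.eventually_analyticAt.and h)
  let e := EuclideanSpace.equiv (Fin k) ℝ
  let e' := EuclideanSpace.equiv (Fin m) ℝ
  have hd : ∀ u ∈ e ⁻¹' U, ContDiffAt ℝ ∞ (fun u => e'.symm (σ (e u))) u := fun u hu =>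
    e'.symm.contDiff.contDiffAt.comp u ((hU _ hu).1.contDiffAt.comp u e.contDiff.contDiffAt)
  refine ⟨e ⁻¹' U, fun u => e'.symm (σ (e u)), hUo.preimage e.continuous, ⟨e.symm u₀, by simpa⟩,
    fun u hu => (hd u hu).contDiffWithinAt, fun u hu => ?_, fun u hu => (hU _ hu).2.1⟩
  have h1 : HasFDerivAt (fun u => e.symm (g (e' (e'.symm (σ (e u))))))
      (((e.symm : (Fin k → ℝ) →L[ℝ] _) ∘L (fderiv ℝ g (e' (e'.symm (σ (e u)))) ∘L
        (e' : _ →L[ℝ] Fin m → ℝ))) ∘L fderiv ℝ (fun u => e'.symm (σ (e u))) u) u := by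
    have h2 : HasFDerivAt (fun y => e.symm (g (e' y))) _ (e'.symm (σ (e u))) :=
      e.symm.hasFDerivAt.comp _ ((hg _).hasFDerivAt.comp _ e'.hasFDerivAt)
    exact h2.comp u ((hd u hu).differentiableAt (by simp)).hasFDerivAt
  have h2 : (fun u => e.symm (g (e' (e'.symm (σ (e u)))))) =ᶠ[𝓝 u] id := by
    filter_upwards [(hUo.preimage e.continuous).mem_nhds hu] with x hx
    simp [(hU _ hx).2.2]
  have h3 := h1.unique ((hasFDerivAt_id u).congr_of_eventuallyEq h2)
  intro x y hxy
  have h4 := congrArg (fun L : EuclideanSpace ℝ (Fin k) →L[ℝ] EuclideanSpace ℝ (Fin k) => L x) h3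
  have h5 := congrArg (fun L : EuclideanSpace ℝ (Fin k) →L[ℝ] EuclideanSpace ℝ (Fin k) => L y) h3
  simp only [ContinuousLinearMap.comp_apply, ContinuousLinearMap.id_apply] at h4 h5
  rw [← h4, ← h5, hxy]

theorem eval_sqDist_zero (x : EuclideanSpace ℝ (Fin m)) :
    MvPolynomial.eval x.ofLp (sqDist 0) = ‖x‖ ^ 2 := by
  rw [eval_sqDist, EuclideanSpace.real_norm_sq_eq]
  simp

/-- The squared norm and the coordinates with indices `J`. -/
def normCoordinates {k : ℕ} (J : Fin k → Fin m) : Option (Fin k) → MvPolynomial (Fin m) ℝ :=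
  fun o => o.elim (sqDist 0) fun i => .X (J i)

theorem evalMap_normCoordinates {k : ℕ} (J : Fin k → Fin m) (x : EuclideanSpace ℝ (Fin m)) :
    evalMap (normCoordinates J) x.ofLp = fun o => o.elim (‖x‖ ^ 2) fun i => x (J i) := by
  funext o
  cases o
  · exact eval_sqDist_zero x
  · exact MvPolynomial.eval_X _

theorem differentiable_evalMap {ι κ : Type*} [Fintype ι] [Fintype κ] (φ : κ → MvPolynomial ι ℝ) :
    Differentiable ℝ (evalMap φ) := differentiable_pi.2 fun k =>
  fun x => (AnalyticOnNhd.eval_mvPolynomial (φ k) x (mem_univ x)).differentiableAt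

/-- A section of the squared norm and `k` coordinates over a point of norm `R` yields a piece
of dimension `k` in the sphere of radius `R`. -/
theorem containsPiece_sphere_of_hasLocalSection {Z : Set (Fin m → ℝ)} {k : ℕ} {J : Fin k → Fin m}
    {x : EuclideanSpace ℝ (Fin m)} (h : HasLocalSection Z (normCoordinates J) x.ofLp) :
    ContainsPiece (WithLp.ofLp ⁻¹' Z ∩ sphere 0 ‖x‖) k := by
  obtain ⟨σ, h1, -, h3⟩ := h
  rw [evalMap_normCoordinates] at h1 h3
  set j : (Fin k → ℝ) → Option (Fin k) → ℝ := fun u o => o.elim (‖x‖ ^ 2) u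
  have hj : AnalyticAt ℝ j fun i => x (J i) := by
    rw [analyticAt_pi_iff]
    rintro (_ | i)
    · exact analyticAt_const
    · exact (ContinuousLinearMap.proj (R := ℝ) (φ := fun _ : Fin k => ℝ) i).analyticAt _
  refine containsPiece_of_section (σ := σ ∘ j) (g := fun y i => y (J i))
    (AnalyticAt.comp (g := σ) (f := j) h1 hj) (by fun_prop) ?_
  filter_upwards [hj.continuousAt.eventually h3] with u hu
  have hy : evalMap (normCoordinates J) (WithLp.toLp 2 (σ (j u)) : EuclideanSpace ℝ (Fin m)).ofLp =
      j u := hu.2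
  rw [evalMap_normCoordinates] at hy
  refine ⟨⟨hu.1, ?_⟩, funext fun i => congrFun hy (some i)⟩
  rw [mem_sphere_zero_iff_norm]
  exact (sq_eq_sq₀ (norm_nonneg _) (norm_nonneg _)).1 (congrFun hy none)

variable {J : Ideal (MvPolynomial (Fin m) ℝ)} {d : ℕ}

/-- Without a relation, these `d + 1` functions would be independent on the open set `R₁ < ‖x‖`, and
a section would be a piece of dimension `d + 1`. -/
theorem exists_relation_of_hasDim {R₁ : ℝ}
    (h : ∀ e, ContainsPiece (WithLp.ofLp ⁻¹' MvPolynomial.zeroLocus ℝ J \ ball 0 R₁) e → e ≤ d)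
    (j : Fin d → Fin m) : ∃ Q : MvPolynomial (Option (Fin d)) ℝ, Q ≠ 0 ∧
      ∀ x : EuclideanSpace ℝ (Fin m), x.ofLp ∈ MvPolynomial.zeroLocus ℝ J → R₁ < ‖x‖ →
        MvPolynomial.eval (fun o => o.elim (‖x‖ ^ 2) fun i => x (j i)) Q = 0 := by
  by_contra! hcon
  have hind : IndepAlong (𝓟 {v : Fin m → ℝ | R₁ < ‖(WithLp.toLp 2 v : EuclideanSpace ℝ (Fin m))‖})
      (MvPolynomial.zeroLocus ℝ J) (normCoordinates j) := by
    intro Q hQ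
    obtain ⟨x, hx, hxR, hxQ⟩ := hcon Q hQ
    refine frequently_principal.2 ⟨x.ofLp, hxR, hx, ?_⟩
    rw [evalMap_normCoordinates]
    exact hxQ
  obtain ⟨v, hvO, σ, h1, h2, h3⟩ := hind.exists_hasLocalSection
  have hcont : ContinuousAt (fun u => ‖(WithLp.toLp 2 (σ u) : EuclideanSpace ℝ (Fin m))‖)
      (evalMap (normCoordinates j) v) :=
    ((PiLp.continuous_toLp 2 _).continuousAt.comp h1.continuousAt).norm
  have h4 := hcont.eventually (lt_mem_nhds (a := R₁) (by
    simp only [h2]; exact hvO))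
  let e : Option (Fin d) ≃ Fin (d + 1) := (Fintype.equivFinOfCardEq (by simp))
  have hp : ContainsPiece (WithLp.ofLp ⁻¹' MvPolynomial.zeroLocus ℝ J \ ball 0 R₁) (d + 1) := by
    set c : (Fin (d + 1) → ℝ) → Option (Fin d) → ℝ := fun u o => u (e o)
    have hc : ∀ u, AnalyticAt ℝ c u := fun u => analyticAt_pi_iff.2 fun o =>
      (ContinuousLinearMap.proj (R := ℝ) (φ := fun _ : Fin (d + 1) => ℝ) (e o)).analyticAt _
    have hc0 : c (fun i => evalMap (normCoordinates j) v (e.symm i)) =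
        evalMap (normCoordinates j) v := by funext o; simp [c]
    refine containsPiece_of_section (σ := σ ∘ c)
      (g := fun y i => evalMap (normCoordinates j) y (e.symm i))
      (u₀ := fun i => evalMap (normCoordinates j) v (e.symm i))
      (AnalyticAt.comp (g := σ) (f := c) (by rw [hc0]; exact h1) (hc _)) ?_ ?_
    · exact differentiable_pi.2 fun i => differentiable_pi.1 (differentiable_evalMap _) _
    · have h5 := (hc (fun i => evalMap (normCoordinates j) v (e.symm i))).continuousAt.eventually
        (p := fun w => (σ w ∈ MvPolynomial.zeroLocus ℝ J ∧ evalMap (normCoordinates j) (σ w) = w) ∧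
          R₁ < ‖(WithLp.toLp 2 (σ w) : EuclideanSpace ℝ (Fin m))‖) (by rw [hc0]; exact h3.and h4)
      filter_upwards [h5] with u hu
      refine ⟨⟨hu.1.1, ?_⟩, ?_⟩
      · rw [mem_ball_zero_iff, not_lt]; exact hu.2.le
      · funext i
        simp [hu.1.2, c]
  have := h _ hp
  omega

/-- The links of large radius have smaller dimension than the algebraic set at infinity. -/
theorem eventually_lt_of_containsPiece_sphere {R₁ : ℝ}
    (h : ∀ e, ContainsPiece (WithLp.ofLp ⁻¹' MvPolynomial.zeroLocus ℝ J \ ball 0 R₁) e → e ≤ d) :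
    ∀ᶠ R : ℝ in atTop, ∀ e,
      ContainsPiece (WithLp.ofLp ⁻¹' MvPolynomial.zeroLocus ℝ J ∩ sphere 0 R) e → e < d := by
  choose Q hQ hQ0 using exists_relation_of_hasDim h
  have h1 := Filter.eventually_all.2 fun j : Fin d → Fin m => eventually_exists_specialization (hQ j)
  filter_upwards [(tendsto_pow_atTop (two_ne_zero)).eventually h1, Ioi_mem_atTop R₁]
    with R hR hRR₁ e he
  by_contra! hde
  -- A piece of dimension at least `d` has `d` independent coordinates, but on the sphere these
  -- satisfy the nonzero relation specialised at `R ^ 2`.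
  obtain ⟨U, f, hU, ⟨u, hu⟩, hf, hinj, hmaps⟩ := he
  have hfu : HasStrictFDerivAt f (fderiv ℝ f u) u :=
    (hf.contDiffAt (hU.mem_nhds hu)).hasStrictFDerivAt (by simp)
  obtain ⟨j, hj⟩ := exists_coordinates_surjective (k := d)
    ((EuclideanSpace.equiv (Fin m) ℝ : EuclideanSpace ℝ (Fin m) →ₗ[ℝ] Fin m → ℝ) ∘ₗ
      (fderiv ℝ f u : EuclideanSpace ℝ (Fin e) →ₗ[ℝ] EuclideanSpace ℝ (Fin m)))
    ((EuclideanSpace.equiv (Fin m) ℝ).injective.comp (hinj u hu)) (by simpa using hde)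
  obtain ⟨Q', hQ', hQ'0⟩ := hR j
  refine hQ' (eq_zero_of_eventually_comp_eq_zero (u := u) (g := fun x i => f x (j i))
    (g' := fun i => EuclideanSpace.proj (j i) ∘L fderiv ℝ f u) (fun i => ?_) (fun w => ?_) ?_)
  · exact (EuclideanSpace.proj (𝕜 := ℝ) (j i)).hasStrictFDerivAt.comp u hfu
  · obtain ⟨x, hx⟩ := hj w
    exact ⟨x, hx⟩
  · filter_upwards [hU.mem_nhds hu] with x hx
    have hfx := hmaps hx
    have hnorm : ‖f x‖ = R := mem_sphere_zero_iff_norm.1 hfx.2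
    rw [hQ'0, ← hQ0 j (f x) hfx.1 (by rw [hnorm]; exact hRR₁), hnorm]

/-- A piece on which the norm is not locally constant has the squared norm and some of the
coordinates as independent functions. -/
theorem exists_coordinates_of_containsPiece {k : ℕ} (h : ContainsPiece A (k + 1))
    (hsphere : ∀ x ∈ A, ¬ ContainsPiece (A ∩ sphere 0 ‖x‖) (k + 1)) :
    ∃ j : Fin k → Fin m, ∀ Q : MvPolynomial (Option (Fin k)) ℝ, Q ≠ 0 → ∃ x ∈ A,
      MvPolynomial.eval (fun o => o.elim (‖x‖ ^ 2) fun i => x (j i)) Q ≠ 0 := by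
  obtain ⟨U, f, hU, ⟨u₀, hu₀⟩, hf, hinj, hmaps⟩ := h
  have hstrict : ∀ u ∈ U, HasStrictFDerivAt f (fderiv ℝ f u) u := fun u hu =>
    (hf.contDiffAt (hU.mem_nhds hu)).hasStrictFDerivAt (by simp)
  have hd : ∀ u ∈ U, HasStrictFDerivAt (fun x => ‖f x‖ ^ 2)
      (2 • (innerSL ℝ (f u) ∘L fderiv ℝ f u)) u := fun u hu => 
    (hasStrictFDerivAt_norm_sq (f u)).comp u (hstrict u hu)
  -- Otherwise the norm would be constant on a ball, whose image would be a piece in one sphere.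
  obtain ⟨u, hu, hne⟩ : ∃ u ∈ U, innerSL ℝ (f u) ∘L fderiv ℝ f u ≠ 0 := by
    by_contra! hcon
    obtain ⟨ε, hε, hball⟩ := Metric.isOpen_iff.1 hU u₀ hu₀
    refine hsphere (f u₀) (hmaps hu₀) ⟨ball u₀ ε, f, isOpen_ball, ⟨u₀, mem_ball_self hε⟩,
      hf.mono hball, fun u hu => hinj u (hball hu), fun u hu => ⟨hmaps (hball hu), ?_⟩⟩
    have := isOpen_ball.is_const_of_fderiv_eq_zero (𝕜 := ℝ) (f := fun x => ‖f x‖ ^ 2)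
      (convex_ball u₀ ε).isPreconnected
      (fun x hx => (hd x (hball hx)).hasFDerivAt.differentiableAt.differentiableWithinAt)
      (fun x hx => by rw [(hd x (hball hx)).hasFDerivAt.fderiv, hcon x (hball hx)]; simp)
      hu (mem_ball_self hε)
    rw [mem_sphere_zero_iff_norm]
    exact (sq_eq_sq₀ (norm_nonneg _) (norm_nonneg _)).1 this
  obtain ⟨j, hj⟩ := exists_coordinates_surjective_with (k := k)
    ((EuclideanSpace.equiv (Fin m) ℝ : EuclideanSpace ℝ (Fin m) →ₗ[ℝ] Fin m → ℝ) ∘ₗ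
      (fderiv ℝ f u : EuclideanSpace ℝ (Fin (k + 1)) →ₗ[ℝ] EuclideanSpace ℝ (Fin m)))
    ((EuclideanSpace.equiv (Fin m) ℝ).injective.comp (hinj u hu))
    (l := ((innerSL ℝ (f u) ∘L fderiv ℝ f u : _ →L[ℝ] ℝ) : _ →ₗ[ℝ] ℝ))
    (fun h0 => hne (ContinuousLinearMap.coe_injective h0)) (by simp)
  refine ⟨j, fun Q hQ => ?_⟩
  by_contra! hcon
  refine hQ (eq_zero_of_eventually_comp_eq_zero (u := u)
    (g := fun x o => o.elim (‖f x‖ ^ 2) fun i => f x (j i))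
    (g' := fun o => o.elim (2 • (innerSL ℝ (f u) ∘L fderiv ℝ f u))
      fun i => EuclideanSpace.proj (j i) ∘L fderiv ℝ f u) ?_ (fun w => ?_) ?_)
  · rintro (_ | i)
    · exact hd u hu
    · exact (EuclideanSpace.proj (𝕜 := ℝ) (j i)).hasStrictFDerivAt.comp u (hstrict u hu)
  -- The half compensates the factor 2 in the differential of `‖·‖ ^ 2`.
  · obtain ⟨x, hx, hx'⟩ := hj (w none / 2) fun i => w (some i)
    refine ⟨x, ?_⟩
    rintro (_ | i)
    · have h2 : (innerSL ℝ (f u) ∘L fderiv ℝ f u) x = w none / 2 := hx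
      change (2 • (innerSL ℝ (f u) ∘L fderiv ℝ f u)) x = w none
      rw [two_smul, add_apply, h2]; ring
    · exact hx' i
  · filter_upwards [hU.mem_nhds hu] with x hx
    exact hcon (f x) (hmaps hx)

/-- If an algebraic set has dimension `k + 1` at infinity, then its links of large radius have
dimension `k`. -/
theorem eventually_hasDim_sphere {k : ℕ}
    (h : ∀ᶠ R : ℝ in atTop, HasDim (WithLp.ofLp ⁻¹' MvPolynomial.zeroLocus ℝ J \ ball 0 R) (k + 1)) :
    ∀ᶠ R : ℝ in atTop, HasDim (WithLp.ofLp ⁻¹' MvPolynomial.zeroLocus ℝ J ∩ sphere 0 R) k := by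
  set V : Set (EuclideanSpace ℝ (Fin m)) := WithLp.ofLp ⁻¹' MvPolynomial.zeroLocus ℝ J with hV
  obtain ⟨R₁, hR₁⟩ := h.exists
  have hup := eventually_lt_of_containsPiece_sphere hR₁.2
  obtain ⟨R₂, hR₂⟩ := eventually_atTop.1 hup
  have hloc : ∀ᶠ R : ℝ in atTop, ∃ j : Fin k → Fin m, ∀ Q : MvPolynomial (Option (Fin k)) ℝ,
      Q ≠ 0 → ∃ x ∈ V \ ball 0 R,
        MvPolynomial.eval (fun o => o.elim (‖x‖ ^ 2) fun i => x (j i)) Q ≠ 0 := by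
    filter_upwards [h, eventually_ge_atTop R₂] with R hR hRR₂
    refine exists_coordinates_of_containsPiece hR.1 fun x hx hp => ?_
    have hx2 : R ≤ ‖x‖ := by simpa using hx.2
    exact lt_irrefl _ (hR₂ ‖x‖ (hRR₂.trans hx2) _ (hp.mono (inter_subset_inter_left _ sdiff_subset)))
  -- The coordinates may depend on `R`, but there are finitely many choices, so one serves for
  -- arbitrarily large `R`.
  obtain ⟨j, hj⟩ := frequently_exists.1 hloc.frequently
  have hind : IndepAlong (comap (fun v => MvPolynomial.eval v (sqDist 0)) atTop)
      (MvPolynomial.zeroLocus ℝ J) (normCoordinates j) := by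
    intro Q hQ
    rw [frequently_comap, frequently_atTop]
    intro a
    obtain ⟨R, hR, ha, hR0⟩ := (hj.and_eventually ((tendsto_pow_atTop two_ne_zero).eventually
      (eventually_ge_atTop a) |>.and (eventually_ge_atTop 0))).exists
    obtain ⟨x, hx, hxQ⟩ := hR Q hQ
    have hx2 : R ≤ ‖x‖ := by simpa using hx.2
    refine ⟨‖x‖ ^ 2, ha.trans (pow_le_pow_left₀ hR0 hx2 2), x.ofLp, eval_sqDist_zero x, hx.1, ?_⟩
    rw [evalMap_normCoordinates]
    exact hxQ
  have hlow := (tendsto_pow_atTop (two_ne_zero)).eventually hind.eventually_exists_hasLocalSection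
  filter_upwards [hup, hlow, eventually_ge_atTop 0] with R h1 h2 hR0
  refine ⟨?_, fun e he => Nat.lt_succ_iff.1 (h1 e he)⟩
  obtain ⟨v, hv, hs⟩ := h2
  have hx : ‖(WithLp.toLp 2 v : EuclideanSpace ℝ (Fin m))‖ = R := by
    refine (sq_eq_sq₀ (norm_nonneg _) hR0).1 ?_
    rw [← eval_sqDist_zero]
    exact hv
  have := containsPiece_sphere_of_hasLocalSection
    (x := (WithLp.toLp 2 v : EuclideanSpace ℝ (Fin m))) (J := j) hs
  rwa [hx] at this

end Link

/-! ### Polynomial maps: regularity, zero locus and codimension of the links. -/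

section PolyMap

variable {m p : ℕ}

theorem contDiff_polyMap (P : Fin p → MvPolynomial (Fin m) ℝ) : ContDiff ℝ ∞ (polyMap P) := by
  rw [contDiff_euclidean]
  intro i
  exact ((AnalyticOnNhd.eval_mvPolynomial (P i)).contDiff (n := ∞)).comp
    (EuclideanSpace.equiv (Fin m) ℝ).contDiff

theorem analyticOnNhd_polyMap (P : Fin p → MvPolynomial (Fin m) ℝ) :
    AnalyticOnNhd ℝ (polyMap P) univ := by
  intro x _
  have h : AnalyticAt ℝ (evalMap P) x.ofLp := analyticAt_pi_iff.2 fun i =>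
    AnalyticOnNhd.eval_mvPolynomial (P i) _ (mem_univ _)
  have h2 : AnalyticAt ℝ (fun x : EuclideanSpace ℝ (Fin m) => evalMap P x.ofLp) x :=
    h.comp ((EuclideanSpace.equiv (Fin m) ℝ : _ →L[ℝ] Fin m → ℝ).analyticAt x)
  have h3 : AnalyticAt ℝ (fun y => (EuclideanSpace.equiv (Fin p) ℝ).symm y) (evalMap P x.ofLp) :=
    ContinuousLinearMap.analyticAt
      ((EuclideanSpace.equiv (Fin p) ℝ).symm : (Fin p → ℝ) →L[ℝ] EuclideanSpace ℝ (Fin p)) _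
  exact AnalyticAt.comp (g := fun y => (EuclideanSpace.equiv (Fin p) ℝ).symm y)
    (f := fun x : EuclideanSpace ℝ (Fin m) => evalMap P x.ofLp) h3 h2

theorem zeroLocus_polyMap (P : Fin p → MvPolynomial (Fin m) ℝ) :
    zeroLocus (polyMap P) = WithLp.ofLp ⁻¹' MvPolynomial.zeroLocus ℝ (Ideal.span (range P)) := by
  ext x
  rw [mem_preimage, mem_zeroLocus]
  have h1 : x ∈ zeroLocus (polyMap P) ↔ ∀ i, MvPolynomial.eval x.ofLp (P i) = 0 := by
    constructor
    · intro h i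
      exact congrFun (congrArg WithLp.ofLp (show polyMap P x = 0 from h)) i
    · intro h
      change polyMap P x = 0
      ext i
      exact h i
  rw [h1]
  refine ⟨fun h f hf => ?_, fun h i => h _ (Ideal.subset_span ⟨i, rfl⟩)⟩
  have : Ideal.span (range P) ≤ RingHom.ker (MvPolynomial.eval x.ofLp) :=
    Ideal.span_le.2 (by rintro _ ⟨i, rfl⟩; exact h i)
  exact this hf

/-- The zero locus of codimension `p` at infinity has links of codimension `p` in the spheres of
large radius. -/
theorem eventually_hasCodim_link (hpm : p ≤ m - 1) (hp : 0 < p) (P : Fin p → MvPolynomial (Fin m) ℝ)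
    (h : HasCodimAtInfinity p (zeroLocus (polyMap P))) :
    ∀ᶠ R : ℝ in atTop, HasCodim (m - 1) p (link (polyMap P) R) := by
  have h1 : ∀ᶠ R : ℝ in atTop, HasDim
      (WithLp.ofLp ⁻¹' MvPolynomial.zeroLocus ℝ (Ideal.span (range P)) \ ball 0 R)
      ((m - 1 - p) + 1) := by
    filter_upwards [h.1] with R ⟨d, hd, hdim⟩
    rw [← zeroLocus_polyMap]
    have : m - 1 - p + 1 = d := by omega
    rwa [this]
  filter_upwards [eventually_hasDim_sphere h1] with R hR
  refine ⟨m - 1 - p, by omega, ?_⟩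
  rw [link, zeroLocus_polyMap]
  exact hR

/-- A set of positive codimension outside a ball has dense complement there. -/
theorem mem_closure_compl_of_hasCodim (hp : 0 < p) {V : Set (EuclideanSpace ℝ (Fin m))} {R : ℝ}
    (h : HasCodim m p (V \ ball 0 R)) {y : EuclideanSpace ℝ (Fin m)} (hy : R < ‖y‖) :
    y ∈ closure Vᶜ := by
  obtain ⟨d, hd, hdim⟩ := h
  by_contra hcon
  rw [closure_compl, mem_compl_iff, not_not] at hcon
  -- An interior point of `V` outside the ball would give a piece of full dimension `m`, but the
  -- dimension is `m - p < m`.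
  have := hdim.2 m ⟨interior V ∩ {z | R < ‖z‖}, id,
    isOpen_interior.inter (isOpen_lt continuous_const continuous_norm), ⟨y, hcon, hy⟩,
    contDiff_id.contDiffOn, fun u _ => by rw [fderiv_id]; exact Function.injective_id,
    fun z hz => ⟨interior_subset hz.1, by
      rw [mem_ball_zero_iff, not_lt]; exact (show R < ‖z‖ from hz.2).le⟩⟩
  omega

end PolyMap

end SingularOpenBook

end

/-! ### The equivalence. -/

theorem theorem3p2 (m p : ℕ) (hp : 2 ≤ p) (hpm : p ≤ m - 1)
    (P : Fin p → MvPolynomial (Fin m) ℝ)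
    (hcodim : SingularOpenBook.HasCodimAtInfinity p
      (SingularOpenBook.zeroLocus (SingularOpenBook.polyMap P)))
    (hM : Bornology.IsBounded
      (closure (SingularOpenBook.milnorSet Set.univ p (SingularOpenBook.polyMap P) \
          SingularOpenBook.zeroLocus (SingularOpenBook.polyMap P)) ∩
        SingularOpenBook.zeroLocus (SingularOpenBook.polyMap P))) :
    SingularOpenBook.InducesOpenBookAtInfinity (SingularOpenBook.polyMap P) ↔
      Bornology.IsBounded
        (SingularOpenBook.milnorSet (SingularOpenBook.zeroLocus (SingularOpenBook.polyMap P))ᶜ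
          (p - 1) (SingularOpenBook.normalized (SingularOpenBook.polyMap P))) := by
  constructor
  · rintro ⟨R₀, hR₀, hbook, -⟩
    exact Metric.isBounded_ball.subset
      (SingularOpenBook.milnorSet_subset_of_isSmoothFibration (by omega)
        (SingularOpenBook.contDiff_polyMap P) hR₀ fun R hR => (hbook R hR).fibration)
  · intro hM'
    obtain ⟨r₁, h₁⟩ := hM.subset_ball 0
    obtain ⟨r₂, h₂⟩ := hM'.subset_ball 0
    obtain ⟨r₃, h₃⟩ := Filter.eventually_atTop.1
      (SingularOpenBook.eventually_hasCodim_link hpm (by omega) P hcodim)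
    obtain ⟨a, ⟨⟨⟨ha₁, ha₂⟩, ha₃⟩, ha₀⟩, ha⟩ := (((((Filter.eventually_ge_atTop r₁).and
      (Filter.eventually_ge_atTop r₂)).and (Filter.eventually_ge_atTop r₃)).and
      (Filter.eventually_gt_atTop 0)).and hcodim.1).exists
    exact SingularOpenBook.inducesOpenBookAtInfinity_of_milnorSet_subset hp hpm
      (SingularOpenBook.contDiff_polyMap P) (SingularOpenBook.analyticOnNhd_polyMap P) ha₀
      (h₂.trans (Metric.ball_subset_ball ha₂)) (h₁.trans (Metric.ball_subset_ball ha₁))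
      (fun R hR => h₃ R (ha₃.trans hR.le))
      fun y hy => SingularOpenBook.mem_closure_compl_of_hasCodim (by omega) ha hy
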